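/- Let $k$ be a field, let $F,G$ be finite-dimensional division algebras over $k$, and let $M={}_FM_G$ be a finite-dimensional $F$-$G$-bimodule on which $k$ acts centrally and which is tame, i.e. $\dim{}_FM\cdot\dim M_G=4$. Put $\varepsilon=\sqrt{\dim{}_FM/\dim M_G}\in\{\tfrac12,1,2\}$. A finite-dimensional representation of $M$ is a triple $(U,V,\rho)$ with $U$ a right $F$-module, $V$ a right $G$-module and $\rho:U\otimes_FM\to V$ right $G$-linear; it is called regular if it is a finite direct sum of indecomposable representations $(U',V',\rho')$ with $\dim U'_F=\varepsilon\dim V'_G$, and regular-simple if it is regular, non-zero, and has no regular subrepresentations other than zero and itself. Let $p_1,\dots,p_t\ge 2$ be integers and let $\rho_i:U_i\otimes_FM\to V_i$ ($1\le i\le t$) be pairwise non-isomorphic regular-simple representations with endomorphism algebras $D_i$. Put $U_i^\vee=\mathrm{Hom}_{D_i}(U_i,D_i)$, $e_i=\dim{}_{D_i}U_i$ and $f_i=\dim(V_i)_G$. Assume that $$\theta_0:M\to\bigoplus_{i=1}^t\mathrm{Hom}_{D_i}(U_i,V_i),\qquad m\mapsto(\rho_i(-\otimes m))_i,$$ is injective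 and let $W$ be its cokernel. Let $B$ be the associated Coxeter-Dynkin algebra of canonical type, i.e. the matrix algebra with rows and columns indexed by $F$, by $i(j)$ ($1\le i\le t$, $1\le j\le p_i-1$) and by $G$, whose non-zero entries are: $F$ at $(F,F)$, $U_i^\vee$ at $(F,i(1))$, $W$ at $(F,G)$, $D_i$ at $(i(a),i(b))$ for $a\ge b$, $V_i$ at $(i(a),G)$, and $G$ at $(G,G)$; the multiplication is given by the bimodule structures and by the maps $U_i^\vee\otimes_{D_i}V_i\cong\mathrm{Hom}_{D_i}(U_i,V_i)\to W$. Let $S_F,S_i(j),S_G$ be the tops of the right $B$-modules $e_FB,e_i(j)B,e_GB$, where $e_F,e_i(j),e_G$ are the diagonal idempotents. Then these modules are, up to isomorphism, all simple right $B$-modules, and their classes form a $\mathbb Z$-basis of the Grothendieck group $\mathsf K_0(\mathsf{mod-}B)$ of finitely generated right $B$-modules. The spaces $\mathrm{Ext}^m_B(X,Y)$ are finite-dimensional and vanish for large $m$ (for fixed finitely generated $X,Y$), and there is exactly one biadditive form on $\mathsf K_0(\mathsf{mod-}B)$ (the Euler form) with $\langle[X],[Y]\rangle=\sum_{m\ge0}(-1)^m\dim_k\mathrm{Ext}_B^m(X,Y)$.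 Its non-vanishing values on the basis are \begin{align*} \langle[S_F],[S_F]\rangle&=\dim_kF, & \langle[S_F],[S_i(1)]\rangle&=-\varepsilon f_i\dim_kF,\\ \langle[S_F],[S_G]\rangle&=2\varepsilon\dim_kF, & \langle[S_i(j)],[S_i(j)]\rangle&=\tfrac{\varepsilon f_i}{e_i}\dim_kF\quad(1\le j\le p_i-1),\\ \langle[S_i(j+1)],[S_i(j)]\rangle&=-\tfrac{\varepsilon f_i}{e_i}\dim_kF\quad(1\le j\le p_i-2), & \langle[S_i(1)],[S_G]\rangle&=-\varepsilon^2f_i\dim_kF,\\ \langle[S_G],[S_G]\rangle&=\varepsilon^2\dim_kF && \end{align*} for $1\le i\le t$, where $e_i,f_i>0$; all other values on pairs of basis elements are $0$. Moreover the modules $e_FB,e_i(j)B,e_GB$ are projective, there is an exact sequence of right $B$-modules $$0\to(e_GB)^{\dim M_G}\to\bigoplus_{i=1}^t(e_i(1)B)^{e_i}\to e_FB\to S_F\to0,$$ and $\mathrm{Ext}^2_B(S_F,S_G)\cong M$ as $k$-vector spaces. -/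

import Mathlib

open CategoryTheory MulOpposite

universe u

namespace CoxeterDynkin

noncomputable section

/-! ### Representations of an `F`-`G`-bimodule -/

section Representations

variable (k F G M : Type u) [Field k] [DivisionRing F] [DivisionRing G]
  [Algebra k F] [Algebra k G] [AddCommGroup M] [Module k M] [Module F M] [Module Gᵐᵒᵖ M]

/-- A finite-dimensional representation `ρ : U ⊗_F M ⟶ V` of the bimodule `M`.
Right modules are modules over the opposite ring.  A morphism of right `G`-modules
`U ⊗_F M ⟶ V` is given as an `F`-balanced, right `G`-linear map in two variables. -/
structure BimodRep where
  /-- the right `F`-module -/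
  U : Type u
  /-- the right `G`-module -/
  V : Type u
  [addCommGroupU : AddCommGroup U]
  [addCommGroupV : AddCommGroup V]
  [moduleU : Module k U]
  [moduleV : Module k V]
  [moduleFU : Module Fᵐᵒᵖ U]
  [moduleGV : Module Gᵐᵒᵖ V]
  [towerU : IsScalarTower k Fᵐᵒᵖ U]
  [towerV : IsScalarTower k Gᵐᵒᵖ V]
  [finiteU : Module.Finite k U]
  [finiteV : Module.Finite k V]
  /-- the structure map -/
  ρ : U →ₗ[k] M →ₗ[k] V
  balanced : ∀ (u : U) (f : F) (m : M), ρ (op f • u) m = ρ u (f • m)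
  map_right : ∀ (u : U) (m : M) (g : G), ρ u (op g • m) = op g • ρ u m

attribute [instance] BimodRep.addCommGroupU BimodRep.addCommGroupV BimodRep.moduleU
  BimodRep.moduleV BimodRep.moduleFU BimodRep.moduleGV BimodRep.towerU BimodRep.towerV
  BimodRep.finiteU BimodRep.finiteV

/-- The bimodule `M` is tame: `dim _F M · dim M_G = 4`. -/
def IsTame : Prop := Module.finrank F M * Module.finrank Gᵐᵒᵖ M = 4

/-- `ε = √(dim _F M / dim M_G)`. -/
def epsilon : ℝ := Real.sqrt (Module.finrank F M / Module.finrank Gᵐᵒᵖ M)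

variable {k F G M}

namespace BimodRep

/-- Isomorphic representations. -/
def Isomorphic (X Y : BimodRep k F G M) : Prop :=
  ∃ (a : X.U ≃ₗ[Fᵐᵒᵖ] Y.U) (b : X.V ≃ₗ[Gᵐᵒᵖ] Y.V),
    ∀ (u : X.U) (m : M), Y.ρ (a u) m = b (X.ρ u m)

variable (X : BimodRep k F G M)

/-- Subrepresentations. -/
structure SubRep where
  /-- the `F`-part -/
  U : Submodule Fᵐᵒᵖ X.U
  /-- the `G`-part -/
  V : Submodule Gᵐᵒᵖ X.V
  map_mem : ∀ u ∈ U, ∀ m : M, X.ρ u m ∈ V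

variable {X}

namespace SubRep

/-- The zero subrepresentation. -/
def IsZero (Y : X.SubRep) : Prop := Y.U = ⊥ ∧ Y.V = ⊥

/-- The subrepresentation is the whole representation. -/
def IsTop (Y : X.SubRep) : Prop := Y.U = ⊤ ∧ Y.V = ⊤

/-- `Y` is an indecomposable representation: it is non-zero, and in every decomposition
`Y = Y₁ ⊕ Y₂` one of the two summands is zero. -/
def IsIndecomposable (Y : X.SubRep) : Prop :=
  ¬ Y.IsZero ∧ ∀ Y₁ Y₂ : X.SubRep,
    Y₁.U ⊓ Y₂.U = ⊥ → Y₁.V ⊓ Y₂.V = ⊥ → Y₁.U ⊔ Y₂.U = Y.U → Y₁.V ⊔ Y₂.V = Y.V →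
      Y₁.IsZero ∨ Y₂.IsZero

/-- `Y` is regular: it is a finite direct sum of indecomposable representations `Z i`, each
of which is regular, that is, satisfies `dim (Z i).U_F = ε · dim (Z i).V_G`
(indecomposables with `<` are preprojective, those with `>` are preinjective). -/
def IsRegular (Y : X.SubRep) : Prop :=
  ∃ (n : ℕ) (Z : Fin n → X.SubRep),
    (∀ i, (Z i).IsIndecomposable ∧
      (Module.finrank Fᵐᵒᵖ (Z i).U : ℝ) = epsilon F G M * Module.finrank Gᵐᵒᵖ (Z i).V) ∧
    iSupIndep (fun i => (Z i).U) ∧ iSupIndep (fun i => (Z i).V) ∧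
    ⨆ i, (Z i).U = Y.U ∧ ⨆ i, (Z i).V = Y.V

end SubRep

variable (X)

/-- The representation as a subrepresentation of itself. -/
def topSub : X.SubRep := ⟨⊤, ⊤, fun _ _ _ => Submodule.mem_top⟩

/-- Regular-simple representations: the simple objects of the category of regular
representations. -/
def IsRegularSimple : Prop :=
  X.topSub.IsRegular ∧ ¬ X.topSub.IsZero ∧
    ∀ Y : X.SubRep, Y.IsRegular → Y.IsZero ∨ Y.IsTop

/-- The pairs `(a, b)` of endomorphisms with `ρ (a u ⊗ m) = b (ρ (u ⊗ m))`. -/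
def endSubalgebra : Subalgebra k (Module.End Fᵐᵒᵖ X.U × Module.End Gᵐᵒᵖ X.V) where
  carrier := {d | ∀ (u : X.U) (m : M), X.ρ (d.1 u) m = d.2 (X.ρ u m)}
  mul_mem' := by
    intro a b ha hb u m
    simp only [Set.mem_ofPred_eq] at ha hb
    simp [ha, hb]
  add_mem' := by
    intro a b ha hb u m
    simp only [Set.mem_ofPred_eq] at ha hb
    simp [ha, hb]
  algebraMap_mem' := by
    intro r u m
    simp [Prod.algebraMap_apply, Module.algebraMap_end_apply]

/-- The endomorphism algebra `D` of a representation. -/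
def End : Type u := X.endSubalgebra

instance : Ring X.End := inferInstanceAs (Ring X.endSubalgebra)

instance : Algebra k X.End := inferInstanceAs (Algebra k X.endSubalgebra)

instance : Module X.End X.U :=
  Module.compHom X.U ((RingHom.fst (Module.End Fᵐᵒᵖ X.U) (Module.End Gᵐᵒᵖ X.V)).comp
    X.endSubalgebra.val.toRingHom)

instance : Module X.End X.V :=
  Module.compHom X.V ((RingHom.snd (Module.End Fᵐᵒᵖ X.U) (Module.End Gᵐᵒᵖ X.V)).comp
    X.endSubalgebra.val.toRingHom)

variable {X}

theorem End.smul_U (d : X.End) (u : X.U) : d • u = d.1.1 u := rfl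

theorem End.smul_V (d : X.End) (v : X.V) : d • v = d.1.2 v := rfl

instance : SMulCommClass X.End Fᵐᵒᵖ X.U := ⟨fun d f u => d.1.1.map_smul f u⟩

instance : SMulCommClass X.End Gᵐᵒᵖ X.V := ⟨fun d g v => d.1.2.map_smul g v⟩

instance : IsScalarTower k X.End X.U := ⟨fun _ _ _ => rfl⟩

instance : IsScalarTower k X.End X.V := ⟨fun _ _ _ => rfl⟩

instance : SMulCommClass X.End k X.U :=
  ⟨fun d c u => d.1.1.map_smul_of_tower c u⟩

instance : SMulCommClass X.End k X.V :=
  ⟨fun d c v => d.1.2.map_smul_of_tower c v⟩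

variable (X)

/-- The `D`-dual `U^∨ = Hom_D(U, D)`. -/
abbrev Dual : Type u := X.U →ₗ[X.End] X.End

/-- `Hom_D(U, V)`. -/
abbrev HomUV : Type u := X.U →ₗ[X.End] X.V

instance : AddCommGroup X.Dual := inferInstance

instance : Module k X.Dual := inferInstance

instance : AddCommGroup X.HomUV := inferInstance

instance : Module k X.HomUV := inferInstance

variable {X}

/-- Right multiplication `u ↦ u f` on `U`. -/
def rightMul (f : F) : X.U →ₗ[X.End] X.U where
  toFun u := op f • u
  map_add' u v := smul_add _ u v
  map_smul' d u := (smul_comm d (op f) u).symm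

/-- The left `F`-action on `U^∨`: `(f φ)(u) = φ (u f)`. -/
def dualLeft (f : F) (φ : X.Dual) : X.Dual := φ ∘ₗ rightMul f

/-- The right `D`-action on `U^∨`: `(φ d)(u) = φ u * d`. -/
def dualRight (φ : X.Dual) (d : X.End) : X.Dual where
  toFun u := φ u * d
  map_add' u u' := by rw [map_add, add_mul]
  map_smul' c u := by rw [map_smul, smul_mul_assoc]; rfl

/-- The map `U^∨ ⊗_D V → Hom_D(U, V)`, `φ ⊗ v ↦ (u ↦ φ u • v)`. -/
def dualTensor (φ : X.Dual) (v : X.V) : X.HomUV where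
  toFun u := φ u • v
  map_add' u u' := by rw [map_add, add_smul]
  map_smul' d u := by rw [map_smul, smul_eq_mul, mul_smul]; rfl

/-- The left `F`-action on `Hom_D(U, V)`: `(f h)(u) = h (u f)`. -/
def homLeft (f : F) : X.HomUV →ₗ[k] X.HomUV where
  toFun h := h ∘ₗ rightMul f
  map_add' _ _ := rfl
  map_smul' _ _ := rfl

/-- The right `G`-action on `Hom_D(U, V)`: `(h g)(u) = (h u) g`. -/
def homRight (g : G) : X.HomUV →ₗ[k] X.HomUV where
  toFun h := op g • h
  map_add' _ _ := smul_add _ _ _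
  map_smul' c h := by
    ext u
    exact (smul_comm c (op g) (h u)).symm

theorem dualLeft_apply (f : F) (φ : X.Dual) (u : X.U) : dualLeft f φ u = φ (op f • u) := rfl

theorem dualRight_apply (φ : X.Dual) (d : X.End) (u : X.U) : dualRight φ d u = φ u * d := rfl

theorem dualTensor_apply (φ : X.Dual) (v : X.V) (u : X.U) : dualTensor φ v u = φ u • v := rfl

theorem homLeft_apply (f : F) (h : X.HomUV) (u : X.U) : homLeft (k := k) f h u = h (op f • u) := rfl

theorem homRight_apply (g : G) (h : X.HomUV) (u : X.U) : homRight (k := k) g h u = op g • h u := rfl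

theorem algebraMap_smul_U (c : k) (u : X.U) : op (algebraMap k F c) • u = c • u :=
  algebraMap_smul Fᵐᵒᵖ c u

theorem algebraMap_smul_V (c : k) (v : X.V) : op (algebraMap k G c) • v = c • v :=
  algebraMap_smul Gᵐᵒᵖ c v

variable (X)

/-- The map `M ⟶ Hom_D(U, V)`, `m ↦ ρ(- ⊗ m)`. -/
def sharp : M →ₗ[k] X.HomUV where
  toFun m :=
    { toFun := fun u => X.ρ u m
      map_add' := fun u u' => by simp
      map_smul' := fun d u => d.2 u m }
  map_add' m m' := by ext u; exact (X.ρ u).map_add m m'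
  map_smul' c m := by ext u; exact (X.ρ u).map_smul c m

end BimodRep

end Representations

/-! ### The Coxeter-Dynkin algebra of canonical type -/

section Algebra

variable (k F G M : Type u) [Field k] [DivisionRing F] [DivisionRing G]
  [Algebra k F] [Algebra k G] [AddCommGroup M] [Module k M] [Module F M] [Module Gᵐᵒᵖ M]

/-- Weights `p₁, …, p_t ≥ 2` and representations `ρ₁, …, ρ_t` of `M`. -/
structure Datum where
  /-- the number of arms -/
  t : ℕ
  /-- the weights -/
  p : Fin t → ℕ
  two_le : ∀ i, 2 ≤ p i
  /-- the representations -/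
  rep : Fin t → BimodRep k F G M

variable {k F G M}

namespace Datum

variable (X : Datum k F G M)

/-- The set `{1, …, p_i - 1}` of labels of the vertices in the `i`-th arm. -/
abbrev Arm (i : Fin X.t) : Type := ↥(Finset.Icc 1 (X.p i - 1))

/-- The vertex labelled `1` in the `i`-th arm. -/
def one (i : Fin X.t) : X.Arm i :=
  ⟨1, Finset.mem_Icc.2 ⟨le_rfl, by have := X.two_le i; omega⟩⟩

theorem one_le {i : Fin X.t} (a : X.Arm i) : X.one i ≤ a := (Finset.mem_Icc.1 a.2).1

/-- `D_i = End(ρ_i)`. -/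
abbrev D (i : Fin X.t) : Type u := (X.rep i).End

/-- `e_i = dim _{D_i} U_i`. -/
def e (i : Fin X.t) : ℕ := Module.finrank (X.D i) (X.rep i).U

/-- `f_i = dim (V_i)_G`. -/
def f (i : Fin X.t) : ℕ := Module.finrank Gᵐᵒᵖ (X.rep i).V

/-- `θ₀ : M ⟶ ⨁ Hom_{D_i}(U_i, V_i)`, `m ↦ (ρ_i(- ⊗ m))_i`. -/
def theta : M →ₗ[k] (∀ i, (X.rep i).HomUV) := LinearMap.pi fun i => (X.rep i).sharp

/-- `W = cok θ₀`. -/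
abbrev W : Type u := (∀ i, (X.rep i).HomUV) ⧸ LinearMap.range X.theta

instance : AddCommGroup X.W := inferInstance

instance : Module k X.W := inferInstance

variable {X}

/-- The left `F`-action on `W`. -/
def wLeft (a : F) : X.W →ₗ[k] X.W :=
  Submodule.mapQ _ _ (LinearMap.pi fun i => BimodRep.homLeft a ∘ₗ LinearMap.proj i) <| by
    rintro _ ⟨m, rfl⟩
    refine ⟨a • m, ?_⟩
    ext i u
    exact ((X.rep i).balanced u a m).symm

/-- The right `G`-action on `W`. -/
def wRight (b : G) : X.W →ₗ[k] X.W :=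
  Submodule.mapQ _ _ (LinearMap.pi fun i => BimodRep.homRight b ∘ₗ LinearMap.proj i) <| by
    rintro _ ⟨m, rfl⟩
    refine ⟨op b • m, ?_⟩
    ext i u
    exact (X.rep i).map_right u m b

/-- The multiplication `⨁ U_i^∨ ⊗_{D_i} V_i ⟶ W` (composed with addition). -/
def wMul (φ : ∀ i, (X.rep i).Dual) (v : ∀ i, (X.rep i).V) : X.W :=
  Submodule.Quotient.mk fun i => BimodRep.dualTensor (φ i) (v i)


theorem wLeft_mk (a : F) (h : ∀ i, (X.rep i).HomUV) :
    wLeft a (Submodule.Quotient.mk h : X.W) =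
      Submodule.Quotient.mk fun i => BimodRep.homLeft (k := k) a (h i) := rfl

theorem wRight_mk (b : G) (h : ∀ i, (X.rep i).HomUV) :
    wRight b (Submodule.Quotient.mk h : X.W) =
      Submodule.Quotient.mk fun i => BimodRep.homRight (k := k) b (h i) := rfl

theorem wLeft_one (w : X.W) : wLeft (1 : F) w = w := by
  induction w using Submodule.Quotient.induction_on with
  | H h => rw [wLeft_mk]; congr 1; ext i u; simp [BimodRep.homLeft_apply]

theorem wRight_one (w : X.W) : wRight (1 : G) w = w := by
  induction w using Submodule.Quotient.induction_on with
  | H h => rw [wRight_mk]; congr 1; ext i u; simp [BimodRep.homRight_apply]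

theorem wLeft_mul (a b : F) (w : X.W) : wLeft (a * b) w = wLeft a (wLeft b w) := by
  induction w using Submodule.Quotient.induction_on with
  | H h => simp only [wLeft_mk]; congr 1; ext i u; simp [BimodRep.homLeft_apply, mul_smul]

theorem wRight_mul (a b : G) (w : X.W) : wRight (a * b) w = wRight b (wRight a w) := by
  induction w using Submodule.Quotient.induction_on with
  | H h => simp only [wRight_mk]; congr 1; ext i u; simp [BimodRep.homRight_apply, mul_smul]

theorem wLeft_wRight (a : F) (b : G) (w : X.W) : wLeft a (wRight b w) = wRight b (wLeft a w) := by
  induction w using Submodule.Quotient.induction_on with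
  | H h => rfl

theorem wLeft_add (a b : F) (w : X.W) : wLeft (a + b) w = wLeft a w + wLeft b w := by
  induction w using Submodule.Quotient.induction_on with
  | H h =>
    simp only [wLeft_mk, ← Submodule.Quotient.mk_add]
    congr 1; ext i u; simp [BimodRep.homLeft_apply, add_smul]

theorem wRight_add (a b : G) (w : X.W) : wRight (a + b) w = wRight a w + wRight b w := by
  induction w using Submodule.Quotient.induction_on with
  | H h =>
    simp only [wRight_mk, ← Submodule.Quotient.mk_add]
    congr 1; ext i u; simp [BimodRep.homRight_apply, add_smul]

theorem wLeft_smul (c : k) (a : F) (w : X.W) : wLeft (c • a) w = c • wLeft a w := by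
  induction w using Submodule.Quotient.induction_on with
  | H h =>
    simp only [wLeft_mk, ← Submodule.Quotient.mk_smul]
    congr 1; ext i u
    have h2 : op (c • a) • u = c • (op a • u) := smul_assoc c (op a) u
    rw [BimodRep.homLeft_apply, h2]
    exact (h i).map_smul_of_tower c _

theorem wRight_smul (c : k) (b : G) (w : X.W) : wRight (c • b) w = c • wRight b w := by
  induction w using Submodule.Quotient.induction_on with
  | H h =>
    simp only [wRight_mk, ← Submodule.Quotient.mk_smul]
    congr 1; ext i u
    exact smul_assoc c (op b) (h i u)

theorem wMul_add_left (φ ψ : ∀ i, (X.rep i).Dual) (v : ∀ i, (X.rep i).V) :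
    wMul (φ + ψ) v = wMul φ v + wMul ψ v := by
  simp only [wMul, ← Submodule.Quotient.mk_add]
  rfl

theorem wMul_add_right (φ : ∀ i, (X.rep i).Dual) (v v' : ∀ i, (X.rep i).V) :
    wMul φ (v + v') = wMul φ v + wMul φ v' := by
  simp only [wMul, ← Submodule.Quotient.mk_add]
  congr 1; ext i u; simp [BimodRep.dualTensor_apply, smul_add]

theorem wMul_zero_left (v : ∀ i, (X.rep i).V) : wMul (0 : ∀ i, (X.rep i).Dual) v = 0 := by
  simp only [wMul, ← Submodule.Quotient.mk_zero]
  rfl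

theorem wMul_zero_right (φ : ∀ i, (X.rep i).Dual) : wMul φ (0 : ∀ i, (X.rep i).V) = 0 := by
  simp only [wMul, ← Submodule.Quotient.mk_zero]
  congr 1; ext i u; simp [BimodRep.dualTensor_apply]

theorem wMul_smul_left (c : k) (φ : ∀ i, (X.rep i).Dual) (v : ∀ i, (X.rep i).V) :
    wMul (c • φ) v = c • wMul φ v := by
  simp only [wMul, ← Submodule.Quotient.mk_smul]
  rfl

theorem wMul_smul_right (c : k) (φ : ∀ i, (X.rep i).Dual) (v : ∀ i, (X.rep i).V) :
    wMul φ (c • v) = c • wMul φ v := by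
  simp only [wMul, ← Submodule.Quotient.mk_smul]
  congr 1; ext i u
  exact smul_comm (φ i u) c (v i)

theorem wLeft_wMul (a : F) (φ : ∀ i, (X.rep i).Dual) (v : ∀ i, (X.rep i).V) :
    wLeft a (wMul φ v) = wMul (fun i => BimodRep.dualLeft a (φ i)) v := rfl

theorem wRight_wMul (b : G) (φ : ∀ i, (X.rep i).Dual) (v : ∀ i, (X.rep i).V) :
    wRight b (wMul φ v) = wMul φ (fun i => op b • v i) := by
  simp only [wMul, wRight_mk]
  congr 1; ext i u
  simp [BimodRep.homRight_apply, BimodRep.dualTensor_apply, smul_comm]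

theorem wMul_dualRight (φ : ∀ i, (X.rep i).Dual) (d : ∀ i, X.D i) (v : ∀ i, (X.rep i).V) :
    wMul (fun i => BimodRep.dualRight (φ i) (d i)) v = wMul φ (fun i => d i • v i) := by
  simp only [wMul]
  rfl

variable (X)

/-- The block of the `i`-th arm: the matrices over `D_i` whose entry in row `a` and column `b`
vanishes unless `b ≤ a`.  (These are upper triangular if rows and columns are listed in the
order `p_i - 1, …, 1`.) -/
def Block (i : Fin X.t) : Subalgebra k (Matrix (X.Arm i) (X.Arm i) (X.D i)) where
  carrier := {A | ∀ a b, a < b → A a b = 0}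
  mul_mem' := by
    intro A B hA hB a b hab
    rw [Matrix.mul_apply]
    refine Finset.sum_eq_zero fun c _ => ?_
    rcases lt_or_ge a c with h | h
    · rw [hA a c h, zero_mul]
    · rw [hB c b (lt_of_le_of_lt h hab), mul_zero]
  add_mem' := by
    intro A B hA hB a b hab
    rw [Matrix.add_apply, hA a b hab, hB a b hab, add_zero]
  algebraMap_mem' := by
    intro r a b hab
    rw [Matrix.algebraMap_matrix_apply, if_neg hab.ne]

instance (i : Fin X.t) : Ring (X.Block i) := inferInstance

instance (i : Fin X.t) : Algebra k (X.Block i) := inferInstance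

/-- The Coxeter-Dynkin algebra `B` of canonical type, as an algebra of upper triangular
`3 × 3`-block matrices
```
  F   (0 ⋯ 0 U_i^∨)_i     W
      (Block i)_i         (V_i, …, V_i)_i
                          G
```
-/
@[ext]
structure CDAlgebra where
  /-- the `(F, F)`-entry -/
  cF : F
  /-- the `(F, i(1))`-entries; all other entries `(F, i(j))` are zero -/
  cU : ∀ i, (X.rep i).Dual
  /-- the `(F, G)`-entry -/
  cW : X.W
  /-- the `(i(a), i(b))`-entries; all entries `(i(a), i'(b))` with `i ≠ i'` are zero -/
  cD : ∀ i, X.Block i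
  /-- the `(i(a), G)`-entries -/
  cV : ∀ i, X.Arm i → (X.rep i).V
  /-- the `(G, G)`-entry -/
  cG : G

namespace CDAlgebra

variable {X}

/-- The underlying tuple of entries. -/
def equivProd : X.CDAlgebra ≃ F × (∀ i, (X.rep i).Dual) × X.W × (∀ i, X.Block i) ×
    (∀ i, X.Arm i → (X.rep i).V) × G where
  toFun x := (x.cF, x.cU, x.cW, x.cD, x.cV, x.cG)
  invFun y := ⟨y.1, y.2.1, y.2.2.1, y.2.2.2.1, y.2.2.2.2.1, y.2.2.2.2.2⟩
  left_inv _ := rfl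
  right_inv _ := rfl

/-- Entrywise addition. -/
instance : AddCommGroup X.CDAlgebra := equivProd.addCommGroup

/-- Entrywise scalar multiplication. -/
instance : Module k X.CDAlgebra := equivProd.module k

/-- Matrix multiplication. -/
instance : Mul X.CDAlgebra where
  mul x y :=
    { cF := x.cF * y.cF
      cU := fun i => BimodRep.dualLeft x.cF (y.cU i) +
        BimodRep.dualRight (x.cU i) ((y.cD i).1 (X.one i) (X.one i))
      cW := wLeft x.cF y.cW + wMul x.cU (fun i => y.cV i (X.one i)) + wRight y.cG x.cW
      cD := fun i => x.cD i * y.cD i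
      cV := fun i a => (∑ b, (x.cD i).1 a b • y.cV i b) + op y.cG • x.cV i a
      cG := x.cG * y.cG }

instance : One X.CDAlgebra where
  one := { cF := 1, cU := 0, cW := 0, cD := 1, cV := 0, cG := 1 }

@[simp] theorem add_cF (x y : X.CDAlgebra) : (x + y).cF = x.cF + y.cF := rfl
@[simp] theorem add_cU (x y : X.CDAlgebra) : (x + y).cU = x.cU + y.cU := rfl
@[simp] theorem add_cW (x y : X.CDAlgebra) : (x + y).cW = x.cW + y.cW := rfl
@[simp] theorem add_cD (x y : X.CDAlgebra) : (x + y).cD = x.cD + y.cD := rfl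
@[simp] theorem add_cV (x y : X.CDAlgebra) : (x + y).cV = x.cV + y.cV := rfl
@[simp] theorem add_cG (x y : X.CDAlgebra) : (x + y).cG = x.cG + y.cG := rfl
@[simp] theorem zero_cF : (0 : X.CDAlgebra).cF = 0 := rfl
@[simp] theorem zero_cU : (0 : X.CDAlgebra).cU = 0 := rfl
@[simp] theorem zero_cW : (0 : X.CDAlgebra).cW = 0 := rfl
@[simp] theorem zero_cD : (0 : X.CDAlgebra).cD = 0 := rfl
@[simp] theorem zero_cV : (0 : X.CDAlgebra).cV = 0 := rfl
@[simp] theorem zero_cG : (0 : X.CDAlgebra).cG = 0 := rfl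
@[simp] theorem one_cF : (1 : X.CDAlgebra).cF = 1 := rfl
@[simp] theorem one_cU : (1 : X.CDAlgebra).cU = 0 := rfl
@[simp] theorem one_cW : (1 : X.CDAlgebra).cW = 0 := rfl
@[simp] theorem one_cD : (1 : X.CDAlgebra).cD = 1 := rfl
@[simp] theorem one_cV : (1 : X.CDAlgebra).cV = 0 := rfl
@[simp] theorem one_cG : (1 : X.CDAlgebra).cG = 1 := rfl
@[simp] theorem smul_cF (c : k) (x : X.CDAlgebra) : (c • x).cF = c • x.cF := rfl
@[simp] theorem smul_cU (c : k) (x : X.CDAlgebra) : (c • x).cU = c • x.cU := rfl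
@[simp] theorem smul_cW (c : k) (x : X.CDAlgebra) : (c • x).cW = c • x.cW := rfl
@[simp] theorem smul_cD (c : k) (x : X.CDAlgebra) : (c • x).cD = c • x.cD := rfl
@[simp] theorem smul_cV (c : k) (x : X.CDAlgebra) : (c • x).cV = c • x.cV := rfl
@[simp] theorem smul_cG (c : k) (x : X.CDAlgebra) : (c • x).cG = c • x.cG := rfl
@[simp] theorem mul_cF (x y : X.CDAlgebra) : (x * y).cF = x.cF * y.cF := rfl
@[simp] theorem mul_cU (x y : X.CDAlgebra) : (x * y).cU = fun i =>
    BimodRep.dualLeft x.cF (y.cU i) +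
      BimodRep.dualRight (x.cU i) ((y.cD i).1 (X.one i) (X.one i)) := rfl
@[simp] theorem mul_cW (x y : X.CDAlgebra) : (x * y).cW =
    wLeft x.cF y.cW + wMul x.cU (fun i => y.cV i (X.one i)) + wRight y.cG x.cW := rfl
@[simp] theorem mul_cD (x y : X.CDAlgebra) : (x * y).cD = fun i => x.cD i * y.cD i := rfl
@[simp] theorem mul_cV (x y : X.CDAlgebra) : (x * y).cV = fun i a =>
    (∑ b, (x.cD i).1 a b • y.cV i b) + op y.cG • x.cV i a := rfl
@[simp] theorem mul_cG (x y : X.CDAlgebra) : (x * y).cG = x.cG * y.cG := rfl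

/-- The first row of a block has at most one non-zero entry. -/
theorem block_one {i : Fin X.t} (A : X.Block i) {b : X.Arm i} (hb : b ≠ X.one i) :
    A.1 (X.one i) b = 0 := A.2 _ _ (lt_of_le_of_ne (X.one_le b) hb.symm)

theorem block_mul_one {i : Fin X.t} (A B : X.Block i) :
    (A * B).1 (X.one i) (X.one i) = A.1 (X.one i) (X.one i) * B.1 (X.one i) (X.one i) := by
  change (A.1 * B.1) _ _ = _
  rw [Matrix.mul_apply, Finset.sum_eq_single (X.one i)]
  · intro b _ hb
    rw [block_one A hb, zero_mul]
  · intro h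
    exact absurd (Finset.mem_univ _) h

theorem block_sum_one {i : Fin X.t} (A : X.Block i) (v : X.Arm i → (X.rep i).V) :
    ∑ b, A.1 (X.one i) b • v b = A.1 (X.one i) (X.one i) • v (X.one i) := by
  rw [Finset.sum_eq_single (X.one i)]
  · intro b _ hb
    rw [block_one A hb, zero_smul]
  · intro h
    exact absurd (Finset.mem_univ _) h

/-- The ring structure of `B`. -/
instance : Ring X.CDAlgebra :=
  { (inferInstance : AddCommGroup X.CDAlgebra), (inferInstance : Mul X.CDAlgebra),
    (inferInstance : One X.CDAlgebra) with
    left_distrib := by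
      intro x y z
      ext1
      · simp [mul_add]
      · ext1 i; ext1 u
        simp [BimodRep.dualLeft_apply, BimodRep.dualRight_apply, mul_add]
        abel
      · have h : (fun i => y.cV i (X.one i) + z.cV i (X.one i)) =
            (fun i => y.cV i (X.one i)) + fun i => z.cV i (X.one i) := rfl
        simp only [mul_cW, add_cW, add_cV, add_cG, Pi.add_apply, map_add, wRight_add, h,
          wMul_add_right]
        abel
      · ext1 i; simp [mul_add]
      · ext i a
        simp [smul_add, Finset.sum_add_distrib, add_smul]
        abel
      · simp [mul_add]
    right_distrib := by
      intro x y z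
      ext1
      · simp [add_mul]
      · ext1 i; ext1 u
        simp [BimodRep.dualLeft_apply, BimodRep.dualRight_apply, add_mul, add_smul]
        abel
      · simp only [mul_cW, add_cF, add_cW, add_cU, map_add, wLeft_add, wMul_add_left]
        abel
      · ext1 i; simp [add_mul]
      · ext i a
        simp [smul_add, Finset.sum_add_distrib, add_smul]
        abel
      · simp [add_mul]
    zero_mul := by
      intro x
      ext1
      · simp
      · ext1 i; ext1 u; simp [BimodRep.dualLeft_apply, BimodRep.dualRight_apply]
      · have h := wLeft_smul (X := X) (0 : k) (0 : F) x.cW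
        simp only [zero_smul] at h
        simp [wMul_zero_left, h]
      · ext1 i; simp
      · ext i a; simp
      · simp
    mul_zero := by
      intro x
      ext1
      · simp
      · ext1 i; ext1 u; simp [BimodRep.dualLeft_apply, BimodRep.dualRight_apply]
      · have h := wRight_smul (X := X) (0 : k) (0 : G) x.cW
        simp only [zero_smul] at h
        have h' := wMul_zero_right x.cU
        simp only [mul_cW, zero_cW, map_zero, zero_cV, zero_cG, h, Pi.zero_apply, add_zero,
          zero_add]
        exact h'
      · ext1 i; simp
      · ext i a; simp
      · simp
    one_mul := by
      intro x
      ext1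
      · simp
      · ext1 i; ext1 u; simp [BimodRep.dualLeft_apply, BimodRep.dualRight_apply]
      · simp [wMul_zero_left, wLeft_one]
      · ext1 i; simp
      · ext i a; simp [Matrix.one_apply]
      · simp
    mul_one := by
      intro x
      ext1
      · simp
      · ext1 i; ext1 u; simp [BimodRep.dualLeft_apply, BimodRep.dualRight_apply]
      · have h' := wMul_zero_right x.cU
        simp only [mul_cW, one_cW, map_zero, one_cV, one_cG, wRight_one, Pi.zero_apply, zero_add]
        rw [show (fun i => (0 : (X.rep i).V)) = 0 from rfl, h', zero_add]
      · ext1 i; simp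
      · ext i a; simp
      · simp
    mul_assoc := by
      intro x y z
      ext1
      · simp [mul_assoc]
      · ext1 i; ext1 u
        simp only [mul_cU, mul_cF, mul_cD, block_mul_one, LinearMap.add_apply,
          BimodRep.dualLeft_apply, BimodRep.dualRight_apply, op_mul, mul_smul, add_mul, mul_assoc,
          add_assoc]
      · have h : wMul x.cU (fun i => (y * z).cV i (X.one i)) =
            wMul (fun i => BimodRep.dualRight (x.cU i) ((y.cD i).1 (X.one i) (X.one i)))
              (fun i => z.cV i (X.one i)) +
            wRight z.cG (wMul x.cU fun i => y.cV i (X.one i)) := by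
          rw [wMul_dualRight, wRight_wMul, ← wMul_add_right]
          simp only [mul_cV, block_sum_one]
          rfl
        have h2 : wMul (x * y).cU (fun i => z.cV i (X.one i)) =
            wLeft x.cF (wMul y.cU fun i => z.cV i (X.one i)) +
            wMul (fun i => BimodRep.dualRight (x.cU i) ((y.cD i).1 (X.one i) (X.one i)))
              (fun i => z.cV i (X.one i)) := by
          rw [wLeft_wMul, ← wMul_add_left]
          rfl
        rw [mul_cW, mul_cW x (y * z), h, h2]
        simp only [mul_cW, mul_cF, mul_cG, map_add, wLeft_mul, wRight_mul, wLeft_wRight]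
        abel
      · ext1 i; simp [mul_assoc]
      · ext i a
        simp only [mul_cV, mul_cD, mul_cG, op_mul, mul_smul, smul_add, Finset.smul_sum,
          Finset.sum_add_distrib, ← add_assoc]
        congr 1
        congr 1
        · have : ∀ b, ((x.cD i * y.cD i : X.Block i)).1 a b =
              ∑ c, (x.cD i).1 a c * (y.cD i).1 c b := fun b => Matrix.mul_apply
          simp only [this, Finset.sum_smul]
          rw [Finset.sum_comm]
          simp only [mul_smul]
        · exact Finset.sum_congr rfl fun b _ =>
            (smul_comm ((x.cD i).1 a b) (op z.cG) (y.cV i b)).symm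
      · simp [mul_assoc] }

/-- The `k`-algebra structure of `B`. -/
instance : Algebra k X.CDAlgebra :=
  Algebra.ofModule
    (by
      intro c x y
      ext1
      · simp
      · ext1 i; ext1 u
        have h := ((y.cU i).map_smul_of_tower c (op x.cF • u))
        have h2 : op (c • x.cF) • u = c • (op x.cF • u) := smul_assoc c (op x.cF) u
        simp [BimodRep.dualLeft_apply, BimodRep.dualRight_apply, h2, -op_smul, h]
      · simp [wLeft_smul, wMul_smul_left, smul_add]
      · ext1 i; simp
      · ext i a; simp [smul_add, Finset.smul_sum, smul_comm c (op y.cG)]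
      · simp)
    (by
      intro c x y
      ext1
      · simp
      · ext1 i; ext1 u
        simp [BimodRep.dualLeft_apply, BimodRep.dualRight_apply]
      · have h := wMul_smul_right c x.cU (fun i => y.cV i (X.one i))
        simp only [mul_cW, smul_cW, map_smul, smul_cV, smul_cG, wRight_smul, smul_add]
        rw [← h]
        rfl
      · ext1 i; simp
      · ext i a
        have h2 : op (c • y.cG) • x.cV i a = c • (op y.cG • x.cV i a) :=
          smul_assoc c (op y.cG) (x.cV i a)
        have h3 : ∀ b, (x.cD i).1 a b • c • y.cV i b = c • (x.cD i).1 a b • y.cV i b :=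
          fun b => smul_comm _ _ _
        simp [smul_add, Finset.smul_sum, h2, h3, -op_smul]
      · simp)

end CDAlgebra
end Datum
end Algebra

/-! ### The Grothendieck group and the Euler form -/

section Grothendieck

variable (k R : Type u) [Field k] [Ring R] [Algebra k R]

/-- The relations `[Y] = [X] + [Z]` for all short exact sequences `0 → X → Y → Z → 0` of
finitely generated right `R`-modules. -/
def K0Relations : AddSubgroup (FreeAbelianGroup (FGModuleCat.{u} Rᵐᵒᵖ)) :=
  AddSubgroup.closure {x | ∃ (X Y Z : FGModuleCat.{u} Rᵐᵒᵖ) (f : X.obj →ₗ[Rᵐᵒᵖ] Y.obj)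
    (g : Y.obj →ₗ[Rᵐᵒᵖ] Z.obj), Function.Injective f ∧ Function.Exact f g ∧
      Function.Surjective g ∧
      x = FreeAbelianGroup.of Y - FreeAbelianGroup.of X - FreeAbelianGroup.of Z}

/-- The Grothendieck group `K₀(mod-R)` of the category of finitely generated right
`R`-modules. -/
abbrev K0 : Type (u + 1) := FreeAbelianGroup (FGModuleCat.{u} Rᵐᵒᵖ) ⧸ K0Relations R

variable {R}

/-- The class `[X]` of a finitely generated right `R`-module. -/
def cls (X : FGModuleCat.{u} Rᵐᵒᵖ) : K0 R := QuotientAddGroup.mk (FreeAbelianGroup.of X)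

/-- `∑_m (-1)^m dim_k Ext^m_R(X, Y)`. -/
def eulerChar (X Y : FGModuleCat.{u} Rᵐᵒᵖ) : ℤ :=
  ∑ᶠ m : ℕ, (-1) ^ m * (Module.finrank k (Abelian.Ext X.obj Y.obj m) : ℤ)

/-- For all finitely generated right `R`-modules the spaces `Ext^m_R(X, Y)` are
finite-dimensional, and zero for almost all `m`. -/
def HasFiniteExt (R : Type u) [Ring R] [Algebra k R] : Prop :=
  ∀ X Y : FGModuleCat.{u} Rᵐᵒᵖ,
    (∀ m : ℕ, Module.Finite k (Abelian.Ext X.obj Y.obj m)) ∧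
    ∃ N : ℕ, ∀ m : ℕ, N ≤ m → Subsingleton (Abelian.Ext X.obj Y.obj m)

/-- `E` is the Euler form on `K₀(mod-R)`. -/
def IsEulerForm (E : K0 R →+ K0 R →+ ℤ) : Prop :=
  ∀ X Y : FGModuleCat.{u} Rᵐᵒᵖ, E (cls X) (cls Y) = eulerChar k X Y

end Grothendieck

/-! ### The simple modules -/

section Simples

variable {k F G M : Type u} [Field k] [DivisionRing F] [DivisionRing G]
  [Algebra k F] [Algebra k G] [AddCommGroup M] [Module k M] [Module F M] [Module Gᵐᵒᵖ M]

namespace Datum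

variable (X : Datum k F G M)

/-- The vertices `F`, `i(j)` for `1 ≤ j ≤ p_i - 1`, and `G`. -/
inductive Vertex : Type
  | F : Vertex
  | arm (i : Fin X.t) (j : X.Arm i) : Vertex
  | G : Vertex

variable {X}

/-- The primitive idempotents `e_F`, `e_i(j)`, `e_G` of `B`: the diagonal matrices with a single
entry `1`. -/
def idem : X.Vertex → X.CDAlgebra
  | .F => { cF := 1, cU := 0, cW := 0, cD := 0, cV := 0, cG := 0 }
  | .arm i j =>
      { cF := 0, cU := 0, cW := 0
        cD := Pi.single i ⟨Matrix.diagonal (Pi.single j 1),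
          fun _ _ h => Matrix.diagonal_apply_ne _ h.ne⟩
        cV := 0, cG := 0 }
  | .G => { cF := 0, cU := 0, cW := 0, cD := 0, cV := 0, cG := 1 }

/-- The right `B`-module `e_x B`. -/
def projective (x : X.Vertex) : Submodule X.CDAlgebraᵐᵒᵖ X.CDAlgebra :=
  Submodule.span X.CDAlgebraᵐᵒᵖ {idem x}

instance (x : X.Vertex) : Module.Finite X.CDAlgebraᵐᵒᵖ (projective x) :=
  inferInstanceAs (Module.Finite X.CDAlgebraᵐᵒᵖ (Submodule.span X.CDAlgebraᵐᵒᵖ {idem x}))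

/-- The right `B`-module `S_x = top (e_x B)`, the quotient by the radical. -/
def simple (x : X.Vertex) : FGModuleCat.{u} X.CDAlgebraᵐᵒᵖ :=
  FGModuleCat.of X.CDAlgebraᵐᵒᵖ
    (projective x ⧸ Module.jacobson X.CDAlgebraᵐᵒᵖ (projective x))

end Datum
end Simples

end

end CoxeterDynkin

namespace CoxeterDynkin

noncomputable section

set_option linter.unusedSectionVars false

/-! ### Dimensions over a tame bimodule -/

section Dimensions

variable {k F G M : Type u} [Field k] [DivisionRing F] [DivisionRing G]
  [Algebra k F] [Algebra k G] [AddCommGroup M] [Module k M] [Module F M] [Module Gᵐᵒᵖ M]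

/-! The crux is that each D_i is a division algebra, i.e. that a regular-simple representation X is
a brick (`IsRegularSimple.isBrick`). Such an X is indecomposable of defect dim U_F - ε dim V_G = 0.
If X is not a brick, a non-zero non-invertible endomorphism of least rank has square zero by
Fitting, and its kernel has an indecomposable summand K to which its image projects non-trivially.
If Ext¹(K, K) were zero, K would be a retract of X; so K is a proper indecomposable
subrepresentation with self-extensions (`exists_indecomposable_not_surjective`). Descending in
dimension, one may take K to be a brick, unless a proper subrepresentation of defect zero has
already been found. For a brick with self-extensions, Ext¹(K, K) is a non-zero module over the
division algebra End K, so dim End K ≤ dim Ext¹(K, K). For a tame bimodule dim End - dim Ext¹ is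
dim_k F times the square of the defect, so K has defect zero (`IsBrick.defect_eq_zero`). Thus K is
regular, contrary to X being regular-simple.

Now e_x B e_x is F, D_i or G, so every e_x is a local idempotent: e_x B has a unique maximal
submodule, its top is simple, and every simple module is such a top because the e_x sum to 1.

The rows of the matrix algebra give projective resolutions. S_G is e_G B itself. The radical of
e_i(1)B is V_i, a sum of f_i copies of e_G B, and the radical of e_i(j+1)B is e_i(j)B. The radical
of e_F B consists of the entries in the U_i^∨ and W; dual bases of the U_i cover it by ⨁
(e_i(1)B)^{e_i}. An element of this cover dies in e_F B exactly when its D_i-entries vanish and its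
V_i-entries, read in ⨁ Hom(U_i, V_i), vanish in W = cok θ₀, that is, come from M. As θ₀ is
injective, the kernel is M, a sum of dim M_G copies of e_G B (`coverF_exact`, `syzygyF_exact`,
`syzygyF_injective`).

Hence every simple module has finite projective dimension, Ext is finite by induction on the length,
and Euler characteristics descend to K₀. Since ⟨e_x B, S_y⟩ is zero for x ≠ y and dim_k(e_x B e_x)
for x = y, the classes of the simples are independent and the resolutions yield all values of the
form. The number dim_k D_i is found by counting dim_k U_i over D_i and over F. Finally, Ext²(S_F,
S_G) is Hom((e_G B)^n, S_G) by two dimension shifts, where n = dim M_G, and this has the dimension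
of M. -/

theorem finrank_opposite (k A : Type*) [Field k] [Ring A] [Algebra k A] :
    Module.finrank k Aᵐᵒᵖ = Module.finrank k A :=
  (opLinearEquiv k (M := A)).finrank_eq.symm

theorem finrank_eq_mul_right [Module.Finite k F] (U : Type*) [AddCommGroup U] [Module k U]
    [Module Fᵐᵒᵖ U] [IsScalarTower k Fᵐᵒᵖ U] :
    Module.finrank k U = Module.finrank k F * Module.finrank Fᵐᵒᵖ U := by
  rw [← Module.finrank_mul_finrank k Fᵐᵒᵖ U, finrank_opposite]

/-- Writing a and b for the two dimensions of M, ab = 4 turns a/b into (a/2)², which removes the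
square root from ε. -/
theorem IsTame.finrank_left (hM : IsTame F G M) :
    (Module.finrank F M : ℝ) = 2 * epsilon F G M := by
  have h : (Module.finrank F M : ℝ) * Module.finrank Gᵐᵒᵖ M = 4 := by exact_mod_cast hM
  have hb : (0 : ℝ) < Module.finrank Gᵐᵒᵖ M := by
    rcases Nat.eq_zero_or_pos (Module.finrank Gᵐᵒᵖ M) with h0 | h0
    · rw [h0] at h; norm_num at h
    · exact_mod_cast h0
  have ha : (0 : ℝ) ≤ Module.finrank F M := Nat.cast_nonneg _
  rw [epsilon, show (Module.finrank F M : ℝ) / Module.finrank Gᵐᵒᵖ M =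
    (Module.finrank F M / 2) ^ 2 by
      rw [div_eq_iff hb.ne', div_pow, pow_two]
      linear_combination (-(Module.finrank F M : ℝ) / 4) * h, Real.sqrt_sq (by positivity)]
  ring

theorem IsTame.epsilon_mul_finrank_right (hM : IsTame F G M) :
    epsilon F G M * Module.finrank Gᵐᵒᵖ M = 2 := by
  have h : (Module.finrank F M : ℝ) * Module.finrank Gᵐᵒᵖ M = 4 := by exact_mod_cast hM
  rw [hM.finrank_left] at h
  linarith

theorem IsTame.epsilon_pos (hM : IsTame F G M) : 0 < epsilon F G M := by
  refine lt_of_le_of_ne (Real.sqrt_nonneg _) fun h => ?_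
  have h2 := hM.epsilon_mul_finrank_right
  rw [← h] at h2
  norm_num at h2

theorem IsTame.finrank_bimodule [Module.Finite k F] [IsScalarTower k F M] (hM : IsTame F G M) :
    (Module.finrank k M : ℝ) = 2 * epsilon F G M * Module.finrank k F := by
  rw [← Module.finrank_mul_finrank k F M, Nat.cast_mul, hM.finrank_left, mul_comm]

/-- Count dim_k M from the left over F and from the right over G. -/
theorem IsTame.finrank_right_algebra [IsScalarTower k F M] [IsScalarTower k Gᵐᵒᵖ M]
    [Module.Finite k F] [Module.Finite k G]
    (hM : IsTame F G M) :
    (Module.finrank k G : ℝ) = epsilon F G M ^ 2 * Module.finrank k F := by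
  have h := hM.finrank_bimodule (k := k)
  rw [finrank_eq_mul_right (F := G), Nat.cast_mul] at h
  linear_combination (epsilon F G M / 2) * h -
    (Module.finrank k G / 2 : ℝ) * hM.epsilon_mul_finrank_right

end Dimensions

namespace BimodRep

variable {k F G M : Type u} [Field k] [DivisionRing F] [DivisionRing G]
  [Algebra k F] [Algebra k G] [AddCommGroup M] [Module k M] [Module F M] [Module Gᵐᵒᵖ M]

/-! ### Bricks -/

/-- Every non-zero endomorphism of `X` is invertible. -/
def IsBrick (X : BimodRep k F G M) : Prop := ∀ d : X.End, d ≠ 0 → IsUnit d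

variable (X : BimodRep k F G M)

instance : Module.Finite Fᵐᵒᵖ X.U := Module.Finite.of_restrictScalars_finite k Fᵐᵒᵖ X.U

instance : Module.Finite Gᵐᵒᵖ X.V := Module.Finite.of_restrictScalars_finite k Gᵐᵒᵖ X.V

variable {X}

/-- A bijective endomorphism is invertible. -/
theorem End.isUnit_of_injective (d : X.End) (h₁ : Function.Injective d.1.1)
    (h₂ : Function.Injective d.1.2) : IsUnit d := by
  let a := LinearEquiv.ofBijective d.1.1 ⟨h₁, LinearMap.surjective_of_injective h₁⟩
  let b := LinearEquiv.ofBijective d.1.2 ⟨h₂, LinearMap.surjective_of_injective h₂⟩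
  have ha : ∀ u, d.1.1 (a.symm u) = u := a.apply_symm_apply
  have hb : ∀ u, d.1.2 (b.symm u) = u := b.apply_symm_apply
  let c : X.End := ⟨(a.symm.toLinearMap, b.symm.toLinearMap), fun u m => by
    apply h₂
    have := d.2 (a.symm u) m
    change X.ρ (d.1.1 _) m = _ at this
    rw [ha] at this
    change d.1.2 _ = d.1.2 (b.symm _)
    rw [hb]
    exact this.symm⟩
  refine ⟨⟨d, c, ?_, ?_⟩, rfl⟩
  · apply Subtype.ext
    exact Prod.ext (LinearMap.ext ha) (LinearMap.ext hb)
  · apply Subtype.ext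
    exact Prod.ext (LinearMap.ext a.symm_apply_apply) (LinearMap.ext b.symm_apply_apply)

/-! ### The Euler form of representations -/

variable (X)

/-- The balanced right `G`-linear maps `U ⊗_F M ⟶ V`. -/
def balancedMaps : Submodule k (X.U →ₗ[k] M →ₗ[k] X.V) where
  carrier := {c | (∀ u (f : F) m, c (op f • u) m = c u (f • m)) ∧
    ∀ u m (g : G), c u (op g • m) = op g • c u m}
  add_mem' := fun hc hd => ⟨fun u f m => by simp [hc.1, hd.1], fun u m g => by simp [hc.2, hd.2]⟩
  zero_mem' := by simp
  smul_mem' := fun r c hc => ⟨fun u f m => by simp [hc.1], fun u m g => by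
    simp [hc.2, smul_comm r (op g)]⟩

/-- The map `(a, b) ↦ ρ (a u ⊗ m) - b (ρ (u ⊗ m))`, with kernel `End X` and cokernel
`Ext¹(X, X)`. -/
def commutatorMap :
    ((X.U →ₗ[Fᵐᵒᵖ] X.U) × (X.V →ₗ[Gᵐᵒᵖ] X.V)) →ₗ[k] X.balancedMaps where
  toFun d := ⟨LinearMap.mk₂ k (fun u m => X.ρ (d.1 u) m - d.2 (X.ρ u m))
      (fun u u' m => by simp; abel)
      (fun r u m => by
        rw [d.1.map_smul_of_tower, map_smul, map_smul, LinearMap.smul_apply, LinearMap.smul_apply,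
          d.2.map_smul_of_tower, smul_sub])
      (fun u m m' => by simp; abel)
      (fun r u m => by simp [d.2.map_smul_of_tower, smul_sub]),
    fun u f m => by simp [X.balanced],
    fun u m g => by simp [X.map_right, smul_sub]⟩
  map_add' d d' := by
    ext u m
    simp; abel
  map_smul' r d := by
    ext u m
    simp [smul_sub]

theorem commutatorMap_apply (d : (X.U →ₗ[Fᵐᵒᵖ] X.U) × (X.V →ₗ[Gᵐᵒᵖ] X.V)) (u : X.U) (m : M) :
    (X.commutatorMap d).1 u m = X.ρ (d.1 u) m - d.2 (X.ρ u m) := rfl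

theorem finrank_end_right {A : Type u} [DivisionRing A] [Algebra k A] [Module.Finite k A]
    (U : Type u) [AddCommGroup U] [Module k U] [Module Aᵐᵒᵖ U] [IsScalarTower k Aᵐᵒᵖ U]
    [Module.Finite k U] :
    Module.finrank k (U →ₗ[Aᵐᵒᵖ] U) =
      Module.finrank Aᵐᵒᵖ U * (Module.finrank k A * Module.finrank Aᵐᵒᵖ U) := by
  have : Module.Finite Aᵐᵒᵖ U := Module.Finite.of_restrictScalars_finite k Aᵐᵒᵖ U
  rw [← ((Module.finBasis Aᵐᵒᵖ U).constr k (M' := U)).finrank_eq, Module.finrank_pi_fintype]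
  simp [finrank_eq_mul_right (k := k) (F := A) U]

theorem mem_ker_commutatorMap {d : (X.U →ₗ[Fᵐᵒᵖ] X.U) × (X.V →ₗ[Gᵐᵒᵖ] X.V)}
    (hd : X.commutatorMap d = 0) (u : X.U) (m : M) : X.ρ (d.1 u) m = d.2 (X.ρ u m) :=
  sub_eq_zero.1 (LinearMap.congr_fun (LinearMap.congr_fun (congr_arg Subtype.val hd) u) m)

theorem finite_end_right {A : Type u} [DivisionRing A] [Algebra k A]
    (U : Type u) [AddCommGroup U] [Module k U] [Module Aᵐᵒᵖ U] [IsScalarTower k Aᵐᵒᵖ U]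
    [Module.Finite k U] : Module.Finite k (U →ₗ[Aᵐᵒᵖ] U) :=
  have : Module.Finite Aᵐᵒᵖ U := Module.Finite.of_restrictScalars_finite k Aᵐᵒᵖ U
  Module.Finite.equiv ((Module.finBasis Aᵐᵒᵖ U).constr k (M' := U))

/-- The hypothesis says that g embeds ker f into coker f, and dim A - dim W = dim ker f - dim coker
f. It will be applied to the commutator map, whose kernel is End X and whose cokernel is Ext¹(X, X).
-/
theorem finrank_le_of_ker {A W : Type*} [AddCommGroup A] [AddCommGroup W]
    [Module k A] [Module k W] [Module.Finite k A] [Module.Finite k W] (f : A →ₗ[k] W)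
    (g : LinearMap.ker f →ₗ[k] W) (h : ∀ e, g e ∈ LinearMap.range f → e = 0) :
    Module.finrank k A ≤ Module.finrank k W := by
  have hinj : Function.Injective ((LinearMap.range f).mkQ ∘ₗ g) := by
    rw [injective_iff_map_eq_zero]
    intro e he
    exact h e ((Submodule.Quotient.mk_eq_zero _).1 he)
  have h1 := LinearMap.finrank_le_finrank_of_injective hinj
  have h2 := (LinearMap.range f).finrank_quotient_add_finrank
  have h3 := f.finrank_range_add_finrank_ker
  omega

/-- The action of `End X` on the balanced maps through `V`. -/
def endAct (e : X.End) (c : X.balancedMaps) : X.balancedMaps :=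
  ⟨LinearMap.mk₂ k (fun u m => e.1.2 (c.1 u m)) (fun u u' m => by simp)
    (fun r u m => by simp [e.1.2.map_smul_of_tower]) (fun u m m' => by simp)
    (fun r u m => by simp [e.1.2.map_smul_of_tower]),
  fun u f m => by simp [c.2.1], fun u m g => by simp [c.2.2]⟩

/-- This equivariance makes End X act on the cokernel Ext¹(X, X). -/
theorem commutatorMap_mul (e : X.End) (d : (X.U →ₗ[Fᵐᵒᵖ] X.U) × (X.V →ₗ[Gᵐᵒᵖ] X.V)) :
    X.commutatorMap (e.1.1 ∘ₗ d.1, e.1.2 ∘ₗ d.2) = X.endAct e (X.commutatorMap d) := by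
  apply Subtype.ext
  ext u m
  have := e.2 (d.1 u) m
  change X.ρ (e.1.1 (d.1 u)) m = e.1.2 _ at this
  simp [commutatorMap_apply, endAct, this]

variable [Module.Finite k G] [Module.Finite k M] [IsScalarTower k Gᵐᵒᵖ M]

/-- A balanced map is determined by its values on pairs from an F-basis of U and a G-basis of M.
Only this upper bound on the dimension is needed. -/
theorem finrank_balancedMaps_le :
    Module.finrank k X.balancedMaps ≤ Module.finrank Fᵐᵒᵖ X.U *
      (Module.finrank Gᵐᵒᵖ M * (Module.finrank k G * Module.finrank Gᵐᵒᵖ X.V)) := by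
  have : Module.Finite Gᵐᵒᵖ M := Module.Finite.of_restrictScalars_finite k Gᵐᵒᵖ M
  let bU := Module.finBasis Fᵐᵒᵖ X.U
  let bM := Module.finBasis Gᵐᵒᵖ M
  let φ : X.balancedMaps →ₗ[k] (Fin (Module.finrank Fᵐᵒᵖ X.U) →
      Fin (Module.finrank Gᵐᵒᵖ M) → X.V) :=
    { toFun := fun c i j => c.1 (bU i) (bM j)
      map_add' := fun _ _ => rfl
      map_smul' := fun _ _ => rfl }
  have hφ : Function.Injective φ := by
    rw [injective_iff_map_eq_zero]
    intro c hc
    have h1 : ∀ i m, c.1 (bU i) m = 0 := by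
      intro i m
      rw [← bM.sum_repr m, map_sum]
      refine Finset.sum_eq_zero fun j _ => ?_
      have := c.2.2 (bU i) (bM j) (unop (bM.repr m j))
      rw [op_unop] at this
      rw [this, show c.1 (bU i) (bM j) = 0 from congr_fun (congr_fun hc i) j, smul_zero]
    apply Subtype.ext
    ext u m
    rw [← bU.sum_repr u, map_sum, LinearMap.sum_apply]
    refine Finset.sum_eq_zero fun i _ => ?_
    have := c.2.1 (bU i) (unop (bU.repr u i)) m
    rw [op_unop] at this
    rw [this, h1]
  refine (LinearMap.finrank_le_finrank_of_injective hφ).trans (le_of_eq ?_)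
  rw [Module.finrank_pi_fintype]
  simp [Module.finrank_pi_fintype, finrank_eq_mul_right (k := k) (F := G) X.V]

variable [Module.Finite k F] [IsScalarTower k F M]

/-- Here c represents a non-zero class in Ext¹(X, X) and e annihilates that class. Were e non-zero,
its inverse would carry the trivial class e c back to c. -/
theorem IsBrick.eq_zero_of_endAct {X : BimodRep k F G M} (hX : X.IsBrick) {c : X.balancedMaps}
    (hc : ∀ d, X.commutatorMap d ≠ c) (e : X.End)
    (d : (X.U →ₗ[Fᵐᵒᵖ] X.U) × (X.V →ₗ[Gᵐᵒᵖ] X.V)) (hd : X.commutatorMap d = X.endAct e c) :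
    e = 0 := by
  by_contra hne
  obtain ⟨⟨a, a', h1, h2⟩, rfl⟩ := hX e hne
  refine hc (a'.1.1 ∘ₗ d.1, a'.1.2 ∘ₗ d.2) ?_
  rw [commutatorMap_mul, hd]
  apply Subtype.ext
  ext u m
  change a'.1.2 (a.1.2 (c.1 u m)) = _
  have h3 : a'.1.2 * a.1.2 = 1 := congr_arg (fun x : X.End => x.1.2) h2
  exact LinearMap.congr_fun h3 _

/-- The orbit map of a balanced map under `End X`. -/
def orbitMap (c : X.balancedMaps) : LinearMap.ker X.commutatorMap →ₗ[k] X.balancedMaps where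
  toFun e := X.endAct ⟨e.1, X.mem_ker_commutatorMap e.2⟩ c
  map_add' _ _ := Subtype.ext <| by ext u m; rfl
  map_smul' _ _ := Subtype.ext <| by ext u m; rfl

/-- The orbit map of a non-zero class embeds End X into Ext¹(X, X), so dim End ≤ dim Ext¹; stated
for the source and target of the commutator map. -/
theorem IsBrick.finrank_le {X : BimodRep k F G M} (hX : X.IsBrick)
    (hext : ¬ Function.Surjective X.commutatorMap) :
    Module.finrank k ((X.U →ₗ[Fᵐᵒᵖ] X.U) × (X.V →ₗ[Gᵐᵒᵖ] X.V)) ≤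
      Module.finrank k X.balancedMaps := by
  obtain ⟨c, hc⟩ : ∃ c, ∀ d, X.commutatorMap d ≠ c := by
    by_contra! h
    exact hext h
  have := finite_end_right (k := k) (A := F) X.U
  have := finite_end_right (k := k) (A := G) X.V
  refine finrank_le_of_ker (A := (X.U →ₗ[Fᵐᵒᵖ] X.U) × (X.V →ₗ[Gᵐᵒᵖ] X.V))
    (W := X.balancedMaps) X.commutatorMap (X.orbitMap c) fun e he => ?_
  obtain ⟨d, hd⟩ := he
  exact Subtype.ext (congr_arg (·.1) (hX.eq_zero_of_endAct hc _ d hd))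

/-- A brick with self-extensions has defect zero. -/
theorem IsBrick.defect_eq_zero {X : BimodRep k F G M} (hX : X.IsBrick) (hM : IsTame F G M)
    (hext : ¬ Function.Surjective X.commutatorMap) :
    (Module.finrank Fᵐᵒᵖ X.U : ℝ) = epsilon F G M * Module.finrank Gᵐᵒᵖ X.V := by
  have h1 := hX.finrank_le hext
  have := finite_end_right (k := k) (A := F) X.U
  have := finite_end_right (k := k) (A := G) X.V
  rw [Module.finrank_prod, finrank_end_right, finrank_end_right] at h1
  have h4 := X.finrank_balancedMaps_le
  have h5 : Module.finrank Fᵐᵒᵖ X.U * (Module.finrank k F * Module.finrank Fᵐᵒᵖ X.U) +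
      Module.finrank Gᵐᵒᵖ X.V * (Module.finrank k G * Module.finrank Gᵐᵒᵖ X.V) ≤
      Module.finrank Fᵐᵒᵖ X.U *
      (Module.finrank Gᵐᵒᵖ M * (Module.finrank k G * Module.finrank Gᵐᵒᵖ X.V)) := by omega
  have h6 : (Module.finrank Fᵐᵒᵖ X.U * (Module.finrank k F * Module.finrank Fᵐᵒᵖ X.U) +
      Module.finrank Gᵐᵒᵖ X.V * (Module.finrank k G * Module.finrank Gᵐᵒᵖ X.V) : ℝ) ≤
      Module.finrank Fᵐᵒᵖ X.U *
      (Module.finrank Gᵐᵒᵖ M * (Module.finrank k G * Module.finrank Gᵐᵒᵖ X.V)) := by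
    exact_mod_cast h5
  have hd : (0 : ℝ) < Module.finrank k F := by exact_mod_cast Module.finrank_pos
  have h7 := hM.epsilon_mul_finrank_right
  rw [hM.finrank_right_algebra (k := k)] at h6
  -- With dim_k G = ε² dim_k F and ε dim M_G = 2 the Euler quadratic form becomes a perfect square:
  -- dim_k F · (dim U - ε dim V)².
  have h8 : (Module.finrank k F : ℝ) * ((Module.finrank Fᵐᵒᵖ X.U : ℝ) -
      epsilon F G M * Module.finrank Gᵐᵒᵖ X.V) ^ 2 ≤ 0 := by
    linear_combination h6 + (Module.finrank Fᵐᵒᵖ X.U : ℝ) * epsilon F G M *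
      Module.finrank k F * Module.finrank Gᵐᵒᵖ X.V * h7
  have h9 : ((Module.finrank Fᵐᵒᵖ X.U : ℝ) -
      epsilon F G M * Module.finrank Gᵐᵒᵖ X.V) ^ 2 ≤ 0 := by
    by_contra! h
    exact absurd h8 (not_le.2 (mul_pos hd h))
  exact sub_eq_zero.1 (pow_eq_zero_iff (two_ne_zero)|>.1 (le_antisymm h9 (sq_nonneg _)))

end BimodRep

namespace BimodRep

variable {k F G M : Type u} [Field k] [DivisionRing F] [DivisionRing G]
  [Algebra k F] [Algebra k G] [AddCommGroup M] [Module k M] [Module F M] [Module Gᵐᵒᵖ M]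
  {X : BimodRep k F G M}

/-! ### Subrepresentations -/

namespace SubRep

/-- A subrepresentation as a representation. -/
def toRep (Y : X.SubRep) : BimodRep k F G M :=
  have : Module.Finite k Y.U := inferInstanceAs (Module.Finite k (Y.U.restrictScalars k))
  have : Module.Finite k Y.V := inferInstanceAs (Module.Finite k (Y.V.restrictScalars k))
  { U := Y.U
    V := Y.V
    ρ := LinearMap.mk₂ k (fun u m => ⟨X.ρ u m, Y.map_mem u u.2 m⟩)
      (fun u u' m => Subtype.ext (by simp)) (fun c u m => Subtype.ext (by simp))
      (fun u m m' => Subtype.ext (by simp)) (fun c u m => Subtype.ext (by simp))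
    balanced := fun u f m => Subtype.ext (X.balanced u f m)
    map_right := fun u m g => Subtype.ext (X.map_right u m g) }

/-- The sum of two subrepresentations. -/
def sup (Y Z : X.SubRep) : X.SubRep where
  U := Y.U ⊔ Z.U
  V := Y.V ⊔ Z.V
  map_mem u hu m := by
    obtain ⟨y, hy, z, hz, rfl⟩ := Submodule.mem_sup.1 hu
    rw [map_add, LinearMap.add_apply]
    exact Submodule.add_mem_sup (Y.map_mem y hy m) (Z.map_mem z hz m)

/-- A subrepresentation of a subrepresentation. -/
def map (Y : X.SubRep) (Z : Y.toRep.SubRep) : X.SubRep where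
  U := Submodule.map (M₂ := X.U) Y.U.subtype Z.U
  V := Submodule.map (M₂ := X.V) Y.V.subtype Z.V
  map_mem := by
    rintro _ ⟨u, hu, rfl⟩ m
    exact ⟨_, Z.map_mem u hu m, rfl⟩

/-- The part of a subrepresentation inside another one. -/
def comap (Y Z : X.SubRep) : Y.toRep.SubRep where
  U := Submodule.comap (M₂ := X.U) Y.U.subtype Z.U
  V := Submodule.comap (M₂ := X.V) Y.V.subtype Z.V
  map_mem _ hu m := Z.map_mem _ hu m

/-- The total dimension of a subrepresentation. -/
def size (Y : X.SubRep) : ℕ := Module.finrank Fᵐᵒᵖ Y.U + Module.finrank Gᵐᵒᵖ Y.V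

theorem isZero_of_size_eq_zero {Y : X.SubRep} (h : Y.size = 0) : Y.IsZero := by
  have h := Nat.add_eq_zero_iff.1 h
  exact ⟨Submodule.finrank_eq_zero.1 h.1, Submodule.finrank_eq_zero.1 h.2⟩

theorem size_add {Y A B : X.SubRep} (hU : A.U ⊓ B.U = ⊥) (hV : A.V ⊓ B.V = ⊥)
    (hU' : A.U ⊔ B.U = Y.U) (hV' : A.V ⊔ B.V = Y.V) : A.size + B.size = Y.size := by
  have h1 := Submodule.finrank_sup_add_finrank_inf_eq A.U B.U
  have h2 := Submodule.finrank_sup_add_finrank_inf_eq A.V B.V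
  rw [hU, hU', finrank_bot] at h1
  rw [hV, hV', finrank_bot] at h2
  simp only [size]
  omega

/-! ### Submodules of a submodule and their images in the ambient module -/

section Submodule

variable {A E : Type*} [Ring A] [AddCommGroup E] [Module A E] {p q r : Submodule A E}
  {q' r' : Submodule A p}

theorem map_subtype_eq_bot : q'.map p.subtype = ⊥ ↔ q' = ⊥ :=
  ⟨fun h => Submodule.map_injective_of_injective p.injective_subtype (h.trans (Submodule.map_bot _).symm),
    fun h => by rw [h, Submodule.map_bot]⟩

theorem finrank_map_subtype :
    Module.finrank A (q'.map p.subtype) = Module.finrank A q' :=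
  (Submodule.equivMapOfInjective _ p.injective_subtype q').finrank_eq.symm

theorem map_subtype_inf_eq_bot (h : q' ⊓ r' = ⊥) : q'.map p.subtype ⊓ r'.map p.subtype = ⊥ := by
  rw [← Submodule.map_inf _ p.injective_subtype, h, Submodule.map_bot]

theorem map_subtype_sup_eq (h : q' ⊔ r' = ⊤) : q'.map p.subtype ⊔ r'.map p.subtype = p := by
  rw [← Submodule.map_sup, h, Submodule.map_subtype_top]

theorem comap_subtype_inf_eq_bot (h : q ⊓ r = ⊥) :
    q.comap p.subtype ⊓ r.comap p.subtype = ⊥ := by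
  rw [← Submodule.comap_inf, h, Submodule.comap_bot, Submodule.ker_subtype]

theorem comap_subtype_sup_eq (h : q ⊔ r = q'.map p.subtype) :
    q.comap p.subtype ⊔ r.comap p.subtype = q' := by
  have hp : q'.map p.subtype ≤ p := Submodule.map_subtype_le _ _
  apply Submodule.map_injective_of_injective p.injective_subtype
  rw [Submodule.map_sup, Submodule.map_comap_subtype, Submodule.map_comap_subtype,
    inf_eq_right.2 (le_sup_left.trans (h.le.trans hp)),
    inf_eq_right.2 (le_sup_right.trans (h.le.trans hp)), h]

theorem eq_bot_of_comap_subtype (hq : q ≤ q'.map p.subtype) (h : q.comap p.subtype = ⊥) :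
    q = ⊥ := by
  have hp : q'.map p.subtype ≤ p := Submodule.map_subtype_le _ _
  rw [← inf_eq_right.2 (hq.trans hp), ← Submodule.map_comap_subtype, h, Submodule.map_bot]

end Submodule

theorem IsIndecomposable.map {Y : X.SubRep} {Z : Y.toRep.SubRep} (hZ : Z.IsIndecomposable) :
    (Y.map Z).IsIndecomposable := by
  refine ⟨fun h => hZ.1 ⟨map_subtype_eq_bot.1 h.1, map_subtype_eq_bot.1 h.2⟩,
    fun A B hU hV hU' hV' => ?_⟩
  rcases hZ.2 (Y.comap A) (Y.comap B) (comap_subtype_inf_eq_bot hU)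
    (comap_subtype_inf_eq_bot hV) (comap_subtype_sup_eq hU') (comap_subtype_sup_eq hV') with h | h
  · exact Or.inl ⟨eq_bot_of_comap_subtype (le_sup_left.trans hU'.le) h.1,
      eq_bot_of_comap_subtype (le_sup_left.trans hV'.le) h.2⟩
  · exact Or.inr ⟨eq_bot_of_comap_subtype (le_sup_right.trans hU'.le) h.1,
      eq_bot_of_comap_subtype (le_sup_right.trans hV'.le) h.2⟩

theorem IsIndecomposable.toRep {Y : X.SubRep} (hY : Y.IsIndecomposable) :
    Y.toRep.topSub.IsIndecomposable := by
  refine ⟨fun h => hY.1 ?_, fun A B hU hV hU' hV' => ?_⟩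
  · exact ⟨(Submodule.map_subtype_top Y.U).symm.trans (map_subtype_eq_bot.2 h.1),
      (Submodule.map_subtype_top Y.V).symm.trans (map_subtype_eq_bot.2 h.2)⟩
  · rcases hY.2 (Y.map A) (Y.map B) (map_subtype_inf_eq_bot hU) (map_subtype_inf_eq_bot hV)
      (map_subtype_sup_eq hU') (map_subtype_sup_eq hV') with h | h
    · exact Or.inl ⟨map_subtype_eq_bot.1 h.1, map_subtype_eq_bot.1 h.2⟩
    · exact Or.inr ⟨map_subtype_eq_bot.1 h.1, map_subtype_eq_bot.1 h.2⟩

/-- A subrepresentation `Y` with a non-zero subrepresentation `I` has an indecomposable direct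
summand to which `I` projects non-trivially. -/
theorem exists_indecomposable_summand (Y I : X.SubRep) (hI : ¬ I.IsZero) (hIU : I.U ≤ Y.U)
    (hIV : I.V ≤ Y.V) : ∃ K C : X.SubRep, K.IsIndecomposable ∧ K.U ⊓ C.U = ⊥ ∧ K.V ⊓ C.V = ⊥ ∧
      K.U ⊔ C.U = Y.U ∧ K.V ⊔ C.V = Y.V ∧ ¬ (I.U ≤ C.U ∧ I.V ≤ C.V) := by
  -- The decompositions Y = K ⊕ C with I not contained in C. The pair (Y, 0) is one of them; K of
  -- least size will be indecomposable.
  let s : Set (X.SubRep × X.SubRep) := {p | p.1.U ⊓ p.2.U = ⊥ ∧ p.1.V ⊓ p.2.V = ⊥ ∧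
      p.1.U ⊔ p.2.U = Y.U ∧ p.1.V ⊔ p.2.V = Y.V ∧ ¬ (I.U ≤ p.2.U ∧ I.V ≤ p.2.V)}
  let O : X.SubRep := ⟨⊥, ⊥, fun u hu m => by
    rw [(Submodule.mem_bot _).1 hu, map_zero, LinearMap.zero_apply]; exact zero_mem _⟩
  have hs : s.Nonempty := ⟨(Y, O), inf_bot_eq _, inf_bot_eq _, sup_bot_eq _, sup_bot_eq _,
    fun h => hI ⟨le_bot_iff.1 h.1, le_bot_iff.1 h.2⟩⟩
  obtain ⟨⟨K, C⟩, ⟨hU, hV, hU', hV', hKC⟩, hmin⟩ :=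
    (measure fun p : X.SubRep × X.SubRep => p.1.size).wf.has_min s hs
  refine ⟨K, C, ⟨fun h => hKC ?_, fun A B aU aV aU' aV' => ?_⟩, hU, hV, hU', hV', hKC⟩
  · rw [h.1, bot_sup_eq] at hU'
    rw [h.2, bot_sup_eq] at hV'
    exact ⟨hU' ▸ hIU, hV' ▸ hIV⟩
  -- If K = A ⊕ B with both parts non-zero, minimality forces I into B ⊕ C and into A ⊕ C. By the
  -- modular law these two meet in C, a contradiction.
  · by_contra! hAB
    simp only at hU hV hU' hV' hKC
    have hsize := size_add aU aV aU' aV'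
    have pos : ∀ {Z : X.SubRep}, ¬ Z.IsZero → 0 < Z.size := fun h =>
      Nat.pos_of_ne_zero fun h0 => h (isZero_of_size_eq_zero h0)
    have dU : Disjoint A.U (B.U ⊔ C.U) := Disjoint.disjoint_sup_right_of_disjoint_sup_left
      (disjoint_iff.2 aU) (by rw [aU']; exact disjoint_iff.2 hU)
    have dV : Disjoint A.V (B.V ⊔ C.V) := Disjoint.disjoint_sup_right_of_disjoint_sup_left
      (disjoint_iff.2 aV) (by rw [aV']; exact disjoint_iff.2 hV)
    have dU' : Disjoint B.U (A.U ⊔ C.U) := Disjoint.disjoint_sup_right_of_disjoint_sup_left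
      (disjoint_iff.2 (by rw [inf_comm]; exact aU))
      (by rw [sup_comm, aU']; exact disjoint_iff.2 hU)
    have dV' : Disjoint B.V (A.V ⊔ C.V) := Disjoint.disjoint_sup_right_of_disjoint_sup_left
      (disjoint_iff.2 (by rw [inf_comm]; exact aV))
      (by rw [sup_comm, aV']; exact disjoint_iff.2 hV)
    have h1 : I.U ≤ B.U ⊔ C.U ∧ I.V ≤ B.V ⊔ C.V := by
      by_contra h
      refine hmin (A, B.sup C) ⟨dU.eq_bot, dV.eq_bot, ?_, ?_, h⟩ ?_
      · exact (sup_assoc _ _ _).symm.trans (by rw [aU', hU'])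
      · exact (sup_assoc _ _ _).symm.trans (by rw [aV', hV'])
      · change A.size < K.size
        have := pos hAB.2
        omega
    have h2 : I.U ≤ A.U ⊔ C.U ∧ I.V ≤ A.V ⊔ C.V := by
      by_contra h
      refine hmin (B, A.sup C) ⟨dU'.eq_bot, dV'.eq_bot, ?_, ?_, h⟩ ?_
      · exact (sup_assoc _ _ _).symm.trans (by rw [sup_comm B.U, aU', hU'])
      · exact (sup_assoc _ _ _).symm.trans (by rw [sup_comm B.V, aV', hV'])
      · change B.size < K.size
        have := pos hAB.1
        omega
    refine hKC ⟨(le_inf h2.1 h1.1).trans ?_, (le_inf h2.2 h1.2).trans ?_⟩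
    · rw [sup_comm A.U, sup_inf_assoc_of_le _ (le_sup_right : C.U ≤ B.U ⊔ C.U), dU.eq_bot,
        sup_bot_eq]
    · rw [sup_comm A.V, sup_inf_assoc_of_le _ (le_sup_right : C.V ≤ B.V ⊔ C.V), dV.eq_bot,
        sup_bot_eq]

/-- An indecomposable representation has no proper non-zero retracts. -/
theorem isZero_or_isTop_of_retract (hX : X.topSub.IsIndecomposable) (K : X.SubRep)
    (a : X.U →ₗ[Fᵐᵒᵖ] K.U) (b : X.V →ₗ[Gᵐᵒᵖ] K.V)
    (hab : ∀ u m, (b (X.ρ u m) : X.V) = X.ρ (a u) m)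
    (ha : ∀ u : K.U, a u = u) (hb : ∀ v : K.V, b v = v) : K.IsZero ∨ K.IsTop := by
  have hU := LinearMap.isCompl_of_proj ha
  have hV := LinearMap.isCompl_of_proj hb
  let L : X.SubRep := ⟨LinearMap.ker a, LinearMap.ker b, fun u hu m => by
    rw [LinearMap.mem_ker] at hu ⊢
    apply Subtype.ext
    rw [hab, hu]
    simp⟩
  rcases hX.2 K L hU.inf_eq_bot hV.inf_eq_bot hU.sup_eq_top hV.sup_eq_top with h | h
  · exact Or.inl h
  · right
    have h1 : LinearMap.ker a = ⊥ := h.1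
    have h2 : LinearMap.ker b = ⊥ := h.2
    rw [h1] at hU
    rw [h2] at hV
    exact ⟨by simpa using hU.sup_eq_top, by simpa using hV.sup_eq_top⟩

end SubRep

/-! ### Kernels and images of endomorphisms -/

namespace End

/-- The kernel of an endomorphism. -/
def ker (d : X.End) : X.SubRep where
  U := LinearMap.ker d.1.1
  V := LinearMap.ker d.1.2
  map_mem u hu m := by
    rw [LinearMap.mem_ker] at hu ⊢
    rw [← d.2 u m, hu, map_zero, LinearMap.zero_apply]

/-- The image of an endomorphism. -/
def range (d : X.End) : X.SubRep where
  U := LinearMap.range d.1.1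
  V := LinearMap.range d.1.2
  map_mem := by
    rintro _ ⟨u, rfl⟩ m
    exact ⟨X.ρ u m, (d.2 u m).symm⟩

theorem isUnit_iff (d : X.End) : IsUnit d ↔ d.ker.IsZero := by
  constructor
  · rintro ⟨⟨d, e, h1, h2⟩, rfl⟩
    have hU : e.1.1 ∘ₗ d.1.1 = LinearMap.id := congr_arg (fun x : X.End => x.1.1) h2
    have hV : e.1.2 ∘ₗ d.1.2 = LinearMap.id := congr_arg (fun x : X.End => x.1.2) h2
    exact ⟨LinearMap.ker_eq_bot_of_inverse hU, LinearMap.ker_eq_bot_of_inverse hV⟩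
  · intro h
    exact d.isUnit_of_injective (LinearMap.ker_eq_bot.1 h.1) (LinearMap.ker_eq_bot.1 h.2)

theorem eq_zero_iff (d : X.End) : d = 0 ↔ d.range.IsZero := by
  constructor
  · rintro rfl
    exact ⟨LinearMap.range_zero, LinearMap.range_zero⟩
  · intro h
    exact Subtype.ext (Prod.ext (LinearMap.range_eq_bot.1 h.1) (LinearMap.range_eq_bot.1 h.2))

/-- Since f x = f (f y) for some y, x = f y + (x - f y) lies in the sum; rank-nullity then leaves no
room for an intersection. -/
theorem range_inf_ker_and_sup {A : Type*} [DivisionRing A] {E : Type*} [AddCommGroup E]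
    [Module A E] [Module.Finite A E] {f : Module.End A E}
    (h : LinearMap.range (f * f) = LinearMap.range f) :
    LinearMap.range f ⊓ LinearMap.ker f = ⊥ ∧ LinearMap.range f ⊔ LinearMap.ker f = ⊤ := by
  have h2 : LinearMap.range f ⊔ LinearMap.ker f = ⊤ := by
    rw [eq_top_iff]
    intro x _
    obtain ⟨y, hy⟩ := h.ge ⟨x, rfl⟩
    refine Submodule.mem_sup.2 ⟨f y, ⟨y, rfl⟩, x - f y, ?_, by abel⟩
    rw [LinearMap.mem_ker, map_sub, ← hy]
    exact sub_self _
  refine ⟨?_, h2⟩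
  have h3 := Submodule.finrank_sup_add_finrank_inf_eq (LinearMap.range f) (LinearMap.ker f)
  rw [h2, finrank_top, f.finrank_range_add_finrank_ker] at h3
  exact Submodule.finrank_eq_zero.1 (by omega)

/-- The Fitting decomposition: an endomorphism `d` of an indecomposable representation with
`rank d² = rank d` is zero or invertible. -/
theorem eq_zero_or_isUnit (hX : X.topSub.IsIndecomposable) (d : X.End)
    (h : d.range.size ≤ (d * d).range.size) : d = 0 ∨ IsUnit d := by
  have hU : LinearMap.range (d.1.1 * d.1.1) ≤ LinearMap.range d.1.1 :=
    LinearMap.range_comp_le_range _ _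
  have hV : LinearMap.range (d.1.2 * d.1.2) ≤ LinearMap.range d.1.2 :=
    LinearMap.range_comp_le_range _ _
  have rU := Submodule.finrank_mono hU
  have rV := Submodule.finrank_mono hV
  have h' : Module.finrank Fᵐᵒᵖ (LinearMap.range d.1.1) +
      Module.finrank Gᵐᵒᵖ (LinearMap.range d.1.2) ≤
    Module.finrank Fᵐᵒᵖ (LinearMap.range (d.1.1 * d.1.1)) +
      Module.finrank Gᵐᵒᵖ (LinearMap.range (d.1.2 * d.1.2)) := h
  -- Neither of the two ranks can grow on squaring, so the inequality between their sums is an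
  -- equality in each component.
  have eU := range_inf_ker_and_sup (Submodule.eq_of_le_of_finrank_le hU (by omega))
  have eV := range_inf_ker_and_sup (Submodule.eq_of_le_of_finrank_le hV (by omega))
  rw [isUnit_iff, eq_zero_iff]
  exact hX.2 d.range d.ker eU.1 eV.1 eU.2 eV.2

end End
end BimodRep

namespace BimodRep

variable {k F G M : Type u} [Field k] [DivisionRing F] [DivisionRing G]
  [Algebra k F] [Algebra k G] [AddCommGroup M] [Module k M] [Module F M] [Module Gᵐᵒᵖ M]
  {X : BimodRep k F G M}

/-! ### Regular-simple representations are bricks -/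

/-- Since q need not be a complement of p, one projects along q ⊕ r, where r is a complement of p +
q. -/
theorem exists_linear_projection {A E : Type*} [DivisionRing A] [AddCommGroup E] [Module A E]
    {p q : Submodule A E} (h : p ⊓ q = ⊥) :
    ∃ f : E →ₗ[A] p, (∀ x : p, f x = x) ∧ ∀ x ∈ q, f x = 0 := by
  obtain ⟨r, hr⟩ := exists_isCompl (p ⊔ q)
  have hc : IsCompl p (q ⊔ r) := by
    refine ⟨Disjoint.disjoint_sup_right_of_disjoint_sup_left (disjoint_iff.2 h) hr.disjoint, ?_⟩
    rw [codisjoint_iff, ← sup_assoc]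
    exact hr.sup_eq_top
  exact ⟨Submodule.projectionOnto _ _ hc, Submodule.projectionOnto_apply_left hc,
    fun x hx => (Submodule.projectionOnto_apply_eq_zero_iff hc).2
      (Submodule.mem_sup_left hx)⟩

/-- A section of f over its range, extended linearly to all of E'. -/
theorem exists_quasi_inverse {A E E' : Type*} [DivisionRing A] [AddCommGroup E] [Module A E]
    [AddCommGroup E'] [Module A E'] (f : E →ₗ[A] E') :
    ∃ g : E' →ₗ[A] E, ∀ x, f (g (f x)) = f x := by
  obtain ⟨s, hs⟩ := f.rangeRestrict.exists_rightInverse_of_surjective f.range_rangeRestrict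
  obtain ⟨g, hg⟩ := LinearMap.exists_extend s
  refine ⟨g, fun x => ?_⟩
  have h1 : g (f x) = s (f.rangeRestrict x) := LinearMap.congr_fun hg (f.rangeRestrict x)
  have h2 : f.rangeRestrict (s (f.rangeRestrict x)) = f.rangeRestrict x :=
    LinearMap.congr_fun hs _
  rw [h1]
  exact congr_arg Subtype.val h2

/-- If `n : X ⟶ Y` is zero on `Y ⊆ X`, the maps `p` restrict to a retraction of the kernel of `n`
onto `Y`, and `Y` has no self-extensions, then `Y` is a retract of `X`. -/
theorem exists_retraction {X Y : BimodRep k F G M} (iU : Y.U → X.U) (iV : Y.V → X.V)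
    (pU : X.U →ₗ[Fᵐᵒᵖ] Y.U) (pV : X.V →ₗ[Gᵐᵒᵖ] Y.V) (hpU : ∀ y, pU (iU y) = y)
    (hpV : ∀ y, pV (iV y) = y) (nU : X.U →ₗ[Fᵐᵒᵖ] Y.U) (nV : X.V →ₗ[Gᵐᵒᵖ] Y.V)
    (hn : ∀ u m, nV (X.ρ u m) = Y.ρ (nU u) m) (hnU : ∀ y, nU (iU y) = 0)
    (hnV : ∀ y, nV (iV y) = 0) (hp : ∀ u, nU u = 0 → ∀ m, pV (X.ρ u m) = Y.ρ (pU u) m)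
    (hY : Function.Surjective Y.commutatorMap) :
    ∃ (a : X.U →ₗ[Fᵐᵒᵖ] Y.U) (b : X.V →ₗ[Gᵐᵒᵖ] Y.V), (∀ u m, b (X.ρ u m) = Y.ρ (a u) m) ∧
      (∀ y, a (iU y) = y) ∧ ∀ y, b (iV y) = y := by
  obtain ⟨g, hg⟩ := exists_quasi_inverse nU
  -- The failure of (pU, pV) to be a morphism vanishes on the kernel of nU, so its value at u
  -- depends only on nU u and equals c (nU u); the quasi-inverse g chooses preimages. As Ext¹(Y, Y)
  -- = 0, c is the commutator of some pair (a, b). Then p - (a, b) ∘ n is a morphism, and it is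
  -- still the identity on Y because n vanishes there.
  let c : Y.balancedMaps := ⟨LinearMap.mk₂ k
      (fun u m => Y.ρ (pU (g u)) m - pV (X.ρ (g u) m))
      (fun u u' m => by simp; abel)
      (fun r u m => by
        rw [g.map_smul_of_tower, pU.map_smul_of_tower, map_smul, map_smul, LinearMap.smul_apply,
          LinearMap.smul_apply, pV.map_smul_of_tower, smul_sub])
      (fun u m m' => by simp; abel)
      (fun r u m => by simp [pV.map_smul_of_tower, smul_sub]),
    fun u f m => by simp [X.balanced, Y.balanced],
    fun u m r => by simp [X.map_right, Y.map_right, smul_sub]⟩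
  obtain ⟨⟨a, b⟩, hab⟩ := hY c
  have key : ∀ u m, Y.ρ (a u) m - b (Y.ρ u m) = Y.ρ (pU (g u)) m - pV (X.ρ (g u) m) :=
    fun u m => LinearMap.congr_fun (LinearMap.congr_fun (congr_arg Subtype.val hab) u) m
  refine ⟨pU - a ∘ₗ nU, pV - b ∘ₗ nV, fun u m => ?_, fun y => by simp [hpU, hnU],
    fun y => by simp [hpV, hnV]⟩
  have h1 : nU (g (nU u) - u) = 0 := by rw [map_sub, hg, sub_self]
  have h2 := hp _ h1 m
  have h3 := key (nU u) m
  simp only [map_sub, LinearMap.sub_apply, LinearMap.comp_apply, hn] at h2 h3 ⊢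
  rw [sub_eq_sub_iff_add_eq_add] at h2 h3 ⊢
  have h4 := congr_arg₂ (· - ·) h3 h2
  have h5 : pV ((X.ρ u) m) + Y.ρ (a (nU u)) m - (Y.ρ (pU u) m + b (Y.ρ (nU u) m)) =
    (Y.ρ (a (nU u)) m + pV (X.ρ (g (nU u)) m) - (pV (X.ρ (g (nU u)) m) + Y.ρ (pU u) m)) -
    (Y.ρ (pU (g (nU u))) m + b (Y.ρ (nU u) m) - (Y.ρ (pU (g (nU u))) m + pV ((X.ρ u) m))) := by
    abel
  rw [← sub_eq_zero, h5, h4, sub_self]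

/-- An indecomposable representation which is not a brick has a proper indecomposable
subrepresentation with self-extensions. -/
theorem exists_indecomposable_not_surjective (hX : X.topSub.IsIndecomposable)
    (hb : ¬ X.IsBrick) : ∃ K : X.SubRep, K.IsIndecomposable ∧ ¬ K.IsTop ∧
      ¬ Function.Surjective K.toRep.commutatorMap := by
  -- A non-zero non-invertible endomorphism of least rank.
  obtain ⟨θ, ⟨hθ0, hθu⟩, hmin⟩ := (measure fun d : X.End => d.range.size).wf.has_min
    {d | d ≠ 0 ∧ ¬ IsUnit d} (by
      simp only [IsBrick, not_forall] at hb
      obtain ⟨d, h1, h2⟩ := hb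
      exact ⟨d, h1, h2⟩)
  have hmin' : ∀ d : X.End, d ≠ 0 → ¬ IsUnit d → θ.range.size ≤ d.range.size :=
    fun d h1 h2 => not_lt.1 (hmin d ⟨h1, h2⟩)
  -- If θ² were non-zero, it would be a non-unit of rank at least that of θ, and the Fitting
  -- decomposition would make θ zero or invertible.
  have hsq : θ * θ = 0 := by
    by_contra h
    have hu : ¬ IsUnit (θ * θ) := by
      rw [End.isUnit_iff] at hθu ⊢
      intro h'
      refine hθu ⟨?_, ?_⟩
      · exact le_bot_iff.1 ((LinearMap.ker_le_ker_comp θ.1.1 θ.1.1).trans h'.1.le)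
      · exact le_bot_iff.1 ((LinearMap.ker_le_ker_comp θ.1.2 θ.1.2).trans h'.2.le)
    rcases End.eq_zero_or_isUnit hX θ (hmin' _ h hu) with h' | h'
    · exact hθ0 h'
    · exact hθu h'
  have hsqU : ∀ u, θ.1.1 (θ.1.1 u) = 0 := fun u =>
    LinearMap.congr_fun (congr_arg (fun d : X.End => d.1.1) hsq) u
  have hsqV : ∀ u, θ.1.2 (θ.1.2 u) = 0 := fun u =>
    LinearMap.congr_fun (congr_arg (fun d : X.End => d.1.2) hsq) u
  -- As θ² = 0, the image of θ lies in ker θ = K ⊕ C; K is chosen so that the image is not contained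
  -- in C.
  obtain ⟨K, C, hK, hU, hV, hU', hV', hC⟩ := SubRep.exists_indecomposable_summand θ.ker θ.range
    (fun h => hθ0 (θ.eq_zero_iff.2 h)) (by rintro _ ⟨u, rfl⟩; exact hsqU u)
    (by rintro _ ⟨u, rfl⟩; exact hsqV u)
  have hKU : ∀ u ∈ K.U, θ.1.1 u = 0 := fun u hu => hU'.le (Submodule.mem_sup_left hu)
  have hKV : ∀ u ∈ K.V, θ.1.2 u = 0 := fun u hu => hV'.le (Submodule.mem_sup_left hu)
  obtain ⟨pU, hpU, hpU'⟩ := exists_linear_projection hU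
  obtain ⟨pV, hpV, hpV'⟩ := exists_linear_projection hV
  -- The projections come from a decomposition of ker θ as a representation, so they are compatible
  -- with the structure map there, but perhaps not on all of X.
  have hp : ∀ u, θ.1.1 u = 0 → ∀ m, (pV (X.ρ u m) : X.V) = X.ρ (pU u) m := by
    intro u hu m
    obtain ⟨y, hy, z, hz, rfl⟩ := Submodule.mem_sup.1 (hU'.ge hu)
    have h1 := hpU ⟨y, hy⟩
    have h2 := hpV ⟨X.ρ y m, K.map_mem y hy m⟩
    simp only at h1 h2
    rw [map_add X.ρ, LinearMap.add_apply, map_add pV, h2, hpV' _ (C.map_mem z hz m), map_add pU,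
      h1, hpU' z hz]
    simp
  have hcomm : ∀ u m, (pV (θ.1.2 (X.ρ u m)) : X.V) = X.ρ (pU (θ.1.1 u)) m := fun u m =>
    (congr_arg (fun v => (pV v : X.V)) (θ.2 u m).symm).trans (hp _ (hsqU u) m)
  -- θ followed by the projection to K: an endomorphism, because θ maps into its own kernel. It is
  -- non-zero by the choice of K and not invertible, so by minimality it has the same rank as θ,
  -- hence the same kernel.
  let ψ : X.End := ⟨(K.U.subtype ∘ₗ pU ∘ₗ θ.1.1, K.V.subtype ∘ₗ pV ∘ₗ θ.1.2),
    fun u m => (hcomm u m).symm⟩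
  have hkU : LinearMap.ker θ.1.1 ≤ LinearMap.ker ψ.1.1 :=
    LinearMap.ker_le_ker_comp θ.1.1 (K.U.subtype ∘ₗ pU)
  have hkV : LinearMap.ker θ.1.2 ≤ LinearMap.ker ψ.1.2 :=
    LinearMap.ker_le_ker_comp θ.1.2 (K.V.subtype ∘ₗ pV)
  have hψ0 : ψ ≠ 0 := by
    intro h
    refine hC ⟨?_, ?_⟩
    · rintro _ ⟨u, rfl⟩
      have h1 : (pU (θ.1.1 u) : X.U) = 0 :=
        LinearMap.congr_fun (congr_arg (fun d : X.End => d.1.1) h) u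
      obtain ⟨y, hy, z, hz, hyz⟩ := Submodule.mem_sup.1 (hU'.ge (hsqU u))
      rw [← hyz, map_add, hpU ⟨y, hy⟩, hpU' z hz, add_zero] at h1
      rw [← hyz, show y = 0 from h1, zero_add]
      exact hz
    · rintro _ ⟨u, rfl⟩
      have h1 : (pV (θ.1.2 u) : X.V) = 0 :=
        LinearMap.congr_fun (congr_arg (fun d : X.End => d.1.2) h) u
      obtain ⟨y, hy, z, hz, hyz⟩ := Submodule.mem_sup.1 (hV'.ge (hsqV u))
      rw [← hyz, map_add, hpV ⟨y, hy⟩, hpV' z hz, add_zero] at h1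
      rw [← hyz, show y = 0 from h1, zero_add]
      exact hz
  have hψu : ¬ IsUnit ψ := by
    rw [End.isUnit_iff] at hθu ⊢
    exact fun h => hθu ⟨le_bot_iff.1 (hkU.trans h.1.le), le_bot_iff.1 (hkV.trans h.2.le)⟩
  have hrank : Module.finrank Fᵐᵒᵖ (LinearMap.range θ.1.1) +
      Module.finrank Gᵐᵒᵖ (LinearMap.range θ.1.2) ≤
    Module.finrank Fᵐᵒᵖ (LinearMap.range ψ.1.1) +
      Module.finrank Gᵐᵒᵖ (LinearMap.range ψ.1.2) := hmin' ψ hψ0 hψu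
  have hker : LinearMap.ker θ.1.1 = LinearMap.ker ψ.1.1 := by
    refine Submodule.eq_of_le_of_finrank_le hkU ?_
    have h1 := Submodule.finrank_mono hkU
    have h2 := Submodule.finrank_mono hkV
    have h3 := θ.1.1.finrank_range_add_finrank_ker
    have h4 := ψ.1.1.finrank_range_add_finrank_ker
    have h5 := θ.1.2.finrank_range_add_finrank_ker
    have h6 := ψ.1.2.finrank_range_add_finrank_ker
    omega
  have hKtop : ¬ K.IsTop := by
    intro h
    refine hθ0 (Subtype.ext (Prod.ext (LinearMap.ext fun u => hKU u ?_)
      (LinearMap.ext fun u => hKV u ?_)))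
    · rw [h.1]; trivial
    · rw [h.2]; trivial
  refine ⟨K, hK, hKtop, fun hs => ?_⟩
  -- Apply this with n = p ∘ θ, which vanishes on K. Since the kernels of ψ and θ agree, the
  -- projections are compatible with the structure map on ker n, as is required.
  obtain ⟨a, b, hab, ha, hb'⟩ := exists_retraction (Y := K.toRep) (fun y : K.U => (y : X.U))
    (fun y : K.V => (y : X.V)) pU pV hpU hpV (pU ∘ₗ θ.1.1) (pV ∘ₗ θ.1.2)
    (fun u m => Subtype.ext (hcomm u m))
    (fun x : K.U => (congr_arg pU (hKU x x.2)).trans (map_zero pU))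
    (fun x : K.V => (congr_arg pV (hKV x x.2)).trans (map_zero pV))
    (fun u hu m => Subtype.ext (hp u (hker.ge (congr_arg Subtype.val hu)) m)) hs
  rcases K.isZero_or_isTop_of_retract hX a b (fun u m => congr_arg Subtype.val (hab u m)) ha hb'
    with h | h
  · exact hK.1 h
  · exact hKtop h

variable [Module.Finite k F] [Module.Finite k G] [Module.Finite k M]
  [IsScalarTower k F M] [IsScalarTower k Gᵐᵒᵖ M]

/-- An indecomposable representation of a tame bimodule which is not a brick has a proper
indecomposable subrepresentation of defect zero. -/
theorem exists_indecomposable_defect_zero (hM : IsTame F G M) (n : ℕ) :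
    ∀ X : BimodRep k F G M, X.topSub.size = n → X.topSub.IsIndecomposable → ¬ X.IsBrick →
      ∃ K : X.SubRep, K.IsIndecomposable ∧ ¬ K.IsTop ∧
        (Module.finrank Fᵐᵒᵖ K.U : ℝ) = epsilon F G M * Module.finrank Gᵐᵒᵖ K.V := by
  induction n using Nat.strong_induction_on with
  | _ n ih =>
  intro X hn hX hb
  obtain ⟨K, hK, hKtop, hs⟩ := exists_indecomposable_not_surjective hX hb
  by_cases hKb : K.toRep.IsBrick
  · exact ⟨K, hK, hKtop, hKb.defect_eq_zero hM hs⟩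
  · have hU := Submodule.finrank_le K.U
    have hV := Submodule.finrank_le K.V
    have htop : X.topSub.size = Module.finrank Fᵐᵒᵖ X.U + Module.finrank Gᵐᵒᵖ X.V :=
      congr_arg₂ (· + ·) (finrank_top _ _) (finrank_top _ _)
    have hKsize : K.toRep.topSub.size = K.size := congr_arg₂ (· + ·) (finrank_top _ _) (finrank_top _ _)
    have hlt : K.size < n := by
      rw [← hn, htop]
      refine lt_of_le_of_ne (add_le_add hU hV) fun h => hKtop ?_
      simp only [SubRep.size] at h
      exact ⟨Submodule.eq_top_of_finrank_eq (by omega), Submodule.eq_top_of_finrank_eq (by omega)⟩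
    -- K is indecomposable and strictly smaller than X, so the induction applies to K, and the
    -- subrepresentation found in K is pushed forward to X.
    obtain ⟨Z, hZ, hZtop, hd⟩ := ih _ hlt K.toRep hKsize hK.toRep hKb
    refine ⟨K.map Z, hZ.map, fun h => hKtop ?_, ?_⟩
    · exact ⟨top_le_iff.1 (h.1.ge.trans (Submodule.map_subtype_le _ _)),
        top_le_iff.1 (h.2.ge.trans (Submodule.map_subtype_le _ _))⟩
    · have h1 : Module.finrank Fᵐᵒᵖ (K.map Z).U = Module.finrank Fᵐᵒᵖ Z.U :=
        SubRep.finrank_map_subtype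
      have h2 : Module.finrank Gᵐᵒᵖ (K.map Z).V = Module.finrank Gᵐᵒᵖ Z.V :=
        SubRep.finrank_map_subtype
      rw [h1, h2, hd]

theorem SubRep.IsIndecomposable.isRegular {Y : X.SubRep} (hY : Y.IsIndecomposable)
    (hd : (Module.finrank Fᵐᵒᵖ Y.U : ℝ) = epsilon F G M * Module.finrank Gᵐᵒᵖ Y.V) :
    Y.IsRegular :=
  ⟨1, fun _ => Y, fun _ => ⟨hY, hd⟩, iSupIndep_subsingleton _, iSupIndep_subsingleton _,
    ciSup_const, ciSup_const⟩

/-- Each summand of a regular decomposition of X is itself a non-zero regular subrepresentation, so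
the first one is already all of X. -/
theorem IsRegularSimple.isIndecomposable (hX : X.IsRegularSimple) :
    X.topSub.IsIndecomposable ∧
      (Module.finrank Fᵐᵒᵖ X.U : ℝ) = epsilon F G M * Module.finrank Gᵐᵒᵖ X.V := by
  obtain ⟨⟨n, Z, hZ, -, -, hU, hV⟩, h0, hsub⟩ := hX
  rcases n with _ | n
  · exact absurd ⟨by rw [← hU, iSup_of_empty], by rw [← hV, iSup_of_empty]⟩ h0
  · obtain ⟨hi, hd⟩ := hZ 0
    rcases hsub (Z 0) (hi.isRegular hd) with h | h
    · exact absurd h hi.1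
    · have h1 : Z 0 = X.topSub := by
        have h2 := h.1
        have h3 := h.2
        generalize Z 0 = Y at h2 h3
        cases Y
        subst h2 h3
        rfl
      rw [h1] at hi hd
      refine ⟨hi, ?_⟩
      have e1 : Module.finrank Fᵐᵒᵖ X.topSub.U = Module.finrank Fᵐᵒᵖ X.U := finrank_top _ _
      have e2 : Module.finrank Gᵐᵒᵖ X.topSub.V = Module.finrank Gᵐᵒᵖ X.V := finrank_top _ _
      rwa [e1, e2] at hd

/-- Regular-simple representations are bricks. -/
theorem IsRegularSimple.isBrick (hM : IsTame F G M) (hX : X.IsRegularSimple) : X.IsBrick := by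
  by_contra hb
  obtain ⟨K, hK, hKtop, hd⟩ := exists_indecomposable_defect_zero hM _ X rfl
    hX.isIndecomposable.1 hb
  rcases hX.2.2 K (hK.isRegular hd) with h | h
  · exact hK.1 h
  · exact hKtop h

end BimodRep

/-! ### Long exact sequences of finite-dimensional spaces -/

section LongExact

variable (k : Type*) [Field k]

/-- The spaces `A m` are finite-dimensional, and zero for almost all `m`. -/
def IsFiniteGraded (A : ℕ → Type*) [∀ m, AddCommGroup (A m)] [∀ m, Module k (A m)] : Prop :=
  (∀ m, Module.Finite k (A m)) ∧ ∃ N, ∀ m, N ≤ m → Subsingleton (A m)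

/-- The alternating sum of the dimensions. -/
def gradedChar (A : ℕ → Type*) [∀ m, AddCommGroup (A m)] [∀ m, Module k (A m)] : ℤ :=
  ∑ᶠ m : ℕ, (-1) ^ m * (Module.finrank k (A m) : ℤ)

variable {k} {A B C : ℕ → Type*} [∀ m, AddCommGroup (A m)] [∀ m, Module k (A m)]
  [∀ m, AddCommGroup (B m)] [∀ m, Module k (B m)] [∀ m, AddCommGroup (C m)] [∀ m, Module k (C m)]
  {f : ∀ m, A m →ₗ[k] B m} {g : ∀ m, B m →ₗ[k] C m} {d : ∀ m, C m →ₗ[k] A (m + 1)}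

theorem subsingleton_of_exact {P Q R : Type*} [AddCommGroup P] [AddCommGroup Q] [AddCommGroup R]
    [Module k P] [Module k Q] [Module k R] {f : P →ₗ[k] Q} {g : Q →ₗ[k] R}
    (h : Function.Exact f g) [Subsingleton P] [Subsingleton R] : Subsingleton Q := by
  refine subsingleton_of_forall_eq 0 fun y => ?_
  obtain ⟨x, rfl⟩ := (h y).1 (Subsingleton.elim _ _)
  rw [Subsingleton.elim x 0, map_zero]

theorem finite_of_exact {P Q R : Type*} [AddCommGroup P] [AddCommGroup Q] [AddCommGroup R]
    [Module k P] [Module k Q] [Module k R] {f : P →ₗ[k] Q} {g : Q →ₗ[k] R}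
    (h : Function.Exact f g) [Module.Finite k P] [Module.Finite k R] : Module.Finite k Q := by
  have h' : Function.Exact f g.rangeRestrict := fun y => by
    rw [← h y]
    exact ⟨fun hy => congr_arg Subtype.val hy, fun hy => Subtype.ext hy⟩
  exact Module.Finite.of_exact h' g.surjective_rangeRestrict

theorem IsFiniteGraded.middle (hfg : ∀ m, Function.Exact (f m) (g m))
    (hA : IsFiniteGraded k A) (hC : IsFiniteGraded k C) : IsFiniteGraded k B := by
  obtain ⟨hA, N, hN⟩ := hA
  obtain ⟨hC, N', hN'⟩ := hC
  refine ⟨fun m => ?_, max N N', fun m hm => ?_⟩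
  · exact finite_of_exact (hfg m)
  · have := hN m (le_of_max_le_left hm)
    have := hN' m (le_of_max_le_right hm)
    exact subsingleton_of_exact (hfg m)

theorem IsFiniteGraded.left (hdf : ∀ m, Function.Exact (d m) (f (m + 1)))
    (hf : Function.Injective (f 0))
    (hB : IsFiniteGraded k B) (hC : IsFiniteGraded k C) : IsFiniteGraded k A := by
  obtain ⟨hB, N, hN⟩ := hB
  obtain ⟨hC, N', hN'⟩ := hC
  refine ⟨fun m => ?_, max N N' + 1, fun m hm => ?_⟩
  · rcases m with _ | m
    · exact Module.Finite.of_injective (f 0) hf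
    · exact finite_of_exact (hdf m)
  · obtain ⟨m, rfl⟩ : ∃ n, m = n + 1 := ⟨m - 1, by omega⟩
    have := hN (m + 1) (by omega)
    have := hN' m (by omega)
    exact subsingleton_of_exact (hdf m)

theorem gradedChar_eq_sum (N : ℕ) {N' : ℕ} (h : ∀ m, N' ≤ m → Subsingleton (A m)) (hN : N' ≤ N) :
    gradedChar k A = ∑ m ∈ Finset.range N, (-1) ^ m * (Module.finrank k (A m) : ℤ) := by
  refine finsum_eq_sum_of_support_subset _ fun m hm => ?_
  rw [Finset.coe_range, Set.mem_Iio]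
  by_contra! hm'
  have := h m (hN.trans hm')
  rw [Function.mem_support, Module.finrank_zero_of_subsingleton] at hm
  exact hm (by simp)

/-- With r m = dim ker (f m), exactness gives dim A m + dim C m = dim B m + r m + r (m + 1). The
alternating sum telescopes: r 0 = 0 because f 0 is injective, and r vanishes in high degrees. -/
theorem gradedChar_add (hfg : ∀ m, Function.Exact (f m) (g m))
    (hgd : ∀ m, Function.Exact (g m) (d m)) (hdf : ∀ m, Function.Exact (d m) (f (m + 1)))
    (hf : Function.Injective (f 0))
    (hA : IsFiniteGraded k A) (hB : IsFiniteGraded k B) (hC : IsFiniteGraded k C) :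
    gradedChar k B = gradedChar k A + gradedChar k C := by
  obtain ⟨hA, N₁, hN₁⟩ := hA
  obtain ⟨hB, N₂, hN₂⟩ := hB
  obtain ⟨hC, N₃, hN₃⟩ := hC
  let r : ℕ → ℕ := fun m => Module.finrank k (LinearMap.ker (f m))
  have key : ∀ m, Module.finrank k (A m) + Module.finrank k (C m) =
      Module.finrank k (B m) + r m + r (m + 1) := by
    intro m
    have h1 := (f m).finrank_range_add_finrank_ker
    have h2 := (g m).finrank_range_add_finrank_ker
    have h3 := (d m).finrank_range_add_finrank_ker
    rw [LinearMap.exact_iff.1 (hfg m)] at h2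
    rw [LinearMap.exact_iff.1 (hgd m), ← LinearMap.exact_iff.1 (hdf m)] at h3
    simp only [r]
    omega
  have hr0 : r 0 = 0 := by
    exact Submodule.finrank_eq_zero.2 (LinearMap.ker_eq_bot.2 hf)
  let N := max N₁ (max N₂ N₃)
  have hrN : r N = 0 := by
    have := hN₁ N (le_max_left _ _)
    exact Module.finrank_zero_of_subsingleton
  rw [gradedChar_eq_sum N hN₁ (le_max_left _ _),
    gradedChar_eq_sum N hN₂ ((le_max_left _ _).trans (le_max_right _ _)),
    gradedChar_eq_sum N hN₃ ((le_max_right _ _).trans (le_max_right _ _)), ← Finset.sum_add_distrib]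
  have htel : ∀ n, ∑ m ∈ Finset.range n, ((-1) ^ m * (Module.finrank k (A m) : ℤ) +
      (-1) ^ m * (Module.finrank k (C m) : ℤ)) =
      ∑ m ∈ Finset.range n, (-1) ^ m * (Module.finrank k (B m) : ℤ) - (-1) ^ n * r n := by
    intro n
    induction n with
    | zero => simp [hr0]
    | succ n ih =>
      rw [Finset.sum_range_succ, Finset.sum_range_succ, ih, pow_succ]
      have h := key n
      zify at h
      linear_combination (-1) ^ n * h
  rw [htel, hrN]
  simp

end LongExact

/-! ### The Euler form -/

section Euler

open Abelian

variable (k : Type u) [Field k] {A : Type u} [Ring A] [Algebra k A]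

/-- The spaces `Ext^m(X, Y)` are finite-dimensional, and zero for almost all `m`. -/
abbrev IsExtFinite (X Y : ModuleCat.{u} A) : Prop := IsFiniteGraded k (Ext X Y)

variable {k} {S : ShortComplex (ModuleCat.{u} A)}

/-! ### The long exact Ext sequence in the first argument -/

section Contravariant

/-- `Ext^m(X₃, Y) ⟶ Ext^m(X₂, Y)`. -/
def extContra₁ (Y : ModuleCat.{u} A) (S : ShortComplex (ModuleCat.{u} A)) (m : ℕ) :
    Ext S.X₃ Y m →ₗ[k] Ext S.X₂ Y m :=
  (Ext.mk₀ S.g).precompOfLinear k Y (zero_add m)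

/-- `Ext^m(X₂, Y) ⟶ Ext^m(X₁, Y)`. -/
def extContra₂ (Y : ModuleCat.{u} A) (S : ShortComplex (ModuleCat.{u} A)) (m : ℕ) :
    Ext S.X₂ Y m →ₗ[k] Ext S.X₁ Y m :=
  (Ext.mk₀ S.f).precompOfLinear k Y (zero_add m)

/-- `Ext^m(X₁, Y) ⟶ Ext^{m+1}(X₃, Y)`. -/
def extContraδ (hS : S.ShortExact) (Y : ModuleCat.{u} A)
    (m : ℕ) : Ext S.X₁ Y m →ₗ[k] Ext S.X₃ Y (m + 1) :=
  hS.extClass.precompOfLinear k Y (add_comm 1 m)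

theorem extContra_exact₂ (hS : S.ShortExact) (Y : ModuleCat.{u} A)
    (m : ℕ) :
    Function.Exact (extContra₁ (k := k) Y S m) (extContra₂ (k := k) Y S m) := fun y => by
  constructor
  · exact fun h => Ext.contravariant_sequence_exact₂ hS Y y h
  · rintro ⟨x, rfl⟩
    change (Ext.mk₀ S.f).comp ((Ext.mk₀ S.g).comp x (zero_add m)) (zero_add m) = 0
    rw [← Ext.comp_assoc_of_second_deg_zero, Ext.mk₀_comp_mk₀, S.zero, Ext.mk₀_zero, Ext.zero_comp]

theorem extContra_exact₁ (hS : S.ShortExact) (Y : ModuleCat.{u} A)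
    (m : ℕ) :
    Function.Exact (extContra₂ (k := k) Y S m) (extContraδ (k := k) hS Y m) := fun y => by
  constructor
  · exact fun h => Ext.contravariant_sequence_exact₁ hS Y y (add_comm 1 m) h
  · rintro ⟨x, rfl⟩
    change hS.extClass.comp ((Ext.mk₀ S.f).comp x (zero_add m)) (add_comm 1 m) = 0
    rw [← Ext.comp_assoc_of_second_deg_zero, hS.extClass_comp, Ext.zero_comp]

theorem extContra_exact₃ (hS : S.ShortExact) (Y : ModuleCat.{u} A)
    (m : ℕ) :
    Function.Exact (extContraδ (k := k) hS Y m) (extContra₁ (k := k) Y S (m + 1)) := fun y => by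
  constructor
  · exact fun h => Ext.contravariant_sequence_exact₃ hS Y y h (add_comm 1 m)
  · rintro ⟨x, rfl⟩
    change (Ext.mk₀ S.g).comp (hS.extClass.comp x (add_comm 1 m)) (zero_add _) = 0
    rw [← Ext.comp_assoc (Ext.mk₀ S.g) hS.extClass x (zero_add 1) (add_comm 1 m) (by omega),
      hS.comp_extClass, Ext.zero_comp]

theorem extContra_injective (hS : S.ShortExact) (Y : ModuleCat.{u} A) :
    Function.Injective (extContra₁ (k := k) Y S 0) :=
  have := hS.epi_g
  Ext.precomp_mk₀_injective_of_epi Y S.g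

theorem IsExtFinite.of_X₁_X₂ (hS : S.ShortExact) (Y : ModuleCat.{u} A)
    (h₁ : IsExtFinite k S.X₁ Y) (h₂ : IsExtFinite k S.X₂ Y) :
    IsExtFinite k S.X₃ Y :=
  IsFiniteGraded.left (extContra_exact₃ hS Y) (extContra_injective hS Y) h₂ h₁

theorem IsExtFinite.of_X₁_X₃ (hS : S.ShortExact) (Y : ModuleCat.{u} A)
    (h₁ : IsExtFinite k S.X₁ Y) (h₃ : IsExtFinite k S.X₃ Y) :
    IsExtFinite k S.X₂ Y :=
  IsFiniteGraded.middle (extContra_exact₂ hS Y) h₃ h₁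

theorem gradedChar_contra (hS : S.ShortExact) (Y : ModuleCat.{u} A)
    (h₁ : IsExtFinite k S.X₁ Y) (h₂ : IsExtFinite k S.X₂ Y)
    (h₃ : IsExtFinite k S.X₃ Y) : gradedChar k (Ext S.X₂ Y) =
      gradedChar k (Ext S.X₃ Y) + gradedChar k (Ext S.X₁ Y) :=
  gradedChar_add (extContra_exact₂ hS Y) (extContra_exact₁ hS Y) (extContra_exact₃ hS Y)
    (extContra_injective hS Y) h₃ h₂ h₁

/-- Dimension shifting. -/
def extContraEquiv (hS : S.ShortExact) (Y : ModuleCat.{u} A) (m : ℕ)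
    (h₁ : Subsingleton (Ext S.X₂ Y m))
    (h₂ : Subsingleton (Ext S.X₂ Y (m + 1))) : Ext S.X₁ Y m ≃ₗ[k] Ext S.X₃ Y (m + 1) :=
  LinearEquiv.ofBijective (extContraδ hS Y m) <| by
    constructor
    · rw [injective_iff_map_eq_zero]
      intro x hx
      obtain ⟨y, rfl⟩ := (extContra_exact₁ (k := k) hS Y m x).1 hx
      rw [Subsingleton.elim y 0, map_zero]
    · intro x
      exact (extContra_exact₃ (k := k) hS Y m x).1 (Subsingleton.elim _ _)

end Contravariant

/-! ### The long exact Ext sequence in the second argument -/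

section Covariant

/-- `Ext^m(Y, X₁) ⟶ Ext^m(Y, X₂)`. -/
def extCo₁ (Y : ModuleCat.{u} A) (S : ShortComplex (ModuleCat.{u} A)) (m : ℕ) :
    Ext Y S.X₁ m →ₗ[k] Ext Y S.X₂ m :=
  (Ext.mk₀ S.f).postcompOfLinear k Y (add_zero m)

/-- `Ext^m(Y, X₂) ⟶ Ext^m(Y, X₃)`. -/
def extCo₂ (Y : ModuleCat.{u} A) (S : ShortComplex (ModuleCat.{u} A)) (m : ℕ) :
    Ext Y S.X₂ m →ₗ[k] Ext Y S.X₃ m :=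
  (Ext.mk₀ S.g).postcompOfLinear k Y (add_zero m)

/-- `Ext^m(Y, X₃) ⟶ Ext^{m+1}(Y, X₁)`. -/
def extCoδ (hS : S.ShortExact) (Y : ModuleCat.{u} A)
    (m : ℕ) : Ext Y S.X₃ m →ₗ[k] Ext Y S.X₁ (m + 1) :=
  hS.extClass.postcompOfLinear k Y rfl

theorem extCo_exact₂ (hS : S.ShortExact) (Y : ModuleCat.{u} A)
    (m : ℕ) :
    Function.Exact (extCo₁ (k := k) Y S m) (extCo₂ (k := k) Y S m) := fun y => by
  constructor
  · exact fun h => Ext.covariant_sequence_exact₂ Y hS y h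
  · rintro ⟨x, rfl⟩
    change (x.comp (Ext.mk₀ S.f) (add_zero m)).comp (Ext.mk₀ S.g) (add_zero m) = 0
    rw [Ext.comp_assoc_of_third_deg_zero, Ext.mk₀_comp_mk₀, S.zero, Ext.mk₀_zero, Ext.comp_zero]

theorem extCo_exact₃ (hS : S.ShortExact) (Y : ModuleCat.{u} A)
    (m : ℕ) :
    Function.Exact (extCo₂ (k := k) Y S m) (extCoδ (k := k) hS Y m) := fun y => by
  constructor
  · exact fun h => Ext.covariant_sequence_exact₃ Y hS y rfl h
  · rintro ⟨x, rfl⟩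
    change (x.comp (Ext.mk₀ S.g) (add_zero m)).comp hS.extClass rfl = 0
    rw [Ext.comp_assoc_of_second_deg_zero, hS.comp_extClass, Ext.comp_zero]

theorem extCo_exact₁ (hS : S.ShortExact) (Y : ModuleCat.{u} A)
    (m : ℕ) :
    Function.Exact (extCoδ (k := k) hS Y m) (extCo₁ (k := k) Y S (m + 1)) := fun y => by
  constructor
  · exact fun h => Ext.covariant_sequence_exact₁ Y hS y h rfl
  · rintro ⟨x, rfl⟩
    change (x.comp hS.extClass rfl).comp (Ext.mk₀ S.f) (add_zero _) = 0
    rw [Ext.comp_assoc_of_third_deg_zero, hS.extClass_comp, Ext.comp_zero]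

theorem extCo_injective (hS : S.ShortExact) (Y : ModuleCat.{u} A) :
    Function.Injective (extCo₁ (k := k) Y S 0) :=
  have := hS.mono_f
  Ext.postcomp_mk₀_injective_of_mono Y S.f

theorem gradedChar_co (hS : S.ShortExact) (Y : ModuleCat.{u} A)
    (h₁ : IsExtFinite k Y S.X₁) (h₂ : IsExtFinite k Y S.X₂)
    (h₃ : IsExtFinite k Y S.X₃) : gradedChar k (Ext Y S.X₂) =
      gradedChar k (Ext Y S.X₁) + gradedChar k (Ext Y S.X₃) :=
  gradedChar_add (extCo_exact₂ hS Y) (extCo_exact₃ hS Y) (extCo_exact₁ hS Y)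
    (extCo_injective hS Y) h₁ h₂ h₃

end Covariant

/-! ### Ext out of projective modules -/

section Projective

theorem subsingleton_ext_of_projective (P Y : ModuleCat.{u} A) [Projective P] {m : ℕ}
    (hm : m ≠ 0) : Subsingleton (Ext P Y m) := by
  obtain ⟨m, rfl⟩ := Nat.exists_eq_succ_of_ne_zero hm
  exact Ext.subsingleton_of_projective P Y m

variable (k) in
theorem gradedChar_of_projective (P Y : ModuleCat.{u} A) [Projective P] :
    gradedChar k (Ext P Y) = Module.finrank k (P ⟶ Y) := by
  rw [gradedChar, finsum_eq_single _ 0]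
  · rw [pow_zero, one_mul, (Ext.linearEquiv₀ (R := k) (X := P) (Y := Y)).finrank_eq]
  · intro m hm
    have := subsingleton_ext_of_projective P Y hm
    rw [Module.finrank_zero_of_subsingleton, Nat.cast_zero, mul_zero]

open scoped ModuleCat in
theorem finite_hom [Module.Finite k A] (X Y : ModuleCat.{u} A) [Module.Finite A X]
    [Module.Finite A Y] : Module.Finite k (X ⟶ Y) := by
  have : Module.Finite k X := Module.Finite.trans A X
  have : Module.Finite k Y := Module.Finite.trans A Y
  let φ : (X ⟶ Y) →ₗ[k] (X →ₗ[k] Y) :=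
    { toFun := fun f => f.hom.restrictScalars k
      map_add' := fun _ _ => rfl
      map_smul' := fun _ _ => rfl }
  refine Module.Finite.of_injective φ fun f g h => ?_
  ext x
  exact LinearMap.congr_fun h x

theorem isExtFinite_of_projective [Module.Finite k A] (P Y : ModuleCat.{u} A) [Projective P]
    [Module.Finite A P] [Module.Finite A Y] : IsExtFinite k P Y := by
  refine ⟨fun m => ?_, 1, fun m hm => subsingleton_ext_of_projective P Y (by omega)⟩
  rcases eq_or_ne m 0 with rfl | hm
  · have := finite_hom (k := k) P Y
    exact Module.Finite.equiv (Ext.linearEquiv₀ (R := k) (X := P) (Y := Y)).symm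
  · have := subsingleton_ext_of_projective P Y hm
    infer_instance

end Projective

/-- The short exact sequence given by linear maps. -/
def shortComplex {X Y Z : Type u} [AddCommGroup X] [AddCommGroup Y] [AddCommGroup Z] [Module A X]
    [Module A Y] [Module A Z] (f : X →ₗ[A] Y) (g : Y →ₗ[A] Z) (h : Function.Exact f g) :
    ShortComplex (ModuleCat.{u} A) :=
  ShortComplex.mk (ModuleCat.ofHom f) (ModuleCat.ofHom g) (by ext x; exact h.apply_apply_eq_zero x)

theorem shortComplex_shortExact {X Y Z : Type u} [AddCommGroup X] [AddCommGroup Y]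
    [AddCommGroup Z] [Module A X] [Module A Y] [Module A Z] (f : X →ₗ[A] Y) (g : Y →ₗ[A] Z)
    (h : Function.Exact f g) (hf : Function.Injective f) (hg : Function.Surjective g) :
    (shortComplex f g h).ShortExact :=
  ModuleCat.shortComplex_shortExact _ h hf hg

end Euler

/-! ### Additive functions on the Grothendieck group -/

section K0

variable (k : Type u) {R : Type u} [Field k] [Ring R] [Algebra k R]

theorem eulerChar_eq (X Y : FGModuleCat.{u} Rᵐᵒᵖ) :
    eulerChar k X Y = gradedChar k (Abelian.Ext X.obj Y.obj) := rfl

theorem cls_eq_add {X Y Z : FGModuleCat.{u} Rᵐᵒᵖ} (f : X.obj →ₗ[Rᵐᵒᵖ] Y.obj)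
    (g : Y.obj →ₗ[Rᵐᵒᵖ] Z.obj) (hf : Function.Injective f) (h : Function.Exact f g)
    (hg : Function.Surjective g) : cls Y = cls X + cls Z := by
  have h1 : FreeAbelianGroup.of Y - FreeAbelianGroup.of X - FreeAbelianGroup.of Z ∈
      K0Relations R := AddSubgroup.subset_closure ⟨X, Y, Z, f, g, hf, h, hg, rfl⟩
  have h2 := (QuotientAddGroup.eq_zero_iff _).2 h1
  rw [QuotientAddGroup.mk_sub, QuotientAddGroup.mk_sub, sub_sub, sub_eq_zero] at h2
  exact h2

/-- Additive functions on modules induce homomorphisms on the Grothendieck group. -/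
def K0.lift {T : Type*} [AddCommGroup T] (φ : FGModuleCat.{u} Rᵐᵒᵖ → T)
    (h : ∀ (X Y Z : FGModuleCat.{u} Rᵐᵒᵖ) (f : X.obj →ₗ[Rᵐᵒᵖ] Y.obj)
      (g : Y.obj →ₗ[Rᵐᵒᵖ] Z.obj), Function.Injective f → Function.Exact f g →
      Function.Surjective g → φ Y = φ X + φ Z) : K0 R →+ T :=
  QuotientAddGroup.lift _ (FreeAbelianGroup.lift φ) <| by
    refine (AddSubgroup.closure_le _).2 ?_
    rintro _ ⟨X, Y, Z, f, g, hf, hfg, hg, rfl⟩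
    change FreeAbelianGroup.lift φ _ = 0
    simp [h X Y Z f g hf hfg hg]

theorem K0.lift_cls {T : Type*} [AddCommGroup T] (φ : FGModuleCat.{u} Rᵐᵒᵖ → T) (h)
    (X : FGModuleCat.{u} Rᵐᵒᵖ) : K0.lift φ h (cls X) = φ X :=
  FreeAbelianGroup.lift_apply_of _ _

theorem K0.hom_ext {T : Type*} [AddCommGroup T] {φ ψ : K0 R →+ T}
    (h : ∀ X, φ (cls X) = ψ (cls X)) : φ = ψ := by
  ext X
  exact h X

/-- The long exact sequences make the Euler characteristic additive in each argument, so it descends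
to K₀ first in the second variable and then in the first. -/
theorem exists_isEulerForm (h : HasFiniteExt k R) :
    ∃ E : K0 R →+ K0 R →+ ℤ, IsEulerForm k E := by
  have hco : ∀ (X Y₁ Y₂ Y₃ : FGModuleCat.{u} Rᵐᵒᵖ) (f : Y₁.obj →ₗ[Rᵐᵒᵖ] Y₂.obj)
      (g : Y₂.obj →ₗ[Rᵐᵒᵖ] Y₃.obj), Function.Injective f → Function.Exact f g →
      Function.Surjective g → eulerChar k X Y₂ = eulerChar k X Y₁ + eulerChar k X Y₃ :=
    fun X Y₁ Y₂ Y₃ f g hf hfg hg =>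
      gradedChar_co (shortComplex_shortExact f g hfg hf hg) X.obj (h X Y₁) (h X Y₂) (h X Y₃)
  refine ⟨K0.lift (fun X => K0.lift (eulerChar k X) (hco X)) ?_, fun X Y => ?_⟩
  · intro X₁ X₂ X₃ f g hf hfg hg
    refine K0.hom_ext fun Y => ?_
    rw [AddMonoidHom.add_apply, K0.lift_cls, K0.lift_cls, K0.lift_cls, add_comm]
    exact gradedChar_contra (shortComplex_shortExact f g hfg hf hg) Y.obj (h X₁ Y) (h X₂ Y)
      (h X₃ Y)
  · rw [K0.lift_cls, K0.lift_cls]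

theorem IsEulerForm.unique {E E' : K0 R →+ K0 R →+ ℤ} (hE : IsEulerForm k E)
    (hE' : IsEulerForm k E') : E = E' :=
  K0.hom_ext fun X => K0.hom_ext fun Y => (hE X Y).trans (hE' X Y).symm

end K0

/-! ### Local idempotents -/

section LocalIdempotent

variable (k : Type u) {B : Type u} [Field k] [Ring B] [Algebra k B]

/-- The right ideal `e B`. -/
abbrev rightIdeal (e : B) : Submodule Bᵐᵒᵖ B := Submodule.span Bᵐᵒᵖ {e}

/-- An idempotent `e` together with an algebra homomorphism `χ : B ⟶ D` to a division algebra
which restricts to an isomorphism `e B e ≅ D`. -/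
structure LocalIdempotent (e : B) where
  /-- the division algebra `e B e` -/
  D : Type u
  [ringD : Ring D]
  [algebraD : Algebra k D]
  [nontrivialD : Nontrivial D]
  /-- the projection -/
  χ : B →ₐ[k] D
  idem : e * e = e
  exists_inv : ∀ d : D, d ≠ 0 → ∃ d', d * d' = 1
  map_idem : χ e = 1
  surj : ∀ d, ∃ b, e * b = b ∧ b * e = b ∧ χ b = d
  inj : ∀ b, e * b = b → b * e = b → χ b = 0 → b = 0

attribute [instance] LocalIdempotent.ringD LocalIdempotent.algebraD LocalIdempotent.nontrivialD

/-! ### Right ideals generated by an idempotent -/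

section RightIdeal

variable {e : B}

theorem mem_rightIdeal (he : e * e = e) {b : B} : b ∈ rightIdeal e ↔ e * b = b := by
  rw [Submodule.mem_span_singleton]
  constructor
  · rintro ⟨c, rfl⟩
    rw [← op_unop c, op_smul_eq_mul, ← mul_assoc, he]
  · intro h
    exact ⟨op b, by rw [op_smul_eq_mul, h]⟩

/-- The generator `e` of `e B`. -/
def gen (e : B) : rightIdeal e := ⟨e, Submodule.mem_span_singleton_self e⟩

theorem smul_gen (b : rightIdeal e) (he : e * e = e) : op (b : B) • gen e = b :=
  Subtype.ext ((mem_rightIdeal he).1 b.2)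

/-- Left multiplication `e B ⟶ e' B` by an element of `e' B e`. -/
def leftMul (e : B) {e' : B} (c : rightIdeal e') : rightIdeal e →ₗ[Bᵐᵒᵖ] rightIdeal e' where
  toFun b := op (b : B) • c
  map_add' b b' := by rw [Submodule.coe_add, MulOpposite.op_add, add_smul]
  map_smul' r b := by
    rw [Submodule.coe_smul, ← op_unop r, op_smul_eq_mul, op_mul, mul_smul]
    rfl

theorem coe_leftMul {e' : B} (c : rightIdeal e') (b : rightIdeal e) :
    (leftMul e c b : B) = c * b := rfl

theorem rightIdeal_hom_ext (he : e * e = e) {Y : Type*} [AddCommGroup Y] [Module Bᵐᵒᵖ Y]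
    {f g : rightIdeal e →ₗ[Bᵐᵒᵖ] Y} (h : f (gen e) = g (gen e)) : f = g := by
  ext b
  rw [← smul_gen b he, map_smul, map_smul, h]

theorem projective_rightIdeal (he : e * e = e) : Module.Projective Bᵐᵒᵖ (rightIdeal e) := by
  let u : Bᵐᵒᵖ ≃ₗ[Bᵐᵒᵖ] B :=
    { toFun := unop
      invFun := op
      map_add' := fun _ _ => rfl
      map_smul' := fun _ _ => rfl
      left_inv := fun _ => rfl
      right_inv := fun _ => rfl }
  have hB : Module.Projective Bᵐᵒᵖ B := Module.Projective.of_equiv u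
  let s : B →ₗ[Bᵐᵒᵖ] rightIdeal e :=
    { toFun := fun b => op b • gen e
      map_add' := fun b b' => by rw [MulOpposite.op_add, add_smul]
      map_smul' := fun r b => by
        rw [← op_unop r, op_smul_eq_mul, op_mul, mul_smul]
        rfl }
  exact Module.Projective.of_split (rightIdeal e).subtype s
    (LinearMap.ext fun b => smul_gen b he)

end RightIdeal

theorem hom_smul_apply {k A : Type u} [Field k] [Ring A] [Algebra k A] {X Y : ModuleCat.{u} A}
    (c : k) (f : X ⟶ Y) (x : X) : (c • f).hom x = algebraMap k A c • f.hom x := by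
  let := ModuleCat.moduleOfAlgebraModule (k := k) Y
  have := ModuleCat.isScalarTower_of_algebra_moduleCat (k := k) Y
  exact (algebraMap_smul A c (f.hom x)).symm

/-- Meant for P = e B and x = e: only Hom survives, and a map out of e B is its value at e. The map
φ is only additive because Y sees k through A; compatibility with scalars is the separate hypothesis
`hφ`. -/
theorem gradedChar_of_bijective_eval {k A : Type u} [Field k] [Ring A] [Algebra k A]
    (P Y : ModuleCat.{u} A) [Projective P] (x : P) {W : Type*} [AddCommGroup W] [Module k W]
    (φ : Y →+ W) (hφ : ∀ (c : k) (y : Y), φ (algebraMap k A c • y) = c • φ y)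
    (h : Function.Bijective fun f : P ⟶ Y => φ (f.hom x)) :
    gradedChar k (Abelian.Ext P Y) = Module.finrank k W := by
  let ψ : (P ⟶ Y) →ₗ[k] W :=
    { toFun := fun f => φ (f.hom x)
      map_add' := fun f g => map_add φ (f.hom x) (g.hom x)
      map_smul' := fun c f => (congr_arg φ (hom_smul_apply c f x)).trans (hφ c (f.hom x)) }
  rw [gradedChar_of_projective, (LinearEquiv.ofBijective ψ h).finrank_eq]

theorem gradedChar_of_subsingleton_hom {k A : Type u} [Field k] [Ring A] [Algebra k A]
    (P Y : ModuleCat.{u} A) [Projective P] [Subsingleton (P ⟶ Y)] :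
    gradedChar k (Abelian.Ext P Y) = 0 := by
  rw [gradedChar_of_projective, Module.finrank_zero_of_subsingleton, Nat.cast_zero]

namespace LocalIdempotent

variable {k} {e : B} (L : LocalIdempotent k e)

instance : Module Bᵐᵒᵖ L.D := Module.compHom L.D L.χ.toRingHom.op

theorem op_smul (b : B) (d : L.D) : op b • d = d * L.χ b := rfl

/-- The projection `e B ⟶ D`. -/
def proj : rightIdeal e →ₗ[Bᵐᵒᵖ] L.D where
  toFun b := L.χ b
  map_add' _ _ := map_add L.χ _ _
  map_smul' r b := map_mul L.χ (b : B) (unop r)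

theorem proj_apply (b : rightIdeal e) : L.proj b = L.χ b := rfl

theorem proj_surjective : Function.Surjective L.proj := fun d => by
  obtain ⟨b, h1, -, h2⟩ := L.surj d
  exact ⟨⟨b, (mem_rightIdeal L.idem).2 h1⟩, h2⟩

instance : IsSimpleModule Bᵐᵒᵖ L.D := by
  refine (isSimpleModule_iff_toSpanSingleton_surjective).2 ⟨inferInstance, fun d hd d' => ?_⟩
  obtain ⟨c, hc⟩ := L.exists_inv d hd
  obtain ⟨b, -, -, hb⟩ := L.surj (c * d')
  refine ⟨op b, ?_⟩
  rw [LinearMap.toSpanSingleton_apply, op_smul, hb, ← mul_assoc, hc, one_mul]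

/-- If n ∈ N has χ n ≠ 0, lift a right inverse of χ n to b in e B e. Then n b and e both lie in e B
e and have the same image under χ, so n b = e, and N contains the generator. Hence ker χ is the only
maximal submodule of e B. -/
theorem eq_top_of_not_le (N : Submodule Bᵐᵒᵖ (rightIdeal e))
    (h : ¬ N ≤ LinearMap.ker L.proj) : N = ⊤ := by
  obtain ⟨n, hn, hn'⟩ := SetLike.not_le_iff_exists.1 h
  obtain ⟨d, hd⟩ := L.exists_inv (L.χ n) hn'
  obtain ⟨b, hb1, hb2, hb3⟩ := L.surj d
  have h1 : (n : B) * b = e := by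
    have he := (mem_rightIdeal L.idem).1 n.2
    refine sub_eq_zero.1 (L.inj _ ?_ ?_ ?_)
    · rw [mul_sub, ← mul_assoc, he, L.idem]
    · rw [sub_mul, mul_assoc, hb2, L.idem]
    · rw [map_sub, map_mul, hb3, hd, L.map_idem, sub_self]
  have h2 : gen e ∈ N := by
    have : op b • n = gen e := Subtype.ext h1
    rw [← this]
    exact N.smul_mem _ hn
  rw [eq_top_iff]
  intro b _
  rw [← smul_gen b L.idem]
  exact N.smul_mem _ h2

theorem ker_proj_ne_top : LinearMap.ker L.proj ≠ ⊤ := by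
  intro h
  have h1 : L.proj (gen e) = 0 := by
    rw [← LinearMap.mem_ker, h]
    trivial
  exact one_ne_zero (L.map_idem.symm.trans h1)

theorem eq_ker_of_isCoatom {N : Submodule Bᵐᵒᵖ (rightIdeal e)} (hN : IsCoatom N) :
    N = LinearMap.ker L.proj := by
  by_contra h
  have hle : N ≤ LinearMap.ker L.proj := by
    by_contra h'
    exact hN.1 (L.eq_top_of_not_le N h')
  exact L.ker_proj_ne_top (hN.2 _ (lt_of_le_of_ne hle h))

theorem isCoatom_ker : IsCoatom (LinearMap.ker L.proj) :=
  ⟨L.ker_proj_ne_top, fun N hN => L.eq_top_of_not_le N hN.not_ge⟩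

theorem jacobson_eq : Module.jacobson Bᵐᵒᵖ (rightIdeal e) = LinearMap.ker L.proj := by
  refine le_antisymm (sInf_le L.isCoatom_ker) (le_sInf fun N hN => ?_)
  rw [L.eq_ker_of_isCoatom hN]

/-- The top of `e B` is `D`. -/
def topEquiv : (rightIdeal e ⧸ Module.jacobson Bᵐᵒᵖ (rightIdeal e)) ≃ₗ[Bᵐᵒᵖ] L.D :=
  (Submodule.quotEquivOfEq _ _ L.jacobson_eq).trans
    (L.proj.quotKerEquivOfSurjective L.proj_surjective)

theorem isSimpleModule_top (L : LocalIdempotent k e) :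
    IsSimpleModule Bᵐᵒᵖ (rightIdeal e ⧸ Module.jacobson Bᵐᵒᵖ (rightIdeal e)) :=
  IsSimpleModule.congr L.topEquiv

/-- A simple module on which `e` does not act as zero is the top of `e B`. -/
theorem nonempty_equiv_top (L : LocalIdempotent k e) {T : Type u} [AddCommGroup T] [Module Bᵐᵒᵖ T]
    [IsSimpleModule Bᵐᵒᵖ T] {t : T} (ht : op e • t ≠ 0) :
    Nonempty (T ≃ₗ[Bᵐᵒᵖ] rightIdeal e ⧸ Module.jacobson Bᵐᵒᵖ (rightIdeal e)) := by
  let f : rightIdeal e →ₗ[Bᵐᵒᵖ] T :=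
    { toFun := fun b => op (b : B) • t
      map_add' := fun b b' => by rw [Submodule.coe_add, MulOpposite.op_add, add_smul]
      map_smul' := fun r b => by
        rw [Submodule.coe_smul, ← op_unop r, op_smul_eq_mul, op_mul, mul_smul]
        rfl }
  have hf : f ≠ 0 := fun h => ht (LinearMap.congr_fun h (gen e))
  have hs : Function.Surjective f := f.surjective_of_ne_zero hf
  -- The kernel of a surjection onto a simple module is maximal, so it can only be the radical of e
  -- B.
  have hk : IsCoatom (LinearMap.ker f) := by
    rw [← isSimpleModule_iff_isCoatom]
    exact IsSimpleModule.congr (f.quotKerEquivOfSurjective hs)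
  have h := L.jacobson_eq.trans (L.eq_ker_of_isCoatom hk).symm
  exact ⟨(f.quotKerEquivOfSurjective hs).symm.trans (Submodule.quotEquivOfEq _ _ h.symm)⟩

/-- The simple module `e B / rad (e B)`. -/
abbrev top (_ : LocalIdempotent k e) : ModuleCat.{u} Bᵐᵒᵖ :=
  ModuleCat.of Bᵐᵒᵖ (rightIdeal e ⧸ Module.jacobson Bᵐᵒᵖ (rightIdeal e))

theorem topEquiv_smul (c : k) (s : L.top) :
    L.topEquiv (algebraMap k Bᵐᵒᵖ c • s) = c • L.topEquiv s := by
  have h : L.topEquiv (algebraMap k Bᵐᵒᵖ c • s) = L.topEquiv s * L.χ (algebraMap k B c) :=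
    map_smul L.topEquiv _ s
  rw [h, AlgHom.commutes, ← Algebra.commutes, ← Algebra.smul_def]

theorem bijective_homTop :
    Function.Bijective fun f : ModuleCat.of Bᵐᵒᵖ (rightIdeal e) ⟶ L.top =>
      L.topEquiv (f.hom (gen e)) := by
  refine ⟨fun f g h => ?_, fun d => ?_⟩
  · exact ModuleCat.hom_ext (rightIdeal_hom_ext L.idem (L.topEquiv.injective h))
  · obtain ⟨b, h1, -, h2⟩ := L.surj d
    refine ⟨ModuleCat.ofHom ((Submodule.mkQ _) ∘ₗ
      leftMul e ⟨b, (mem_rightIdeal L.idem).2 h1⟩), ?_⟩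
    change L.χ (b * e) = d
    rw [map_mul, h2, L.map_idem, mul_one]

theorem gradedChar_self : gradedChar k (Abelian.Ext (ModuleCat.of Bᵐᵒᵖ (rightIdeal e)) L.top) =
    Module.finrank k L.D := by
  have : Projective (ModuleCat.of Bᵐᵒᵖ (rightIdeal e)) :=
    (IsProjective.iff_projective _).1 (projective_rightIdeal L.idem)
  exact gradedChar_of_bijective_eval (ModuleCat.of Bᵐᵒᵖ (rightIdeal e)) L.top (gen e)
    L.topEquiv.toAddMonoidHom L.topEquiv_smul L.bijective_homTop

/-- The image of e' is fixed by e', but e' acts on the top through χ e' = χ e · χ e' = χ (e e') = 0.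
-/
theorem subsingleton_hom {e' : B} (he' : e' * e' = e') (h : e * e' = 0) :
    Subsingleton (ModuleCat.of Bᵐᵒᵖ (rightIdeal e') ⟶ L.top) := by
  refine subsingleton_of_forall_eq 0 fun f => ?_
  refine ModuleCat.hom_ext (rightIdeal_hom_ext he' (L.topEquiv.injective ?_))
  have h1 : f.hom (gen e') = op e' • f.hom (gen e') := by
    rw [← map_smul]
    exact congr_arg _ (smul_gen (gen e') he').symm
  have h2 : L.χ e' = 0 := by
    have := congr_arg L.χ h
    rwa [map_mul, L.map_idem, one_mul, map_zero] at this
  rw [h1, map_smul, op_smul, h2, mul_zero]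
  exact (map_zero L.topEquiv).symm

theorem gradedChar_eq_zero {e' : B} (he' : e' * e' = e') (h : e * e' = 0) :
    gradedChar k (Abelian.Ext (ModuleCat.of Bᵐᵒᵖ (rightIdeal e')) L.top) = 0 := by
  have : Projective (ModuleCat.of Bᵐᵒᵖ (rightIdeal e')) :=
    (IsProjective.iff_projective _).1 (projective_rightIdeal he')
  have := L.subsingleton_hom he' h
  exact gradedChar_of_subsingleton_hom _ _

end LocalIdempotent

/-! ### Modules of finite length -/

section FiniteLength

theorem isFiniteLength_of_finite [Module.Finite k B] (M : Type u) [AddCommGroup M]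
    [Module Bᵐᵒᵖ M] [Module.Finite Bᵐᵒᵖ M] : IsFiniteLength Bᵐᵒᵖ M := by
  have : IsArtinianRing Bᵐᵒᵖ := IsArtinianRing.of_finite k Bᵐᵒᵖ
  exact isFiniteLength_iff_isNoetherian_isArtinian.2 ⟨inferInstance, inferInstance⟩

variable {ι : Type*} (S : ι → FGModuleCat.{u} Bᵐᵒᵖ)

/-- Induction along a composition series, by the long exact sequence of N ⊆ M; this reduces
finiteness of Ext to simple first arguments. -/
theorem isExtFinite_of_isFiniteLength
    (hS : ∀ (T : Type u) [AddCommGroup T] [Module Bᵐᵒᵖ T] [IsSimpleModule Bᵐᵒᵖ T],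
      ∃ x, Nonempty (T ≃ₗ[Bᵐᵒᵖ] (S x).obj))
    (Y : FGModuleCat.{u} Bᵐᵒᵖ)
    (h : ∀ x, IsExtFinite k (S x).obj Y.obj) {M : Type u} [AddCommGroup M] [Module Bᵐᵒᵖ M]
    (hM : IsFiniteLength Bᵐᵒᵖ M) : IsExtFinite k (ModuleCat.of Bᵐᵒᵖ M) Y.obj := by
  induction hM with
  | @of_subsingleton M _ _ _ =>
    have : Projective (ModuleCat.of Bᵐᵒᵖ M) :=
      (IsProjective.iff_projective M).1 (Module.Projective.of_free)
    refine ⟨fun m => ?_, 0, fun m _ => ?_⟩ <;>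
    · have : Subsingleton (Abelian.Ext (ModuleCat.of Bᵐᵒᵖ M) Y.obj m) := by
        rcases eq_or_ne m 0 with rfl | hm
        · have : Subsingleton (ModuleCat.of Bᵐᵒᵖ M ⟶ Y.obj) :=
            subsingleton_of_forall_eq 0 fun f => by
              ext x
              rw [Subsingleton.elim x 0, map_zero, map_zero]
          exact (Abelian.Ext.linearEquiv₀ (R := k)).toEquiv.subsingleton
        · exact subsingleton_ext_of_projective _ _ hm
      infer_instance
  | @of_simple_quotient M _ _ N _ _ ih =>
    obtain ⟨x, ⟨φ⟩⟩ := hS (M ⧸ N)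
    refine IsExtFinite.of_X₁_X₃ (shortComplex_shortExact N.subtype (φ.toLinearMap ∘ₗ N.mkQ) ?_
      N.injective_subtype (φ.surjective.comp N.mkQ_surjective)) Y.obj ih (h x)
    intro y
    rw [LinearMap.comp_apply, LinearEquiv.coe_coe, map_eq_zero_iff φ φ.injective]
    simp

/-- For a zero module the sequence X → X → X of identities is short exact, so [X] = [X] + [X]. -/
theorem cls_eq_zero (X : FGModuleCat.{u} Bᵐᵒᵖ) [Subsingleton X.obj] : cls X = 0 := by
  have h := cls_eq_add (X := X) (Y := X) (Z := X) LinearMap.id LinearMap.id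
    Function.injective_id (fun _ => ⟨fun _ => ⟨_, rfl⟩, fun _ => Subsingleton.elim _ _⟩)
    Function.surjective_id
  exact left_eq_add.1 h

theorem cls_congr {X Y : FGModuleCat.{u} Bᵐᵒᵖ} (f : X.obj ≃ₗ[Bᵐᵒᵖ] Y.obj) : cls X = cls Y := by
  let Z : FGModuleCat.{u} Bᵐᵒᵖ := FGModuleCat.of Bᵐᵒᵖ PUnit
  have h := cls_eq_add (X := X) (Y := Y) (Z := Z) f.toLinearMap 0 f.injective
    (fun y => ⟨fun _ => f.surjective y, fun _ => rfl⟩) (fun _ => ⟨0, rfl⟩)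
  have : Subsingleton Z.obj := inferInstanceAs (Subsingleton PUnit)
  rw [cls_eq_zero Z, add_zero] at h
  exact h.symm

/-- Finite generation is quantified after `hM`, so that the induction hypothesis can be fed with
that of N, which follows from N having finite length. -/
theorem cls_mem_span
    (hS : ∀ (T : Type u) [AddCommGroup T] [Module Bᵐᵒᵖ T] [IsSimpleModule Bᵐᵒᵖ T],
      ∃ x, Nonempty (T ≃ₗ[Bᵐᵒᵖ] (S x).obj))
    {M : Type u} [AddCommGroup M] [Module Bᵐᵒᵖ M]
    (hM : IsFiniteLength Bᵐᵒᵖ M) : ∀ [Module.Finite Bᵐᵒᵖ M],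
    cls (FGModuleCat.of Bᵐᵒᵖ M) ∈ Submodule.span ℤ (Set.range fun x => cls (S x)) := by
  induction hM with
  | @of_subsingleton M _ _ _ =>
    intro _
    have : Subsingleton (FGModuleCat.of Bᵐᵒᵖ M).obj := inferInstanceAs (Subsingleton M)
    rw [cls_eq_zero]
    exact zero_mem _
  | @of_simple_quotient M _ _ N _ hN ih =>
    intro _
    have : IsNoetherian Bᵐᵒᵖ N := ((isFiniteLength_iff_isNoetherian_isArtinian).1 hN).1
    obtain ⟨x, ⟨φ⟩⟩ := hS (M ⧸ N)
    have h := cls_eq_add (X := FGModuleCat.of Bᵐᵒᵖ N) (Y := FGModuleCat.of Bᵐᵒᵖ M) (Z := S x)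
      N.subtype (φ.toLinearMap ∘ₗ N.mkQ) N.injective_subtype (fun y => by
        rw [LinearMap.comp_apply, LinearEquiv.coe_coe, map_eq_zero_iff φ φ.injective]
        simp) (φ.surjective.comp N.mkQ_surjective)
    rw [h]
    exact add_mem ih (Submodule.subset_span ⟨x, rfl⟩)

theorem span_cls_eq_top [Module.Finite k B]
    (hS : ∀ (T : Type u) [AddCommGroup T] [Module Bᵐᵒᵖ T] [IsSimpleModule Bᵐᵒᵖ T],
      ∃ x, Nonempty (T ≃ₗ[Bᵐᵒᵖ] (S x).obj)) :
    Submodule.span ℤ (Set.range fun x => cls (S x)) = ⊤ := by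
  rw [eq_top_iff]
  rintro ⟨z⟩ -
  induction z using FreeAbelianGroup.induction_on with
  | zero => exact zero_mem _
  | of X => exact cls_mem_span S hS (isFiniteLength_of_finite k X.obj)
  | neg X h => exact neg_mem h
  | add x y hx hy => exact add_mem hx hy

end FiniteLength
end LocalIdempotent

/-! ### Matrix units of the Coxeter-Dynkin algebra -/

section MatrixUnits

variable {k F G M : Type u} [Field k] [DivisionRing F] [DivisionRing G]
  [Algebra k F] [Algebra k G] [AddCommGroup M] [Module k M] [Module F M] [Module Gᵐᵒᵖ M]

namespace Datum

variable {X : Datum k F G M}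

namespace CDAlgebra

/-- The element with entries `φ i` at `(F, i(1))`. -/
def ofU (φ : ∀ i, (X.rep i).Dual) : X.CDAlgebra :=
  { cF := 0, cU := φ, cW := 0, cD := 0, cV := 0, cG := 0 }

/-- The element with entries `v i a` at `(i(a), G)`. -/
def ofV (v : ∀ i, X.Arm i → (X.rep i).V) : X.CDAlgebra :=
  { cF := 0, cU := 0, cW := 0, cD := 0, cV := v, cG := 0 }

/-- The element with blocks `A i`. -/
def ofD (A : ∀ i, X.Block i) : X.CDAlgebra :=
  { cF := 0, cU := 0, cW := 0, cD := A, cV := 0, cG := 0 }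

theorem wLeft_zero (w : X.W) : wLeft (0 : F) w = 0 := by
  have h := wLeft_add (0 : F) 0 w
  rwa [add_zero, left_eq_add] at h

theorem wRight_zero (w : X.W) : wRight (0 : G) w = 0 := by
  have h := wRight_add (0 : G) 0 w
  rwa [add_zero, left_eq_add] at h

theorem wMul_zero_right' (φ : ∀ i, (X.rep i).Dual) :
    wMul φ (fun i => (0 : (X.rep i).V)) = 0 := wMul_zero_right φ

theorem dualLeft_zero_left {i : Fin X.t} (φ : (X.rep i).Dual) :
    BimodRep.dualLeft (0 : F) φ = 0 := by
  ext1 u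
  simp [BimodRep.dualLeft_apply]

theorem dualLeft_zero_right {i : Fin X.t} (a : F) :
    BimodRep.dualLeft a (0 : (X.rep i).Dual) = 0 := rfl

theorem dualLeft_one {i : Fin X.t} (φ : (X.rep i).Dual) : BimodRep.dualLeft (1 : F) φ = φ := by
  ext1 u
  simp [BimodRep.dualLeft_apply]

theorem dualRight_zero_left {i : Fin X.t} (d : X.D i) :
    BimodRep.dualRight (0 : (X.rep i).Dual) d = 0 := by
  ext1 u
  simp [BimodRep.dualRight_apply]

theorem dualRight_zero_right {i : Fin X.t} (φ : (X.rep i).Dual) :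
    BimodRep.dualRight φ (0 : X.D i) = 0 := by
  ext1 u
  simp [BimodRep.dualRight_apply]

attribute [local simp] wLeft_zero wRight_zero wMul_zero_right wMul_zero_right' wMul_zero_left
  dualLeft_zero_left dualLeft_zero_right dualRight_zero_left dualRight_zero_right wLeft_one
  wRight_one dualLeft_one

/-- The diagonal block with a single entry `1` at `j`. -/
def diagBlock {i : Fin X.t} (j : X.Arm i) : X.Block i :=
  ⟨Matrix.diagonal (Pi.single j 1), fun _ _ h => Matrix.diagonal_apply_ne _ h.ne⟩

theorem idem_arm (i : Fin X.t) (j : X.Arm i) :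
    (idem (.arm i j) : X.CDAlgebra) = ofD (Pi.single i (diagBlock j)) := rfl

/-- The block with a single entry `d` in row `a` and column `b`. -/
def unitBlock {i : Fin X.t} {a b : X.Arm i} (h : b ≤ a) (d : X.D i) : X.Block i :=
  ⟨Matrix.single a b d, fun a' b' h' => by
    rw [Matrix.single_apply, if_neg]
    rintro ⟨rfl, rfl⟩
    exact absurd h' h.not_gt⟩

theorem diagBlock_eq {i : Fin X.t} (j : X.Arm i) : diagBlock j = unitBlock (le_refl j) 1 :=
  Subtype.ext (Matrix.diagonal_single j 1)

theorem unitBlock_mul_apply {i : Fin X.t} {a b : X.Arm i} (h : b ≤ a) (d : X.D i)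
    (A : X.Block i) (a' b' : X.Arm i) :
    (unitBlock h d * A).1 a' b' = if a' = a then d * A.1 b b' else 0 := by
  change (Matrix.single a b d * A.1) a' b' = _
  split_ifs with h'
  · rw [h', Matrix.single_mul_apply_same]
  · rw [Matrix.single_mul_apply_of_ne _ _ _ _ _ h']

theorem mul_unitBlock_apply {i : Fin X.t} {a b : X.Arm i} (h : b ≤ a) (d : X.D i)
    (A : X.Block i) (a' b' : X.Arm i) :
    (A * unitBlock h d).1 a' b' = if b' = b then A.1 a' a * d else 0 := by
  change (A.1 * Matrix.single a b d) a' b' = _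
  split_ifs with h'
  · rw [h', Matrix.mul_single_apply_same]
  · rw [Matrix.mul_single_apply_of_ne _ _ _ _ _ h']

theorem unitBlock_apply {i : Fin X.t} {a b : X.Arm i} (h : b ≤ a) (d : X.D i) (a' b' : X.Arm i) :
    (unitBlock h d).1 a' b' = if a = a' ∧ b = b' then d else 0 := Matrix.single_apply ..

theorem sum_unitBlock_smul {i : Fin X.t} {a b : X.Arm i} (h : b ≤ a) (d : X.D i)
    (v : X.Arm i → (X.rep i).V) (a' : X.Arm i) :
    ∑ c, (unitBlock h d).1 a' c • v c = if a' = a then d • v b else 0 := by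
  rw [Finset.sum_eq_single b]
  · rw [unitBlock_apply]
    by_cases h' : a' = a
    · simp [h']
    · simp [h', Ne.symm h']
  · intro c _ hc
    rw [unitBlock_apply, if_neg (fun h => hc h.2.symm), zero_smul]
  · exact fun h => absurd (Finset.mem_univ _) h

/-- Triangularity leaves a single term; this is what makes reading off a diagonal entry an algebra
homomorphism B → D_i. -/
theorem block_mul_diag {i : Fin X.t} (A B : X.Block i) (j : X.Arm i) :
    (A * B).1 j j = A.1 j j * B.1 j j := by
  change (A.1 * B.1) j j = _
  rw [Matrix.mul_apply, Finset.sum_eq_single j]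
  · intro b _ hb
    rcases lt_or_gt_of_ne hb with h | h
    · rw [B.2 b j h, mul_zero]
    · rw [A.2 j b h, zero_mul]
  · exact fun h => absurd (Finset.mem_univ _) h

theorem idem_F_mul (b : X.CDAlgebra) : (idem .F : X.CDAlgebra) * b =
    { cF := b.cF, cU := b.cU, cW := b.cW, cD := 0, cV := 0, cG := 0 } := by
  ext1 <;> simp [idem] <;> rfl

theorem mul_idem_F (b : X.CDAlgebra) : b * (idem .F : X.CDAlgebra) =
    { cF := b.cF, cU := 0, cW := 0, cD := 0, cV := 0, cG := 0 } := by
  ext1 <;> simp [idem] <;> rfl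

theorem idem_G_mul (b : X.CDAlgebra) : (idem .G : X.CDAlgebra) * b =
    { cF := 0, cU := 0, cW := 0, cD := 0, cV := 0, cG := b.cG } := by
  ext1 <;> simp [idem] <;> rfl

theorem mul_idem_G (b : X.CDAlgebra) : b * (idem .G : X.CDAlgebra) =
    { cF := 0, cU := 0, cW := b.cW, cD := 0, cV := b.cV, cG := b.cG } := by
  ext1 <;> simp [idem] <;> rfl

theorem ofD_single_mul (i : Fin X.t) (A : X.Block i) (b : X.CDAlgebra) :
    ofD (Pi.single i A) * b = { cF := 0, cU := 0, cW := 0, cD := Pi.single i (A * b.cD i)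
                                cV := Pi.single i fun a => ∑ c, A.1 a c • b.cV i c, cG := 0 } := by
  ext1
  · simp [ofD]
  · simp [ofD]; rfl
  · simp [ofD]
  · ext1 i'
    rcases eq_or_ne i' i with rfl | h
    · simp [ofD]
    · simp [ofD, h]
  · ext1 i'
    rcases eq_or_ne i' i with rfl | h
    · simp [ofD]
    · simp [ofD, h]; rfl
  · simp [ofD]

theorem mul_ofD_single (i : Fin X.t) (A : X.Block i) (b : X.CDAlgebra) :
    b * ofD (Pi.single i A) =
      { cF := 0
        cU := Pi.single i (BimodRep.dualRight (b.cU i) (A.1 (X.one i) (X.one i)))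
        cW := 0, cD := Pi.single i (b.cD i * A), cV := 0, cG := 0 } := by
  ext1
  · simp [ofD]
  · ext1 i'
    rcases eq_or_ne i' i with rfl | h
    · simp [ofD]
    · simp [ofD, h]
  · simp [ofD]
  · ext1 i'
    rcases eq_or_ne i' i with rfl | h
    · simp [ofD]
    · simp [ofD, h]
  · simp [ofD]; rfl
  · simp [ofD]

theorem diagBlock_mul_apply {i : Fin X.t} (j : X.Arm i) (A : X.Block i) (a b : X.Arm i) :
    (diagBlock j * A).1 a b = if a = j then A.1 j b else 0 := by
  rw [diagBlock_eq, unitBlock_mul_apply, one_mul]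

theorem mul_diagBlock_apply {i : Fin X.t} (j : X.Arm i) (A : X.Block i) (a b : X.Arm i) :
    (A * diagBlock j).1 a b = if b = j then A.1 a j else 0 := by
  rw [diagBlock_eq, mul_unitBlock_apply, mul_one]

theorem sum_diagBlock_smul {i : Fin X.t} (j : X.Arm i) (v : X.Arm i → (X.rep i).V)
    (a : X.Arm i) : ∑ c, (diagBlock j).1 a c • v c = if a = j then v j else 0 := by
  rw [diagBlock_eq, sum_unitBlock_smul, one_smul]

/-- Elements of `e_i(j) B` are determined by their entries in row `i(j)`. -/
theorem arm_ext {i : Fin X.t} {j : X.Arm i} {b b' : X.CDAlgebra} (h : idem (.arm i j) * b = b)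
    (h' : idem (.arm i j) * b' = b') (hD : ∀ c, (b.cD i).1 j c = (b'.cD i).1 j c)
    (hV : b.cV i j = b'.cV i j) : b = b' := by
  rw [← h, ← h', idem_arm, ofD_single_mul, ofD_single_mul]
  congr 2
  · refine Subtype.ext (Matrix.ext fun a c => ?_)
    rw [diagBlock_mul_apply, diagBlock_mul_apply, hD]
  · funext a
    rw [sum_diagBlock_smul, sum_diagBlock_smul, hV]

theorem idem_mul_idem (x : X.Vertex) : (idem x : X.CDAlgebra) * idem x = idem x := by
  cases x with
  | F => rw [idem_F_mul]; rfl
  | G => rw [idem_G_mul]; rfl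
  | arm i j =>
    rw [idem_arm, ofD_single_mul]
    ext1
    · rfl
    · rfl
    · rfl
    · change Pi.single i _ = Pi.single i _
      congr 1
      refine Subtype.ext (Matrix.ext fun a c => ?_)
      rw [show (ofD (Pi.single i (diagBlock j)) : X.CDAlgebra).cD i = diagBlock j from
        Pi.single_eq_same i _, diagBlock_mul_apply, diagBlock_eq, unitBlock_apply, unitBlock_apply]
      grind
    · change (Pi.single i (fun a => ∑ c, (diagBlock j).1 a c • (0 : (X.rep i).V)) :
        ∀ i, X.Arm i → (X.rep i).V) = 0
      simp only [smul_zero, Finset.sum_const_zero]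
      exact Pi.single_zero i
    · rfl

theorem idem_mul_idem_of_ne {x y : X.Vertex} (h : x ≠ y) :
    (idem x : X.CDAlgebra) * idem y = 0 := by
  have h0 : ∀ (i : Fin X.t), (fun _ : X.Arm i => (0 : (X.rep i).V)) = 0 := fun _ => rfl
  cases x with
  | F =>
    rw [idem_F_mul]
    cases y with
    | F => exact absurd rfl h
    | G => rfl
    | arm i j => rfl
  | G =>
    rw [idem_G_mul]
    cases y with
    | F => rfl
    | G => exact absurd rfl h
    | arm i j => rfl
  | arm i j =>
    rw [idem_arm, ofD_single_mul]
    ext1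
    · rfl
    · rfl
    · rfl
    · change Pi.single i _ = 0
      rw [← Pi.single_zero i]
      congr 1
      cases y with
      | F => exact mul_zero _
      | G => exact mul_zero _
      | arm i' j' =>
        rcases eq_or_ne i i' with rfl | hi
        · have hj : j ≠ j' := fun e => h (by rw [e])
          rw [show (idem (.arm i j') : X.CDAlgebra).cD i = diagBlock j' from
            Pi.single_eq_same i _]
          refine Subtype.ext (Matrix.ext fun a c => ?_)
          rw [diagBlock_mul_apply, diagBlock_eq, unitBlock_apply]
          split_ifs with h1 h2
          · exact absurd h2.1.symm hj
          · rfl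
          · rfl
        · rw [show (idem (.arm i' j') : X.CDAlgebra).cD i = 0 from Pi.single_eq_of_ne hi _,
            mul_zero]
    · have hV : (idem y : X.CDAlgebra).cV i = 0 := by cases y <;> rfl
      simp only [hV, Pi.zero_apply, smul_zero, Finset.sum_const_zero, h0]
      exact Pi.single_zero i
    · rfl

instance : Fintype X.Vertex :=
  Fintype.ofEquiv (Option (Option (Σ i, X.Arm i)))
    { toFun := fun
        | none => .F
        | some none => .G
        | some (some ⟨i, j⟩) => .arm i j
      invFun := fun
        | .F => none
        | .G => some none
        | .arm i j => some (some ⟨i, j⟩)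
      left_inv := by rintro (_ | _ | ⟨i, j⟩) <;> rfl
      right_inv := by rintro (_ | ⟨i, j⟩ | _) <;> rfl }

theorem one_eq : (1 : X.CDAlgebra) = idem .F + (∑ i, ∑ j, idem (.arm i j)) + idem .G := by
  let πD : X.CDAlgebra →+ ∀ i, X.Block i := ⟨⟨cD, rfl⟩, fun _ _ => rfl⟩
  let πF : X.CDAlgebra →+ F := ⟨⟨cF, rfl⟩, fun _ _ => rfl⟩
  let πU : X.CDAlgebra →+ ∀ i, (X.rep i).Dual := ⟨⟨cU, rfl⟩, fun _ _ => rfl⟩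
  let πW : X.CDAlgebra →+ X.W := ⟨⟨cW, rfl⟩, fun _ _ => rfl⟩
  let πV : X.CDAlgebra →+ ∀ i, X.Arm i → (X.rep i).V := ⟨⟨cV, rfl⟩, fun _ _ => rfl⟩
  let πG : X.CDAlgebra →+ G := ⟨⟨cG, rfl⟩, fun _ _ => rfl⟩
  -- Every component other than `cD` vanishes on the idempotents of the arms.
  have h0 : ∀ {T : Type u} [AddCommGroup T] (π : X.CDAlgebra →+ T),
      (∀ i j, π (idem (.arm i j)) = 0) →
      π (idem .F + (∑ i, ∑ j, idem (.arm i j)) + idem .G) = π (idem .F) + π (idem .G) := by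
    intro T _ π hπ
    simp only [map_add, map_sum, hπ, Finset.sum_const_zero, add_zero]
  ext1
  · exact ((h0 πF fun _ _ => rfl).trans (add_zero (1 : F))).symm
  · exact ((h0 πU fun _ _ => rfl).trans (add_zero _)).symm
  · exact ((h0 πW fun _ _ => rfl).trans (add_zero _)).symm
  · change (1 : X.CDAlgebra).cD = πD (idem .F + (∑ i, ∑ j, idem (.arm i j)) + idem .G)
    rw [map_add, map_add, map_sum]
    simp only [map_sum]
    rw [show πD (idem .F) = 0 from rfl, show πD (idem .G) = 0 from rfl, zero_add, add_zero]
    change _ = ∑ i, ∑ j, Pi.single i (diagBlock j)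
    ext1 i
    rw [Finset.sum_apply, Finset.sum_eq_single i]
    · rw [Finset.sum_apply]
      simp only [Pi.single_eq_same]
      refine Subtype.ext (Matrix.ext fun a c => ?_)
      rw [AddSubmonoidClass.coe_finsetSum, Matrix.sum_apply]
      simp only [diagBlock_eq, unitBlock_apply]
      change (1 : Matrix (X.Arm i) (X.Arm i) (X.D i)) a c = _
      rw [Finset.sum_eq_single a]
      · simp [Matrix.one_apply]
      · intro b _ hb
        rw [if_neg (fun h => hb h.1)]
      · exact fun h => absurd (Finset.mem_univ _) h
    · intro i' _ hi'
      rw [Finset.sum_apply]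
      exact Finset.sum_eq_zero fun j _ => Pi.single_eq_of_ne hi'.symm _
    · exact fun h => absurd (Finset.mem_univ _) h
  · exact ((h0 πV fun _ _ => rfl).trans (add_zero _)).symm
  · exact ((h0 πG fun _ _ => rfl).trans (zero_add (1 : G))).symm

end CDAlgebra
end Datum
end MatrixUnits

/-! ### The simple modules of the Coxeter-Dynkin algebra -/

section SimpleModules

variable {k F G M : Type u} [Field k] [DivisionRing F] [DivisionRing G]
  [Algebra k F] [Algebra k G] [AddCommGroup M] [Module k M] [Module F M] [Module Gᵐᵒᵖ M]

instance (X : BimodRep k F G M) : Module.Finite k X.End := by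
  have h : Module.Finite k (Module.End k X.U × Module.End k X.V) := inferInstance
  let φ : X.End →ₗ[k] Module.End k X.U × Module.End k X.V :=
    { toFun := fun d => (d.1.1.restrictScalars k, d.1.2.restrictScalars k)
      map_add' := fun _ _ => rfl
      map_smul' := fun _ _ => rfl }
  refine Module.Finite.of_injective φ fun d d' h => ?_
  have h1 : ∀ u, d.1.1 u = d'.1.1 u := fun u =>
    (LinearMap.congr_fun (Prod.ext_iff.1 h).1 u : (φ d).1 u = (φ d').1 u)
  have h2 : ∀ u, d.1.2 u = d'.1.2 u := fun u =>
    (LinearMap.congr_fun (Prod.ext_iff.1 h).2 u : (φ d).2 u = (φ d').2 u)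
  exact Subtype.ext (Prod.ext (LinearMap.ext h1) (LinearMap.ext h2))

instance (X : BimodRep k F G M) : Module.Finite X.End X.U := Module.Finite.of_restrictScalars_finite k _ _

theorem finite_linearMap_of_tower (D U V : Type*) [Ring D] [Algebra k D] [AddCommGroup U]
    [Module D U] [AddCommGroup V] [Module D V] [Module k U] [IsScalarTower k D U] [Module k V]
    [IsScalarTower k D V] [SMulCommClass D k V] [Module.Finite k U] [Module.Finite k V] :
    Module.Finite k (U →ₗ[D] V) := by
  let φ : (U →ₗ[D] V) →ₗ[k] (U →ₗ[k] V) :=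
    { toFun := fun f => f.restrictScalars k
      map_add' := fun _ _ => rfl
      map_smul' := fun _ _ => rfl }
  exact Module.Finite.of_injective φ fun f g h => LinearMap.ext fun x => LinearMap.congr_fun h x

instance (X : BimodRep k F G M) : Module.Finite k X.HomUV :=
  finite_linearMap_of_tower X.End X.U X.V

instance (X : BimodRep k F G M) : Module.Finite k X.Dual :=
  finite_linearMap_of_tower X.End X.U X.End

namespace Datum

variable {X : Datum k F G M}

namespace CDAlgebra

instance [Module.Finite k F] [Module.Finite k G] : Module.Finite k X.CDAlgebra := by
  have : ∀ i, Module.Finite k (X.Block i) := fun i =>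
    inferInstanceAs (Module.Finite k (Subalgebra.toSubmodule (X.Block i)))
  have h : Module.Finite k (F × (∀ i, (X.rep i).Dual) × X.W × (∀ i, X.Block i) ×
    (∀ i, X.Arm i → (X.rep i).V) × G) := inferInstance
  let φ : X.CDAlgebra →ₗ[k] F × (∀ i, (X.rep i).Dual) × X.W × (∀ i, X.Block i) ×
    (∀ i, X.Arm i → (X.rep i).V) × G :=
    { toFun := equivProd
      map_add' := fun _ _ => rfl
      map_smul' := fun _ _ => rfl }
  exact Module.Finite.of_injective φ equivProd.injective

theorem algebraMap_eq (c : k) : algebraMap k X.CDAlgebra c = c • 1 :=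
  Algebra.algebraMap_eq_smul_one c

/-- The projection of `B` onto the division algebra at the vertex `F`. -/
def χF : X.CDAlgebra →ₐ[k] F where
  toFun := cF
  map_one' := rfl
  map_mul' _ _ := rfl
  map_zero' := rfl
  map_add' _ _ := rfl
  commutes' c := by rw [algebraMap_eq, smul_cF, one_cF, Algebra.algebraMap_eq_smul_one]

/-- The projection of `B` onto the division algebra at the vertex `G`. -/
def χG : X.CDAlgebra →ₐ[k] G where
  toFun := cG
  map_one' := rfl
  map_mul' _ _ := rfl
  map_zero' := rfl
  map_add' _ _ := rfl
  commutes' c := by rw [algebraMap_eq, smul_cG, one_cG, Algebra.algebraMap_eq_smul_one]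

/-- The projection of `B` onto the division algebra at the vertex `i(j)`. -/
def χArm (i : Fin X.t) (j : X.Arm i) : X.CDAlgebra →ₐ[k] X.D i where
  toFun b := (b.cD i).1 j j
  map_one' := Matrix.one_apply_eq j
  map_mul' _ _ := block_mul_diag _ _ j
  map_zero' := rfl
  map_add' _ _ := rfl
  commutes' c := by
    rw [algebraMap_eq, Algebra.algebraMap_eq_smul_one]
    change c • (1 : Matrix (X.Arm i) (X.Arm i) (X.D i)) j j = _
    rw [Matrix.one_apply_eq]

theorem ofD_single_cD (i : Fin X.t) (A : X.Block i) :
    (ofD (Pi.single i A) : X.CDAlgebra).cD i = A :=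
  Pi.single_eq_same (M := fun i => X.Block i) i A

theorem idem_arm_mul_unitBlock {i : Fin X.t} {a b : X.Arm i} (h : b ≤ a) (d : X.D i) :
    (idem (.arm i a) : X.CDAlgebra) * ofD (Pi.single i (unitBlock h d)) =
      ofD (Pi.single i (unitBlock h d)) := by
  have h1 : diagBlock a * unitBlock h d = unitBlock h d := by
    refine Subtype.ext (Matrix.ext fun a' c => ?_)
    rw [diagBlock_mul_apply, unitBlock_apply, unitBlock_apply]
    grind
  have h2 : (fun a' => ∑ c, (diagBlock a).1 a' c • (0 : (X.rep i).V)) = 0 := by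
    funext a'
    simp only [smul_zero, Finset.sum_const_zero]
    rfl
  rw [idem_arm, ofD_single_mul, ofD_single_cD, h1]
  ext1
  · rfl
  · rfl
  · rfl
  · rfl
  · exact (congr_arg (Pi.single (M := fun i => X.Arm i → (X.rep i).V) i) h2).trans (Pi.single_zero i)
  · rfl

theorem unitBlock_mul_idem_arm {i : Fin X.t} {a : X.Arm i} (d : X.D i) :
    (ofD (Pi.single i (unitBlock (le_refl a) d)) : X.CDAlgebra) * idem (.arm i a) =
      ofD (Pi.single i (unitBlock (le_refl a) d)) := by
  have h1 : unitBlock (le_refl a) d * diagBlock a = unitBlock (le_refl a) d := by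
    refine Subtype.ext (Matrix.ext fun a' c => ?_)
    rw [mul_diagBlock_apply, unitBlock_apply, unitBlock_apply]
    grind
  rw [idem_arm, mul_ofD_single, ofD_single_cD, h1]
  ext1
  · rfl
  · exact (congr_arg (Pi.single (M := fun i => (X.rep i).Dual) i) (dualRight_zero_left _)).trans
      (Pi.single_zero i)
  · rfl
  · rfl
  · rfl
  · rfl

theorem idem_arm_mul_ofV {i : Fin X.t} (a : X.Arm i) (v : (X.rep i).V) :
    (idem (.arm i a) : X.CDAlgebra) * ofV (Pi.single i (Pi.single a v)) =
      ofV (Pi.single i (Pi.single a v)) := by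
  have h2 : (fun a' => ∑ c, (diagBlock a).1 a' c •
      (ofV (Pi.single i (Pi.single a v)) : X.CDAlgebra).cV i c) = Pi.single a v := by
    funext a'
    rw [sum_diagBlock_smul, show (ofV (Pi.single i (Pi.single a v)) : X.CDAlgebra).cV i =
      Pi.single a v from Pi.single_eq_same i _, Pi.single_eq_same]
    split_ifs with h
    · rw [h, Pi.single_eq_same]
    · rw [Pi.single_eq_of_ne h]
  rw [idem_arm, ofD_single_mul, h2, show (ofV (Pi.single i (Pi.single a v)) : X.CDAlgebra).cD i = 0
    from rfl, mul_zero, Pi.single_zero]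
  rfl

/-- The idempotents `e_x` are local. -/
def localIdempotent (hX : ∀ i, (X.rep i).IsBrick) (hX' : ∀ i, Nontrivial (X.D i)) :
    ∀ x : X.Vertex, LocalIdempotent k (idem x : X.CDAlgebra)
  | .F =>
    { D := F
      χ := χF
      idem := idem_mul_idem _
      exists_inv := fun d hd => ⟨d⁻¹, mul_inv_cancel₀ hd⟩
      map_idem := rfl
      surj := fun d => ⟨{ cF := d, cU := 0, cW := 0, cD := 0, cV := 0, cG := 0 }, idem_F_mul _,
        mul_idem_F _, rfl⟩
      inj := fun b h1 h2 h3 => by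
        rw [← h2, mul_idem_F, show b.cF = 0 from h3]
        rfl }
  | .G =>
    { D := G
      χ := χG
      idem := idem_mul_idem _
      exists_inv := fun d hd => ⟨d⁻¹, mul_inv_cancel₀ hd⟩
      map_idem := rfl
      surj := fun d => ⟨{ cF := 0, cU := 0, cW := 0, cD := 0, cV := 0, cG := d }, idem_G_mul _,
        mul_idem_G _, rfl⟩
      inj := fun b h1 h2 h3 => by
        rw [← h1, idem_G_mul, show b.cG = 0 from h3]
        rfl }
  | .arm i j =>
    { D := X.D i
      nontrivialD := hX' i
      χ := χArm i j
      idem := idem_mul_idem _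
      exists_inv := fun d hd => (hX i d hd).exists_right_inv
      map_idem := by
        change ((Pi.single i (diagBlock j) : ∀ i, X.Block i) i).1 j j = 1
        rw [Pi.single_eq_same, diagBlock_eq, unitBlock_apply, if_pos ⟨rfl, rfl⟩]
      surj := fun d => by
        refine ⟨ofD (Pi.single i (unitBlock (le_refl j) d)), idem_arm_mul_unitBlock _ _,
          unitBlock_mul_idem_arm d, ?_⟩
        · change ((Pi.single i (unitBlock (le_refl j) d) : ∀ i, X.Block i) i).1 j j = d
          rw [Pi.single_eq_same, unitBlock_apply, if_pos ⟨rfl, rfl⟩]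
      -- Right multiplication by e_i(j) kills the V-entries and all block columns except j, and left
      -- multiplication keeps only row i(j); what remains is the diagonal entry read by χ.
      inj := fun b h1 h2 h3 => by
        have h2' := h2
        rw [idem_arm, mul_ofD_single] at h2'
        refine arm_ext h1 (mul_zero _) (fun c => ?_) ?_
        · rcases eq_or_ne c j with rfl | hc
          · exact h3
          · rw [← h2']
            change ((Pi.single i (b.cD i * diagBlock j) : ∀ i, X.Block i) i).1 j c = 0
            rw [Pi.single_eq_same, mul_diagBlock_apply, if_neg hc]
        · rw [← h2']
          rfl }

/-- The idempotents sum to 1, so at least one of them acts non-trivially on a non-zero t ∈ T, and T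
is then the top of the corresponding e_x B. -/
theorem exists_equiv_top (hX : ∀ i, (X.rep i).IsBrick) (hX' : ∀ i, Nontrivial (X.D i))
    (T : Type u) [AddCommGroup T] [Module X.CDAlgebraᵐᵒᵖ T] [IsSimpleModule X.CDAlgebraᵐᵒᵖ T] :
    ∃ x : X.Vertex, Nonempty (T ≃ₗ[X.CDAlgebraᵐᵒᵖ] (simple x).obj) := by
  have := IsSimpleModule.nontrivial X.CDAlgebraᵐᵒᵖ T
  obtain ⟨t, ht⟩ := exists_ne (0 : T)
  by_contra! h
  have h' : ∀ x : X.Vertex, op (idem x : X.CDAlgebra) • t = 0 := fun x => by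
    by_contra hx
    exact not_isEmpty_of_nonempty _ (h := (localIdempotent hX hX' x).nonempty_equiv_top hx) (h x)
  refine ht ?_
  rw [← one_smul X.CDAlgebraᵐᵒᵖ t, ← op_one, one_eq, MulOpposite.op_add, MulOpposite.op_add,
    add_smul, add_smul, h', h', zero_add, add_zero, Finset.op_sum, Finset.sum_smul]
  refine Finset.sum_eq_zero fun i _ => ?_
  rw [Finset.op_sum, Finset.sum_smul]
  exact Finset.sum_eq_zero fun j _ => h' _

end CDAlgebra
end Datum
end SimpleModules

/-! ### Projective resolutions of the simple modules -/

section Resolutions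

/-- Exactness at e B of a sequence ending in its top becomes a condition on one diagonal entry. -/
theorem LocalIdempotent.mkQ_eq_zero {k B : Type u} [Field k] [Ring B] [Algebra k B] {e : B}
    (L : LocalIdempotent k e) (b : rightIdeal e) :
    (Module.jacobson Bᵐᵒᵖ (rightIdeal e)).mkQ b = 0 ↔ L.χ b = 0 := by
  rw [Submodule.mkQ_apply, Submodule.Quotient.mk_eq_zero, L.jacobson_eq, LinearMap.mem_ker,
    L.proj_apply]

/-- The map `(b_s) ↦ ∑ c_s b_s`. -/
def sumLeftMul {B ι : Type*} [Ring B] [Fintype ι] (e : B) {e' : B} (c : ι → rightIdeal e') :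
    (ι → rightIdeal e) →ₗ[Bᵐᵒᵖ] rightIdeal e' :=
  ∑ s, leftMul e (c s) ∘ₗ LinearMap.proj s

theorem coe_sumLeftMul {B ι : Type*} [Ring B] [Fintype ι] (e : B) {e' : B} (c : ι → rightIdeal e')
    (b : ι → rightIdeal e) : (sumLeftMul e c b : B) = ∑ s, (c s : B) * b s := by
  rw [sumLeftMul, LinearMap.sum_apply, Submodule.coe_sum]
  rfl

variable {k F G M : Type u} [Field k] [DivisionRing F] [DivisionRing G]
  [Algebra k F] [Algebra k G] [AddCommGroup M] [Module k M] [Module F M] [Module Gᵐᵒᵖ M]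

namespace Datum

variable {X : Datum k F G M}

namespace CDAlgebra

theorem sum_cU {ι : Type*} (s : Finset ι) (b : ι → X.CDAlgebra) (i : Fin X.t) :
    (∑ j ∈ s, b j).cU i = ∑ j ∈ s, (b j).cU i :=
  map_sum (⟨⟨fun b => b.cU i, rfl⟩, fun _ _ => rfl⟩ : X.CDAlgebra →+ (X.rep i).Dual) b s

theorem sum_cF {ι : Type*} (s : Finset ι) (b : ι → X.CDAlgebra) :
    (∑ j ∈ s, b j).cF = ∑ j ∈ s, (b j).cF :=
  map_sum (⟨⟨fun b => b.cF, rfl⟩, fun _ _ => rfl⟩ : X.CDAlgebra →+ F) b s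

theorem sum_cW {ι : Type*} (s : Finset ι) (b : ι → X.CDAlgebra) :
    (∑ j ∈ s, b j).cW = ∑ j ∈ s, (b j).cW :=
  map_sum (⟨⟨fun b => b.cW, rfl⟩, fun _ _ => rfl⟩ : X.CDAlgebra →+ X.W) b s

theorem sum_cD {ι : Type*} (s : Finset ι) (b : ι → X.CDAlgebra) (i : Fin X.t) :
    (∑ j ∈ s, b j).cD i = ∑ j ∈ s, (b j).cD i :=
  map_sum (⟨⟨fun b => b.cD i, rfl⟩, fun _ _ => rfl⟩ : X.CDAlgebra →+ X.Block i) b s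

theorem sum_cV {ι : Type*} (s : Finset ι) (b : ι → X.CDAlgebra) (i : Fin X.t) (a : X.Arm i) :
    (∑ j ∈ s, b j).cV i a = ∑ j ∈ s, (b j).cV i a :=
  map_sum (⟨⟨fun b => b.cV i a, rfl⟩, fun _ _ => rfl⟩ : X.CDAlgebra →+ (X.rep i).V) b s

theorem idem_mul_coe {x : X.Vertex} (b : rightIdeal (idem x : X.CDAlgebra)) :
    idem x * (b : X.CDAlgebra) = b := (mem_rightIdeal (idem_mul_idem x)).1 b.2

theorem projective_F_ext {b b' : rightIdeal (idem .F : X.CDAlgebra)}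
    (hF : b.1.cF = b'.1.cF) (hU : b.1.cU = b'.1.cU) (hW : b.1.cW = b'.1.cW) : b = b' := by
  refine Subtype.ext ?_
  rw [← idem_mul_coe b, ← idem_mul_coe b', idem_F_mul, idem_F_mul, hF, hU, hW]

theorem projective_G_ext {b b' : rightIdeal (idem .G : X.CDAlgebra)}
    (hG : b.1.cG = b'.1.cG) : b = b' := by
  refine Subtype.ext ?_
  rw [← idem_mul_coe b, ← idem_mul_coe b', idem_G_mul, idem_G_mul, hG]

theorem projective_arm_ext {i : Fin X.t} {j : X.Arm i}
    {b b' : rightIdeal (idem (.arm i j) : X.CDAlgebra)}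
    (hD : ∀ c, (b.1.cD i).1 j c = (b'.1.cD i).1 j c)
    (hV : b.1.cV i j = b'.1.cV i j) : b = b' :=
  Subtype.ext (arm_ext (idem_mul_coe b) (idem_mul_coe b') hD hV)

theorem projective_one_ext {i : Fin X.t}
    {b b' : rightIdeal (idem (.arm i (X.one i)) : X.CDAlgebra)}
    (hD : (b.1.cD i).1 (X.one i) (X.one i) = (b'.1.cD i).1 (X.one i) (X.one i))
    (hV : b.1.cV i (X.one i) = b'.1.cV i (X.one i)) : b = b' := by
  refine projective_arm_ext (fun c => ?_) hV
  rcases eq_or_ne c (X.one i) with rfl | hc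
  · exact hD
  · rw [block_one _ hc, block_one _ hc]

/-- The elements of `e_G B`. -/
def ofG (g : G) : rightIdeal (idem .G : X.CDAlgebra) :=
  ⟨{ cF := 0, cU := 0, cW := 0, cD := 0, cV := 0, cG := g },
    (mem_rightIdeal (idem_mul_idem _)).2 (idem_G_mul _)⟩

/-- An element of `e_i(a) B` with a single entry. -/
def armV {i : Fin X.t} (a : X.Arm i) (v : (X.rep i).V) :
    rightIdeal (idem (.arm i a) : X.CDAlgebra) :=
  ⟨ofV (Pi.single i (Pi.single a v)),
    (mem_rightIdeal (idem_mul_idem _)).2 (idem_arm_mul_ofV a v)⟩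

/-- An element of `e_i(a) B` with a single entry. -/
def armD {i : Fin X.t} {a b : X.Arm i} (h : b ≤ a) (d : X.D i) :
    rightIdeal (idem (.arm i a) : X.CDAlgebra) :=
  ⟨ofD (Pi.single i (unitBlock h d)),
    (mem_rightIdeal (idem_mul_idem _)).2 (idem_arm_mul_unitBlock h d)⟩

/-- The elements of `U^∨` as elements of `e_F B`. -/
def rowU (φ : ∀ i, (X.rep i).Dual) : rightIdeal (idem .F : X.CDAlgebra) :=
  ⟨ofU φ, (mem_rightIdeal (idem_mul_idem _)).2 (idem_F_mul _)⟩

theorem armV_cV {i : Fin X.t} (a : X.Arm i) (v : (X.rep i).V) : (armV a v).1.cV i a = v :=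
  (congr_fun (Pi.single_eq_same (M := fun i => X.Arm i → (X.rep i).V) i _) a).trans
    (Pi.single_eq_same (M := fun _ => (X.rep i).V) a v)

theorem armD_cD {i : Fin X.t} {a b : X.Arm i} (h : b ≤ a) (d : X.D i) :
    (armD h d).1.cD i = unitBlock h d := ofD_single_cD _ _

theorem mul_cD_apply (x y : X.CDAlgebra) (i : Fin X.t) : (x * y).cD i = x.cD i * y.cD i := rfl

theorem mul_cV_apply (x y : X.CDAlgebra) (i : Fin X.t) (a : X.Arm i) :
    (x * y).cV i a = (∑ b, (x.cD i).1 a b • y.cV i b) + op y.cG • x.cV i a := rfl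

theorem mul_cU_apply (x y : X.CDAlgebra) (i : Fin X.t) : (x * y).cU i =
    BimodRep.dualLeft x.cF (y.cU i) +
      BimodRep.dualRight (x.cU i) ((y.cD i).1 (X.one i) (X.one i)) := rfl

/-- The element of `e_i(a) B` with the given entries in the blocks `(i(a), i)` and
`(i(a), G)`. -/
def armRow {i : Fin X.t} (a : X.Arm i) (A : X.Block i) (v : (X.rep i).V) :
    rightIdeal (idem (.arm i a) : X.CDAlgebra) :=
  ⟨idem (.arm i a) * ofD (Pi.single i A), (mem_rightIdeal (idem_mul_idem _)).2 (by
    rw [← mul_assoc, idem_mul_idem])⟩ + armV a v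

theorem armRow_cD {i : Fin X.t} (a : X.Arm i) (A : X.Block i) (v : (X.rep i).V) (c : X.Arm i) :
    ((armRow a A v).1.cD i).1 a c = A.1 a c := by
  have h : (armRow a A v).1.cD i = diagBlock a * A := by
    change (idem (.arm i a) * ofD (Pi.single i A) : X.CDAlgebra).cD i + 0 = _
    rw [mul_cD_apply, idem_arm, ofD_single_cD, ofD_single_cD, add_zero]
  rw [h, diagBlock_mul_apply, if_pos rfl]

theorem armRow_cV {i : Fin X.t} (a : X.Arm i) (A : X.Block i) (v : (X.rep i).V) :
    (armRow a A v).1.cV i a = v := by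
  have h : (idem (.arm i a) * ofD (Pi.single i A) : X.CDAlgebra).cV i a = 0 := by
    rw [mul_cV_apply]
    simp [ofD, idem]
  change (idem (.arm i a) * ofD (Pi.single i A) : X.CDAlgebra).cV i a + (armV a v).1.cV i a = v
  rw [h, armV_cV, zero_add]

/-! #### The inclusion of `e_i(b) B` in `e_i(b+1) B` -/

theorem armD_mul_cD {i : Fin X.t} {a b : X.Arm i} (h : b ≤ a) (y : X.CDAlgebra) (c : X.Arm i) :
    ((armD h 1 * y).cD i).1 a c = (y.cD i).1 b c := by
  rw [mul_cD_apply, armD_cD, unitBlock_mul_apply, if_pos rfl, one_mul]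

theorem armD_mul_cV {i : Fin X.t} {a b : X.Arm i} (h : b ≤ a) (y : X.CDAlgebra) :
    (armD h 1 * y).cV i a = y.cV i b := by
  rw [mul_cV_apply, armD_cD, sum_unitBlock_smul, if_pos rfl, one_smul,
    show (armD h 1 : X.CDAlgebra).cV i a = 0 from rfl, smul_zero, add_zero]

theorem armInclusion_injective {i : Fin X.t} {a b : X.Arm i} (h : b ≤ a) :
    Function.Injective (leftMul (idem (.arm i b)) (armD h 1)) := by
  intro y y' hy
  have hy' := congr_arg Subtype.val hy
  rw [coe_leftMul, coe_leftMul] at hy'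
  refine projective_arm_ext (fun c => ?_) ?_
  · rw [← armD_mul_cD h, ← armD_mul_cD h, hy']
  · rw [← armD_mul_cV h, ← armD_mul_cV h, hy']

/-- If the diagonal entry of row i(a) vanishes, the row has block entries only in columns up to b =
a - 1, together with an entry in V_i. This is the shape of row i(b), and left multiplication by a
matrix unit moves that row to row i(a). -/
theorem armInclusion_exact (hX : ∀ i, (X.rep i).IsBrick) (hX' : ∀ i, Nontrivial (X.D i))
    {i : Fin X.t} {a b : X.Arm i} (h : b ≤ a) (hab : b.1 + 1 = a.1) :
    Function.Exact (leftMul (idem (.arm i b)) (armD h 1))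
      (Module.jacobson X.CDAlgebraᵐᵒᵖ (rightIdeal (idem (.arm i a) : X.CDAlgebra))).mkQ := by
  intro y
  rw [(localIdempotent hX hX' (.arm i a)).mkQ_eq_zero]
  constructor
  · intro hy
    replace hy : (y.1.cD i).1 a a = 0 := hy
    -- Row i(a) of y moved to row i(b). An entry in a column c > b must vanish: for c = a by `hy`,
    -- for c > a by triangularity of y.
    let A : X.Block i := ⟨Matrix.of fun a' c => if a' = b then (y.1.cD i).1 a c else 0, by
      intro a' c hc
      rw [Matrix.of_apply]
      split_ifs with h1
      · rw [h1] at hc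
        rcases eq_or_ne c a with rfl | hca
        · exact hy
        · refine (y.1.cD i).2 a c (lt_of_le_of_ne ?_ hca.symm)
          change a.1 ≤ c.1
          have : b.1 < c.1 := hc
          omega
      · rfl⟩
    refine ⟨armRow b A (y.1.cV i a), projective_arm_ext (fun c => ?_) ?_⟩
    · rw [coe_leftMul, armD_mul_cD, armRow_cD]
      exact if_pos rfl
    · rw [coe_leftMul, armD_mul_cV, armRow_cV]
  · rintro ⟨x, rfl⟩
    change ((leftMul (idem (.arm i b)) (armD h 1) x).1.cD i).1 a a = 0
    rw [coe_leftMul, armD_mul_cD]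
    refine (x.1.cD i).2 b a ?_
    change b.1 < a.1
    omega

/-! #### The radical of `e_i(1) B` -/

theorem sum_armV_mul_cV {ι : Type*} [Fintype ι] {i : Fin X.t} (a : X.Arm i) (v : ι → (X.rep i).V)
    (x : ι → X.CDAlgebra) (hx : ∀ s, (x s).cV = 0) :
    (∑ s, (armV a (v s)).1 * x s).cV i a = ∑ s, op (x s).cG • v s := by
  rw [sum_cV]
  refine Finset.sum_congr rfl fun s _ => ?_
  rw [mul_cV_apply, armV_cV, hx]
  simp

theorem sum_armV_mul_cD {ι : Type*} [Fintype ι] {i : Fin X.t} (a : X.Arm i) (v : ι → (X.rep i).V)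
    (x : ι → X.CDAlgebra) : (∑ s, (armV a (v s)).1 * x s).cD i = 0 := by
  rw [sum_cD]
  refine Finset.sum_eq_zero fun s _ => ?_
  rw [mul_cD_apply, show (armV a (v s)).1.cD i = 0 from rfl, zero_mul]

theorem cV_eq_zero (x : rightIdeal (idem .G : X.CDAlgebra)) : x.1.cV = 0 := by
  rw [← idem_mul_coe x, idem_G_mul]

theorem radOne_injective {ι : Type*} [Fintype ι] {i : Fin X.t}
    (v : Module.Basis ι Gᵐᵒᵖ (X.rep i).V) :
    Function.Injective (sumLeftMul (idem .G) fun s => armV (X.one i) (v s)) := by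
  rw [injective_iff_map_eq_zero]
  intro x hx
  have h := congr_arg (fun b : rightIdeal _ => b.1.cV i (X.one i)) hx
  replace h : ((sumLeftMul (idem .G) (fun s => armV (X.one i) (v s)) x : _) :
    X.CDAlgebra).cV i (X.one i) = 0 := h
  rw [coe_sumLeftMul, sum_armV_mul_cV _ _ _ fun s => cV_eq_zero (x s)] at h
  have h' := Fintype.linearIndependent_iff.1 v.linearIndependent _ h
  funext s
  exact projective_G_ext (op_injective (h' s))

/-- Row i(1) has only one entry from D_i and one from V_i, so the radical is V_i. The only non-zero
row entry of e_G B is G, so a G-basis of V_i presents the radical as a sum of copies of e_G B. -/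
theorem radOne_exact (hX : ∀ i, (X.rep i).IsBrick) (hX' : ∀ i, Nontrivial (X.D i))
    {ι : Type*} [Fintype ι] {i : Fin X.t} (v : Module.Basis ι Gᵐᵒᵖ (X.rep i).V) :
    Function.Exact (sumLeftMul (idem .G) fun s => armV (X.one i) (v s))
      (Module.jacobson X.CDAlgebraᵐᵒᵖ
        (rightIdeal (idem (.arm i (X.one i)) : X.CDAlgebra))).mkQ := by
  intro y
  rw [(localIdempotent hX hX' (.arm i (X.one i))).mkQ_eq_zero]
  constructor
  · intro hy
    replace hy : (y.1.cD i).1 (X.one i) (X.one i) = 0 := hy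
    refine ⟨fun s => ofG (unop (v.repr (y.1.cV i (X.one i)) s)), projective_one_ext ?_ ?_⟩
    · rw [coe_sumLeftMul, sum_armV_mul_cD, hy]
      rfl
    · rw [coe_sumLeftMul, sum_armV_mul_cV _ _ _ fun s => rfl]
      exact v.sum_repr _
  · rintro ⟨x, rfl⟩
    change ((sumLeftMul _ _ x).1.cD i).1 _ _ = 0
    rw [coe_sumLeftMul, sum_armV_mul_cD]
    rfl

end CDAlgebra
end Datum
end Resolutions

/-! ### The projective resolution of the simple module at the vertex `F` -/

section ResolutionF

variable {k F G M : Type u} [Field k] [DivisionRing F] [DivisionRing G]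
  [Algebra k F] [Algebra k G] [AddCommGroup M] [Module k M] [Module F M] [Module Gᵐᵒᵖ M]

namespace Datum

variable {X : Datum k F G M}

namespace CDAlgebra

theorem wMul_single (i : Fin X.t) (φ : (X.rep i).Dual) (v : ∀ i, (X.rep i).V) :
    wMul (Pi.single i φ) v =
      (LinearMap.range X.theta).mkQ (Pi.single i (BimodRep.dualTensor φ (v i))) := by
  rw [wMul, Submodule.mkQ_apply]
  congr 1
  ext1 i'
  rcases eq_or_ne i' i with rfl | h
  · rw [Pi.single_eq_same, Pi.single_eq_same]
  · rw [Pi.single_eq_of_ne h, Pi.single_eq_of_ne h]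
    ext u
    simp [BimodRep.dualTensor_apply]

theorem rowU_mul_cU (φ : ∀ i, (X.rep i).Dual) (y : X.CDAlgebra) (i : Fin X.t) :
    ((rowU φ).1 * y).cU i = BimodRep.dualRight (φ i) ((y.cD i).1 (X.one i) (X.one i)) := by
  rw [mul_cU_apply, show (rowU φ).1.cF = 0 from rfl, dualLeft_zero_left, zero_add]
  rfl

theorem rowU_mul_cW (φ : ∀ i, (X.rep i).Dual) {y : X.CDAlgebra} (hy : y.cG = 0) :
    ((rowU φ).1 * y).cW = wMul φ fun i => y.cV i (X.one i) := by
  rw [mul_cW, show (rowU φ).1.cF = 0 from rfl, wLeft_zero, hy, wRight_zero, zero_add, add_zero]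
  rfl

theorem rowU_mul_cF (φ : ∀ i, (X.rep i).Dual) (y : X.CDAlgebra) : ((rowU φ).1 * y).cF = 0 := by
  rw [mul_cF, show (rowU φ).1.cF = 0 from rfl, zero_mul]

theorem cG_eq_zero {i : Fin X.t} {a : X.Arm i} (x : rightIdeal (idem (.arm i a) : X.CDAlgebra)) :
    x.1.cG = 0 := by
  rw [← idem_mul_coe x, mul_cG]
  exact zero_mul _

/-- The free module `⨁ (e_i(1) B)^{e_i}`. -/
abbrev CoverF (X : Datum k F G M) : Type u :=
  ∀ i, Fin (X.e i) → rightIdeal (idem (.arm i (X.one i)) : X.CDAlgebra)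

/-- The map `⨁ (e_i(1) B)^{e_i} ⟶ e_F B`. -/
def coverF (φ : ∀ i, Fin (X.e i) → (X.rep i).Dual) :
    CoverF X →ₗ[X.CDAlgebraᵐᵒᵖ] rightIdeal (idem .F : X.CDAlgebra) :=
  ∑ i, sumLeftMul (idem (.arm i (X.one i))) (fun s => rowU (Pi.single i (φ i s))) ∘ₗ
    LinearMap.proj i

variable (φ : ∀ i, Fin (X.e i) → (X.rep i).Dual)

theorem coe_coverF (b : CoverF X) : (coverF φ b : X.CDAlgebra) =
    ∑ i, ∑ s, (rowU (Pi.single i (φ i s))).1 * (b i s).1 := by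
  rw [coverF, LinearMap.sum_apply, Submodule.coe_sum]
  exact Finset.sum_congr rfl fun i _ => coe_sumLeftMul _ _ _

theorem coverF_cF (b : CoverF X) : (coverF φ b).1.cF = 0 := by
  rw [coe_coverF, sum_cF]
  refine Finset.sum_eq_zero fun i _ => ?_
  rw [sum_cF]
  exact Finset.sum_eq_zero fun s _ => rowU_mul_cF _ _

theorem coverF_cU (b : CoverF X) (i : Fin X.t) : (coverF φ b).1.cU i =
    ∑ s, BimodRep.dualRight (φ i s) (((b i s).1.cD i).1 (X.one i) (X.one i)) := by
  rw [coe_coverF, sum_cU, Finset.sum_eq_single i]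
  · rw [sum_cU]
    refine Finset.sum_congr rfl fun s _ => ?_
    rw [rowU_mul_cU, Pi.single_eq_same]
  · intro i' _ hi
    rw [sum_cU]
    refine Finset.sum_eq_zero fun s _ => ?_
    rw [rowU_mul_cU, Pi.single_eq_of_ne hi.symm, dualRight_zero_left]
  · exact fun h => absurd (Finset.mem_univ _) h

theorem coverF_cW (b : CoverF X) : (coverF φ b).1.cW = (LinearMap.range X.theta).mkQ
    fun i => ∑ s, BimodRep.dualTensor (φ i s) ((b i s).1.cV i (X.one i)) := by
  have h : (fun i => ∑ s, BimodRep.dualTensor (φ i s) ((b i s).1.cV i (X.one i))) =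
      ∑ i, ∑ s, Pi.single i (BimodRep.dualTensor (φ i s) ((b i s).1.cV i (X.one i))) := by
    rw [← Finset.univ_sum_single (M := fun i => (X.rep i).HomUV)
      (fun i => ∑ s, BimodRep.dualTensor (φ i s) ((b i s).1.cV i (X.one i)))]
    refine Finset.sum_congr rfl fun i _ => ?_
    exact map_sum (AddMonoidHom.single (fun i => (X.rep i).HomUV) i) _ _
  rw [h, map_sum, coe_coverF, sum_cW]
  refine Finset.sum_congr rfl fun i _ => ?_
  rw [sum_cW, map_sum]
  refine Finset.sum_congr rfl fun s _ => ?_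
  rw [rowU_mul_cW _ (cG_eq_zero _), wMul_single]

/-- Dual basis expansion: the coordinate functionals generate U_i^∨ as a right D_i-module, so e_i
copies of e_i(1)B reach all of it. -/
theorem sum_coord_dualRight {i : Fin X.t} {n : ℕ} (u : Module.Basis (Fin n) (X.D i) (X.rep i).U)
    (ψ : (X.rep i).Dual) : ∑ s, BimodRep.dualRight (u.coord s) (ψ (u s)) = ψ := by
  refine u.ext fun r => ?_
  rw [LinearMap.sum_apply, Finset.sum_eq_single r]
  · simp [BimodRep.dualRight_apply]
  · intro s _ hs
    simp [BimodRep.dualRight_apply, Finsupp.single_eq_of_ne hs]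
  · exact fun h => absurd (Finset.mem_univ _) h

/-- Under U_i^∨ ⊗ V_i ≅ Hom(U_i, V_i), coefficients v_s along the dual basis become the values at
the basis vectors; e_i-tuples in V_i thus are the same as maps U_i → V_i. -/
theorem sum_coord_dualTensor {i : Fin X.t} {n : ℕ} (u : Module.Basis (Fin n) (X.D i) (X.rep i).U)
    (v : Fin n → (X.rep i).V) (r : Fin n) :
    (∑ s, BimodRep.dualTensor (u.coord s) (v s)) (u r) = v r := by
  rw [LinearMap.sum_apply, Finset.sum_eq_single r]
  · simp [BimodRep.dualTensor_apply]
  · intro s _ hs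
    simp [BimodRep.dualTensor_apply, Finsupp.single_eq_of_ne hs]
  · exact fun h => absurd (Finset.mem_univ _) h

theorem sum_dualRight_apply {i : Fin X.t} {n : ℕ} (u : Module.Basis (Fin n) (X.D i) (X.rep i).U)
    (d : Fin n → X.D i) (r : Fin n) :
    (∑ s, BimodRep.dualRight (u.coord s) (d s)) (u r) = d r := by
  rw [LinearMap.sum_apply, Finset.sum_eq_single r]
  · simp [BimodRep.dualRight_apply]
  · intro s _ hs
    simp [BimodRep.dualRight_apply, Finsupp.single_eq_of_ne hs]
  · exact fun h => absurd (Finset.mem_univ _) h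

variable (u : ∀ i, Module.Basis (Fin (X.e i)) (X.D i) (X.rep i).U)

/-- Membership in the radical means a vanishing F-entry, leaving entries in the U_i^∨ and in W. A
lift h of the W-entry to ⨁ Hom(U_i, V_i) and the U^∨-entry are both prescribed by their values on
the bases of the U_i, and these values are the coordinates of the preimage. -/
theorem coverF_exact (hX : ∀ i, (X.rep i).IsBrick) (hX' : ∀ i, Nontrivial (X.D i)) :
    Function.Exact (coverF fun i s => (u i).coord s)
      (Module.jacobson X.CDAlgebraᵐᵒᵖ (rightIdeal (idem .F : X.CDAlgebra))).mkQ := by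
  intro y
  rw [(localIdempotent hX hX' .F).mkQ_eq_zero]
  constructor
  · intro hy
    replace hy : y.1.cF = 0 := hy
    obtain ⟨h, hh⟩ := (LinearMap.range X.theta).mkQ_surjective y.1.cW
    refine ⟨fun i s => armRow (X.one i) (unitBlock (le_refl (X.one i)) (y.1.cU i (u i s))) (h i (u i s)),
      projective_F_ext ?_ ?_ ?_⟩
    · rw [coverF_cF, hy]
    · funext i
      rw [coverF_cU]
      simp only [armRow_cD, unitBlock_apply, and_self, if_true]
      exact sum_coord_dualRight (u i) (y.1.cU i)
    · rw [coverF_cW, ← hh]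
      congr 1
      funext i
      refine (u i).ext fun r => ?_
      simp only [armRow_cV]
      exact sum_coord_dualTensor (u i) (fun s => h i (u i s)) r
  · rintro ⟨b, rfl⟩
    exact coverF_cF (fun i s => (u i).coord s) b

variable {n : ℕ} (m : Module.Basis (Fin n) Gᵐᵒᵖ M)

/-- The map `(e_G B)^n ⟶ ⨁ (e_i(1) B)^{e_i}`. -/
def syzygyF : (Fin n → rightIdeal (idem .G : X.CDAlgebra)) →ₗ[X.CDAlgebraᵐᵒᵖ] CoverF X :=
  LinearMap.pi fun i => LinearMap.pi fun s =>
    sumLeftMul (idem .G) fun r => armV (X.one i) ((X.rep i).ρ (u i s) (m r))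

theorem syzygyF_cD (x : Fin n → rightIdeal (idem .G : X.CDAlgebra)) (i : Fin X.t)
    (s : Fin (X.e i)) : (syzygyF u m x i s).1.cD i = 0 := by
  change (sumLeftMul (idem .G) (fun r => armV (X.one i) ((X.rep i).ρ (u i s) (m r))) x).1.cD i = 0
  rw [coe_sumLeftMul, sum_armV_mul_cD]

theorem syzygyF_cV (x : Fin n → rightIdeal (idem .G : X.CDAlgebra)) (i : Fin X.t)
    (s : Fin (X.e i)) : (syzygyF u m x i s).1.cV i (X.one i) =
      (X.rep i).ρ (u i s) (∑ r, op (x r).1.cG • m r) := by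
  change (sumLeftMul (idem .G) (fun r => armV (X.one i) ((X.rep i).ρ (u i s) (m r))) x).1.cV i
    (X.one i) = _
  rw [coe_sumLeftMul, sum_armV_mul_cV _ _ _ fun r => cV_eq_zero (x r), map_sum]
  exact Finset.sum_congr rfl fun r _ => ((X.rep i).map_right _ _ _).symm

theorem theta_eq_iff (h : ∀ i, (X.rep i).HomUV) (z : M) :
    X.theta z = h ↔ ∀ i s, (X.rep i).ρ (u i s) z = h i (u i s) :=
  ⟨fun e i s => by rw [← e]; rfl, fun e => funext fun i => (u i).ext fun s => e i s⟩

/-- An element of (e_G B)^n is the coordinate vector of some z ∈ M, and its image lists the values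
of θ₀ z on the bases of the U_i. -/
theorem syzygyF_injective (hθ : Function.Injective X.theta) :
    Function.Injective (syzygyF u m) := by
  rw [injective_iff_map_eq_zero]
  intro x hx
  have h : X.theta (∑ r, op (x r).1.cG • m r) = 0 := by
    rw [theta_eq_iff u]
    intro i s
    rw [← syzygyF_cV u m, hx]
    rfl
  have h' := Fintype.linearIndependent_iff.1 m.linearIndependent _
    ((map_eq_zero_iff _ hθ).1 h)
  funext r
  exact projective_G_ext (op_injective (h' r))

/-- In the kernel of the cover, the U^∨-part forces the D_i-entries to vanish, as the dual basis is
independent. The W-part says that the V_i-entries, read as an element of ⨁ Hom(U_i, V_i), lie in the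
image of θ₀. The G-coordinates of a preimage z ∈ M give the required element. -/
theorem syzygyF_exact :
    Function.Exact (syzygyF u m) (coverF fun i s => (u i).coord s) := by
  intro b
  constructor
  · intro hb
    have hD : ∀ i s, ((b i s).1.cD i).1 (X.one i) (X.one i) = 0 := by
      intro i s
      have h := coverF_cU (fun i s => (u i).coord s) b i
      rw [hb] at h
      rw [← sum_dualRight_apply (u i) (fun s => ((b i s).1.cD i).1 (X.one i) (X.one i)) s, ← h]
      rfl
    have hW := coverF_cW (fun i s => (u i).coord s) b
    rw [hb] at hW
    obtain ⟨z, hz⟩ := (Submodule.Quotient.mk_eq_zero _).1 hW.symm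
    rw [theta_eq_iff u] at hz
    refine ⟨fun r => ofG (unop (m.repr z r)), funext fun i => funext fun s =>
      projective_one_ext ?_ ?_⟩
    · rw [syzygyF_cD, hD]
      rfl
    · rw [syzygyF_cV]
      refine (congr_arg ((X.rep i).ρ (u i s)) (m.sum_repr z)).trans ((hz i s).trans ?_)
      exact sum_coord_dualTensor (u i) _ s
  · rintro ⟨x, rfl⟩
    refine projective_F_ext (coverF_cF _ _) (funext fun i => ?_) ?_
    · rw [coverF_cU]
      refine Finset.sum_eq_zero fun s _ => ?_
      rw [syzygyF_cD]
      exact dualRight_zero_right _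
    · rw [coverF_cW]
      refine (Submodule.Quotient.mk_eq_zero _).2 ⟨∑ r, op (x r).1.cG • m r, ?_⟩
      rw [theta_eq_iff u]
      intro i s
      refine Eq.symm ((sum_coord_dualTensor (u i) _ s).trans ?_)
      exact syzygyF_cV u m x i s

end CDAlgebra
end Datum
end ResolutionF

/-! ### Classes and Euler form -/

section Classes

theorem projective_pi {R ι : Type*} [Ring R] [Finite ι] (N : ι → Type*) [∀ i, AddCommGroup (N i)]
    [∀ i, Module R (N i)] [∀ i, Module.Projective R (N i)] : Module.Projective R (∀ i, N i) := by
  classical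
  have := Fintype.ofFinite ι
  exact Module.Projective.of_equiv (DFinsupp.linearEquivFunOnFintype (R := R) (M := N))

theorem cls_pi {R : Type u} [Ring R] {n : ℕ} (N : Fin n → Type u) [∀ i, AddCommGroup (N i)]
    [∀ i, Module Rᵐᵒᵖ (N i)] [∀ i, Module.Finite Rᵐᵒᵖ (N i)] :
    cls (FGModuleCat.of Rᵐᵒᵖ (∀ i, N i)) = ∑ i, cls (FGModuleCat.of Rᵐᵒᵖ (N i)) := by
  induction n with
  | zero =>
    have : Subsingleton (FGModuleCat.of Rᵐᵒᵖ (∀ i, N i)).obj :=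
      inferInstanceAs (Subsingleton (∀ i, N i))
    rw [cls_eq_zero, Finset.univ_eq_empty, Finset.sum_empty]
  | succ n ih =>
    rw [Fin.sum_univ_succ, ← ih fun i => N i.succ]
    refine cls_eq_add (X := FGModuleCat.of Rᵐᵒᵖ (N 0)) (Y := FGModuleCat.of Rᵐᵒᵖ (∀ i, N i))
      (Z := FGModuleCat.of Rᵐᵒᵖ (∀ i : Fin n, N i.succ)) (LinearMap.single Rᵐᵒᵖ N 0)
      (LinearMap.pi fun i : Fin n => LinearMap.proj i.succ) (Pi.single_injective (M := N) 0) ?_ ?_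
    · intro (y : ∀ i, N i)
      constructor
      · intro h
        refine ⟨y 0, funext fun i => ?_⟩
        refine Fin.cases ?_ (fun j => ?_) i
        · exact Pi.single_eq_same (M := N) 0 (y 0)
        · exact (Pi.single_eq_of_ne (M := N) (Fin.succ_ne_zero j) (y 0)).trans
            (congr_fun h j).symm
      · rintro ⟨x, rfl⟩
        exact funext fun j => Pi.single_eq_of_ne (M := N) (Fin.succ_ne_zero j) x
    · intro (z : ∀ i : Fin n, N i.succ)
      exact ⟨(Fin.cons 0 z : ∀ i, N i), rfl⟩

theorem cls_pi_const {R : Type u} [Ring R] (n : ℕ) (N : Type u) [AddCommGroup N]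
    [Module Rᵐᵒᵖ N] [Module.Finite Rᵐᵒᵖ N] :
    cls (FGModuleCat.of Rᵐᵒᵖ (Fin n → N)) = n • cls (FGModuleCat.of Rᵐᵒᵖ N) := by
  rw [cls_pi fun _ : Fin n => N, Finset.sum_const, Finset.card_univ, Fintype.card_fin]

/-! ### Linear algebra over rings whose non-zero elements are units -/

section Division

variable (k : Type*) {D U : Type*} [Field k] [Ring D] [Algebra k D] [Nontrivial D]
  [AddCommGroup U] [Module D U] [Module k U] [IsScalarTower k D U]

/-- The endomorphism ring of a brick is given only as a ring; a division ring structure extending it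
is introduced inside the proof. -/
theorem nonempty_basis (hD : ∀ d : D, d ≠ 0 → IsUnit d) [Module.Finite D U] :
    Nonempty (Module.Basis (Fin (Module.finrank D U)) D U) := by
  let := DivisionRing.ofIsUnitOrEqZero (R := D) fun a => by
    by_cases h : a = 0
    · exact Or.inr h
    · exact Or.inl (hD a h)
  exact ⟨Module.finBasis D U⟩

theorem finrank_mul_finrank_of_isUnit (hD : ∀ d : D, d ≠ 0 → IsUnit d) [Module.Finite D U] :
    Module.finrank k D * Module.finrank D U = Module.finrank k U := by
  let := DivisionRing.ofIsUnitOrEqZero (R := D) fun a => by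
    by_cases h : a = 0
    · exact Or.inr h
    · exact Or.inl (hD a h)
  exact Module.finrank_mul_finrank k D U

end Division

variable {k F G M : Type u} [Field k] [DivisionRing F] [DivisionRing G]
  [Algebra k F] [Algebra k G] [AddCommGroup M] [Module k M] [Module F M] [Module Gᵐᵒᵖ M]

namespace Datum

variable {X : Datum k F G M}

namespace CDAlgebra

instance (x : X.Vertex) : Module.Finite X.CDAlgebraᵐᵒᵖ (rightIdeal (idem x : X.CDAlgebra)) :=
  inferInstanceAs (Module.Finite X.CDAlgebraᵐᵒᵖ (projective x))

instance (x : X.Vertex) : Module.Projective X.CDAlgebraᵐᵒᵖ (rightIdeal (idem x : X.CDAlgebra)) :=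
  projective_rightIdeal (idem_mul_idem x)

instance : Module.Projective X.CDAlgebraᵐᵒᵖ (CoverF X) :=
  have (i : Fin X.t) : Module.Projective X.CDAlgebraᵐᵒᵖ
    (Fin (X.e i) → rightIdeal (idem (.arm i (X.one i)) : X.CDAlgebra)) := projective_pi _
  projective_pi _

instance (n : ℕ) (x : X.Vertex) : Module.Projective X.CDAlgebraᵐᵒᵖ
    (Fin n → rightIdeal (idem x : X.CDAlgebra)) := projective_pi _

/-- The module `e_x B`. -/
abbrev projObj (x : X.Vertex) : FGModuleCat.{u} X.CDAlgebraᵐᵒᵖ :=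
  FGModuleCat.of X.CDAlgebraᵐᵒᵖ (rightIdeal (idem x : X.CDAlgebra))

/-- The radical of `e_F B`. -/
abbrev radF (X : Datum k F G M) : Submodule X.CDAlgebraᵐᵒᵖ (rightIdeal (idem .F : X.CDAlgebra)) :=
  Module.jacobson X.CDAlgebraᵐᵒᵖ (rightIdeal (idem .F : X.CDAlgebra))

/-- Splits the resolution of S_F at the radical K of e_F B into two short exact sequences, to which
the long exact sequences and the relations of K₀ apply. -/
theorem exists_exact_corestrict {R P Q N : Type*} [Ring R] [AddCommGroup P] [AddCommGroup Q]
    [AddCommGroup N] [Module R P] [Module R Q] [Module R N] {K : Submodule R N} {f : P →ₗ[R] Q}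
    {g : Q →ₗ[R] N} (h : Function.Exact f g) (h' : Function.Exact g K.mkQ) :
    ∃ g' : Q →ₗ[R] K, Function.Exact f g' ∧ Function.Surjective g' := by
  have hg : ∀ q, g q ∈ K := fun q =>
    (Submodule.Quotient.mk_eq_zero K).1 (h'.apply_apply_eq_zero q)
  refine ⟨g.codRestrict K hg, fun q => ?_, fun ⟨y, hy⟩ => ?_⟩
  · rw [← h q]
    exact ⟨fun e => congr_arg Subtype.val e, fun e => Subtype.ext e⟩
  · obtain ⟨q, rfl⟩ := (h' y).1 ((Submodule.Quotient.mk_eq_zero K).2 hy)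
    exact ⟨q, rfl⟩

theorem exact_subtype_mkQ {R N : Type*} [Ring R] [AddCommGroup N] [Module R N]
    (K : Submodule R N) : Function.Exact K.subtype K.mkQ := by
  intro y
  simp

theorem exists_pred {i : Fin X.t} {a : X.Arm i} (ha : a ≠ X.one i) :
    ∃ b : X.Arm i, b ≤ a ∧ b.1 + 1 = a.1 := by
  have h := Finset.mem_Icc.1 a.2
  have h' : a.1 ≠ 1 := fun e => ha (Subtype.ext e)
  refine ⟨⟨a.1 - 1, Finset.mem_Icc.2 ⟨by omega, by omega⟩⟩, ?_, ?_⟩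
  · change a.1 - 1 ≤ a.1
    omega
  · change a.1 - 1 + 1 = a.1
    omega

/-! ### Resolutions of the simple modules and relations in K₀ -/

section Sequences

/-- The row of G has a single entry, which χ reads off, so e_G B has zero radical and S_G is
projective. -/
theorem topEquivG (hX : ∀ i, (X.rep i).IsBrick) (hX' : ∀ i, Nontrivial (X.D i)) :
    Nonempty ((simple (X := X) .G).obj ≃ₗ[X.CDAlgebraᵐᵒᵖ] (projObj (X := X) .G).obj) := by
  refine ⟨Submodule.quotEquivOfEqBot _ ?_⟩
  change Module.jacobson X.CDAlgebraᵐᵒᵖ (rightIdeal (idem .G : X.CDAlgebra)) = ⊥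
  rw [(localIdempotent hX hX' .G).jacobson_eq, LinearMap.ker_eq_bot']
  exact fun b hb => projective_G_ext hb

/-! ### Finiteness of Ext -/

section Finiteness

variable [Module.Finite k F] [Module.Finite k G] [Module.Finite k M]

/-- Each simple module has a finite resolution by finitely generated projectives: of length two at
F, zero at G, and one on the arms. -/
theorem isExtFinite_simple (hX : ∀ i, (X.rep i).IsBrick) (hX' : ∀ i, Nontrivial (X.D i))
    (u : ∀ i, Module.Basis (Fin (X.e i)) (X.D i) (X.rep i).U)
    (v : ∀ i, Module.Basis (Fin (X.f i)) Gᵐᵒᵖ (X.rep i).V)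
    {n : ℕ} (m : Module.Basis (Fin n) Gᵐᵒᵖ M) (hθ : Function.Injective X.theta)
    (Y : FGModuleCat.{u} X.CDAlgebraᵐᵒᵖ) (x : X.Vertex) :
    IsExtFinite k (simple x).obj Y.obj := by
  have hP : ∀ (P : Type u) [AddCommGroup P] [Module X.CDAlgebraᵐᵒᵖ P]
      [Module.Finite X.CDAlgebraᵐᵒᵖ P] [Module.Projective X.CDAlgebraᵐᵒᵖ P],
      IsExtFinite k (ModuleCat.of X.CDAlgebraᵐᵒᵖ P) Y.obj := by
    intro P _ _ _ hP
    have : Projective (ModuleCat.of X.CDAlgebraᵐᵒᵖ P) := (IsProjective.iff_projective P).1 hP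
    exact isExtFinite_of_projective _ _
  cases x with
  | F =>
    obtain ⟨g, h1, h2⟩ := exists_exact_corestrict (syzygyF_exact u m) (coverF_exact u hX hX')
    have hK : IsExtFinite k (ModuleCat.of X.CDAlgebraᵐᵒᵖ (radF X)) Y.obj :=
      IsExtFinite.of_X₁_X₂ (shortComplex_shortExact (syzygyF u m) g h1
        (syzygyF_injective u m hθ) h2) Y.obj (hP _) (hP _)
    exact IsExtFinite.of_X₁_X₂ (shortComplex_shortExact (radF X).subtype (radF X).mkQ
      (exact_subtype_mkQ _) (radF X).injective_subtype (radF X).mkQ_surjective) Y.obj hK (hP _)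
  | G =>
    obtain ⟨e⟩ := topEquivG hX hX'
    have : Module.Projective X.CDAlgebraᵐᵒᵖ (simple (X := X) .G).obj :=
      Module.Projective.of_equiv e.symm
    exact hP (simple (X := X) .G).obj
  | arm i a =>
    rcases eq_or_ne a (X.one i) with rfl | ha
    · exact IsExtFinite.of_X₁_X₂ (shortComplex_shortExact _ _ (radOne_exact hX hX' (v i))
        (radOne_injective (v i)) (Submodule.mkQ_surjective _)) Y.obj (hP _) (hP _)
    · obtain ⟨b, h, hab⟩ := exists_pred ha
      exact IsExtFinite.of_X₁_X₂ (shortComplex_shortExact _ _ (armInclusion_exact hX hX' h hab)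
        (armInclusion_injective h) (Submodule.mkQ_surjective _)) Y.obj (hP _) (hP _)

theorem hasFiniteExt (hX : ∀ i, (X.rep i).IsBrick) (hX' : ∀ i, Nontrivial (X.D i))
    (u : ∀ i, Module.Basis (Fin (X.e i)) (X.D i) (X.rep i).U)
    (v : ∀ i, Module.Basis (Fin (X.f i)) Gᵐᵒᵖ (X.rep i).V)
    {n : ℕ} (m : Module.Basis (Fin n) Gᵐᵒᵖ M) (hθ : Function.Injective X.theta) :
    HasFiniteExt k X.CDAlgebra := fun Y Z =>
  isExtFinite_of_isFiniteLength k simple (exists_equiv_top hX hX') Z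
    (isExtFinite_simple hX hX' u v m hθ Z) (isFiniteLength_of_finite k Y.obj)

end Finiteness

theorem cls_simple_G (hX : ∀ i, (X.rep i).IsBrick) (hX' : ∀ i, Nontrivial (X.D i)) :
    cls (simple (X := X) .G) = cls (projObj .G) :=
  cls_congr (topEquivG hX hX').some

theorem cls_simple_one (hX : ∀ i, (X.rep i).IsBrick) (hX' : ∀ i, Nontrivial (X.D i))
    {i : Fin X.t} (v : Module.Basis (Fin (X.f i)) Gᵐᵒᵖ (X.rep i).V) :
    cls (projObj (.arm i (X.one i))) =
      X.f i • cls (projObj .G) + cls (simple (.arm i (X.one i))) := by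
  rw [← cls_pi_const]
  exact cls_eq_add (X := FGModuleCat.of X.CDAlgebraᵐᵒᵖ (Fin (X.f i) → rightIdeal (idem .G)))
    (Y := projObj (.arm i (X.one i))) (Z := simple (.arm i (X.one i))) _ _
    (radOne_injective v) (radOne_exact hX hX' v) (Submodule.mkQ_surjective _)

theorem cls_simple_succ (hX : ∀ i, (X.rep i).IsBrick) (hX' : ∀ i, Nontrivial (X.D i))
    {i : Fin X.t} {a b : X.Arm i} (h : b ≤ a) (hab : b.1 + 1 = a.1) :
    cls (projObj (.arm i a)) = cls (projObj (.arm i b)) + cls (simple (.arm i a)) :=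
  cls_eq_add (X := projObj (.arm i b))
    (Y := projObj (.arm i a)) (Z := simple (.arm i a)) _ _
    (armInclusion_injective h) (armInclusion_exact hX hX' h hab) (Submodule.mkQ_surjective _)

theorem cls_coverF : cls (FGModuleCat.of X.CDAlgebraᵐᵒᵖ (CoverF X)) =
    ∑ i, X.e i • cls (projObj (.arm i (X.one i))) :=
  (cls_pi _).trans (Finset.sum_congr rfl fun _ _ => cls_pi_const _ _)

/-- The alternating sum along the resolution of S_F, arranged so that no signs occur. -/
theorem cls_simple_F (hX : ∀ i, (X.rep i).IsBrick) (hX' : ∀ i, Nontrivial (X.D i))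
    (u : ∀ i, Module.Basis (Fin (X.e i)) (X.D i) (X.rep i).U)
    {n : ℕ} (m : Module.Basis (Fin n) Gᵐᵒᵖ M) (hθ : Function.Injective X.theta) :
    cls (projObj .F) + n • cls (projObj .G) =
      (∑ i, X.e i • cls (projObj (.arm i (X.one i)))) + cls (simple .F) := by
  obtain ⟨g, h1, h2⟩ := exists_exact_corestrict (syzygyF_exact u m) (coverF_exact u hX hX')
  have : Module.Finite X.CDAlgebraᵐᵒᵖ (radF X) := Module.Finite.of_surjective g h2
  have hK := cls_eq_add
    (X := FGModuleCat.of X.CDAlgebraᵐᵒᵖ (Fin n → rightIdeal (idem .G : X.CDAlgebra)))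
    (Y := FGModuleCat.of X.CDAlgebraᵐᵒᵖ (CoverF X))
    (Z := FGModuleCat.of X.CDAlgebraᵐᵒᵖ (radF X)) (syzygyF u m) g (syzygyF_injective u m hθ) h1 h2
  have hF := cls_eq_add (X := FGModuleCat.of X.CDAlgebraᵐᵒᵖ (radF X))
    (Y := projObj .F) (Z := simple .F) (radF X).subtype (radF X).mkQ
    (radF X).injective_subtype (exact_subtype_mkQ _) (radF X).mkQ_surjective
  rw [cls_coverF, cls_pi_const] at hK
  rw [hF, hK]
  abel

end Sequences

/-! ### Pairing projective with simple modules -/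

section Values

variable [Module.Finite k F] [Module.Finite k G]
  {E : K0 X.CDAlgebra →+ K0 X.CDAlgebra →+ ℤ}

theorem euler_projective_self (hX : ∀ i, (X.rep i).IsBrick) (hX' : ∀ i, Nontrivial (X.D i))
    (hE : IsEulerForm k E) (x : X.Vertex) :
    E (cls (projObj x)) (cls (simple x)) = Module.finrank k (localIdempotent hX hX' x).D :=
  (hE _ _).trans (localIdempotent hX hX' x).gradedChar_self

theorem euler_projective_of_ne (hX : ∀ i, (X.rep i).IsBrick) (hX' : ∀ i, Nontrivial (X.D i))
    (hE : IsEulerForm k E) {x y : X.Vertex} (h : x ≠ y) :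
    E (cls (projObj x)) (cls (simple y)) = 0 :=
  (hE _ _).trans ((localIdempotent hX hX' y).gradedChar_eq_zero (idem_mul_idem x)
    (idem_mul_idem_of_ne h.symm))

theorem finrank_localIdempotent_ne_zero (hX : ∀ i, (X.rep i).IsBrick)
    (hX' : ∀ i, Nontrivial (X.D i)) (x : X.Vertex) :
    Module.finrank k (localIdempotent hX hX' x).D ≠ 0 := by
  have : Module.Finite k (localIdempotent hX hX' x).D :=
    Module.Finite.of_surjective (localIdempotent hX hX' x).χ.toLinearMap fun d => by
      obtain ⟨b, -, -, h⟩ := (localIdempotent hX hX' x).surj d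
      exact ⟨b, h⟩
  exact (Module.finrank_pos (R := k) (M := (localIdempotent hX hX' x).D)).ne'

/-- The classes of the e_x B pair diagonally with those of the simples, with non-zero diagonal
entries, and so detect every coefficient. -/
theorem linearIndependent_cls_simple (hX : ∀ i, (X.rep i).IsBrick)
    (hX' : ∀ i, Nontrivial (X.D i)) (hE : IsEulerForm k E) :
    LinearIndependent ℤ fun x : X.Vertex => cls (simple x) := by
  rw [Fintype.linearIndependent_iff]
  intro g hg x
  have h := congr_arg (E (cls (projObj x))) hg
  rw [map_sum, map_zero, Finset.sum_eq_single x] at h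
  · rw [map_zsmul, euler_projective_self hX hX' hE, smul_eq_mul] at h
    exact (mul_eq_zero.1 h).resolve_right
      (Nat.cast_ne_zero.2 (finrank_localIdempotent_ne_zero hX hX' x))
  · intro y _ hy
    rw [map_zsmul, euler_projective_of_ne hX hX' hE hy.symm, smul_zero]
  · exact fun h => absurd (Finset.mem_univ _) h

end Values
end CDAlgebra
end Datum
end Classes

/-! ### The values of the Euler form -/

section EulerValues

variable {k F G M : Type u} [Field k] [DivisionRing F] [DivisionRing G]
  [Algebra k F] [Algebra k G] [AddCommGroup M] [Module k M] [Module F M] [Module Gᵐᵒᵖ M]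
  [Module.Finite k F] [Module.Finite k G] [Module.Finite k M] [IsScalarTower k F M]
  [IsScalarTower k Gᵐᵒᵖ M] [SMulCommClass F Gᵐᵒᵖ M]

namespace BimodRep

variable {X : BimodRep k F G M}

theorem IsRegularSimple.nontrivial_end (hX : X.IsRegularSimple) : Nontrivial X.End := by
  by_contra h
  rw [not_nontrivial_iff_subsingleton] at h
  refine hX.2.1 ⟨?_, ?_⟩
  · refine (Submodule.eq_bot_iff _).2 fun x _ => ?_
    rw [← one_smul X.End x, Subsingleton.elim (1 : X.End) 0, zero_smul]
  · refine (Submodule.eq_bot_iff _).2 fun x _ => ?_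
    rw [← one_smul X.End x, Subsingleton.elim (1 : X.End) 0, zero_smul]

/-- Defect zero and ε > 0 make the two dimensions vanish together, and then X would be zero. -/
theorem IsRegularSimple.finrank_pos (hM : IsTame F G M)
    (hX : X.IsRegularSimple) :
    0 < Module.finrank Fᵐᵒᵖ X.U ∧ 0 < Module.finrank Gᵐᵒᵖ X.V := by
  have hε := hM.epsilon_pos
  have hd := hX.isIndecomposable.2
  by_contra! h
  have h0 : Module.finrank Fᵐᵒᵖ X.U = 0 ∧ Module.finrank Gᵐᵒᵖ X.V = 0 := by
    rcases Nat.eq_zero_or_pos (Module.finrank Fᵐᵒᵖ X.U) with h1 | h1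
    · refine ⟨h1, ?_⟩
      rw [h1, Nat.cast_zero, eq_comm, mul_eq_zero] at hd
      exact_mod_cast hd.resolve_left hε.ne'
    · have h2 := Nat.le_zero.1 (h h1)
      rw [h2, Nat.cast_zero, mul_zero] at hd
      exact absurd (by exact_mod_cast hd) h1.ne'
  have h1 : Subsingleton X.U := (Module.finrank_eq_zero_iff_of_free Fᵐᵒᵖ X.U).1 h0.1
  have h2 : Subsingleton X.V := (Module.finrank_eq_zero_iff_of_free Gᵐᵒᵖ X.V).1 h0.2
  exact hX.2.1 ⟨(Submodule.eq_bot_iff _).2 fun x _ => Subsingleton.elim _ _,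
    (Submodule.eq_bot_iff _).2 fun x _ => Subsingleton.elim _ _⟩

end BimodRep

namespace Datum

variable {X : Datum k F G M}

/-- Compute dim_k U_i over D_i and over F; defect zero replaces dim (U_i)_F by ε f_i. -/
theorem finrank_D_mul_e (hM : IsTame F G M)
    (hreg : ∀ i, (X.rep i).IsRegularSimple) (i : Fin X.t) :
    (Module.finrank k (X.D i) : ℝ) * X.e i = epsilon F G M * X.f i * Module.finrank k F := by
  have := (hreg i).nontrivial_end
  have h1 := finrank_mul_finrank_of_isUnit k (D := X.D i) (U := (X.rep i).U)
    ((hreg i).isBrick hM)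
  have h2 := finrank_eq_mul_right (k := k) (F := F) (X.rep i).U
  have h3 := (hreg i).isIndecomposable.2
  rw [Datum.e, Datum.f, ← Nat.cast_mul, h1, h2, Nat.cast_mul, h3]
  ring

theorem e_pos_and_f_pos (hM : IsTame F G M)
    (hreg : ∀ i, (X.rep i).IsRegularSimple) (i : Fin X.t) : 0 < X.e i ∧ 0 < X.f i := by
  have hf : 0 < X.f i := ((hreg i).finrank_pos hM).2
  refine ⟨Nat.pos_of_ne_zero fun h => ?_, hf⟩
  have := finrank_D_mul_e hM hreg i
  rw [h, Nat.cast_zero, mul_zero, eq_comm] at this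
  have hε := hM.epsilon_pos
  have hd : 0 < Module.finrank k F := Module.finrank_pos
  exact this.not_gt (by positivity)

namespace CDAlgebra

variable {E : K0 X.CDAlgebra →+ K0 X.CDAlgebra →+ ℤ}

/-- Lets dimensions of Hom out of projectives be read off from the Euler form. -/
theorem finrank_ext_zero (hE : IsEulerForm k E) (P Y : FGModuleCat.{u} X.CDAlgebraᵐᵒᵖ)
    [Projective P.obj] : (Module.finrank k (Abelian.Ext P.obj Y.obj 0) : ℤ) = E (cls P) (cls Y) := by
  rw [hE, eulerChar_eq, gradedChar_of_projective, (Abelian.Ext.linearEquiv₀ (R := k)).finrank_eq]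

open Abelian in
-- Two dimension shifts along the resolution of S_F reduce Ext²(S_F, S_G) to Hom((e_G B)^n, S_G).
-- The isomorphism with M is then obtained from equality of dimensions only.
theorem nonempty_ext_two_equiv (hX : ∀ i, (X.rep i).IsBrick)
    (hX' : ∀ i, Nontrivial (X.D i))
    (u : ∀ i, Module.Basis (Fin (X.e i)) (X.D i) (X.rep i).U)
    (v : ∀ i, Module.Basis (Fin (X.f i)) Gᵐᵒᵖ (X.rep i).V)
    {n : ℕ} (m : Module.Basis (Fin n) Gᵐᵒᵖ M) (hθ : Function.Injective X.theta)
    (hE : IsEulerForm k E) (hn : Module.finrank k M = n * Module.finrank k G) :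
    Nonempty (Ext (simple (X := X) .F).obj (simple (X := X) .G).obj 2 ≃ₗ[k] M) := by
  have hfin := hasFiniteExt hX hX' u v m hθ
  have hproj : ∀ (P : Type u) [AddCommGroup P] [Module X.CDAlgebraᵐᵒᵖ P]
      [Module.Projective X.CDAlgebraᵐᵒᵖ P], Projective (ModuleCat.of X.CDAlgebraᵐᵒᵖ P) :=
    fun P => (IsProjective.iff_projective P).1 inferInstance
  let S : ModuleCat.{u} X.CDAlgebraᵐᵒᵖ := (simple (X := X) .G).obj
  let Q : FGModuleCat.{u} X.CDAlgebraᵐᵒᵖ :=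
    FGModuleCat.of X.CDAlgebraᵐᵒᵖ (Fin n → rightIdeal (idem .G : X.CDAlgebra))
  let C : FGModuleCat.{u} X.CDAlgebraᵐᵒᵖ := FGModuleCat.of X.CDAlgebraᵐᵒᵖ (CoverF X)
  have hQ : Projective Q.obj := hproj (Fin n → rightIdeal (idem .G : X.CDAlgebra))
  have hC : Projective C.obj := hproj (CoverF X)
  have hP : Projective (projObj (X := X) .F).obj := hproj (rightIdeal (idem .F : X.CDAlgebra))
  -- Without this vanishing the first shift, which starts in degree 0, would not be injective.
  have hC0 : Subsingleton (Ext C.obj S 0) := by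
    have h := finrank_ext_zero hE C (simple .G)
    rw [cls_coverF, map_sum, AddMonoidHom.finsetSum_apply, Finset.sum_eq_zero] at h
    · have := (hfin C (simple .G)).1 0
      exact Module.finrank_zero_iff.1 (Nat.cast_eq_zero.1 h)
    · intro i _
      rw [map_nsmul, AddMonoidHom.nsmul_apply, euler_projective_of_ne hX hX' hE (by simp),
        smul_zero]
  have hQ0 : Module.finrank k (Ext Q.obj S 0) = Module.finrank k M := by
    have h := finrank_ext_zero hE Q (simple .G)
    rw [cls_pi_const, map_nsmul, AddMonoidHom.nsmul_apply, euler_projective_self hX hX' hE,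
      nsmul_eq_mul, ← Nat.cast_mul] at h
    exact (Nat.cast_injective h).trans hn.symm
  obtain ⟨g, h1, h2⟩ := exists_exact_corestrict (syzygyF_exact u m) (coverF_exact u hX hX')
  have e1 : Ext Q.obj S 0 ≃ₗ[k] Ext (ModuleCat.of X.CDAlgebraᵐᵒᵖ (radF X)) S 1 :=
    extContraEquiv (shortComplex_shortExact (syzygyF u m) g h1 (syzygyF_injective u m hθ) h2) S 0
      hC0 (subsingleton_ext_of_projective C.obj S one_ne_zero)
  have e2 : Ext (ModuleCat.of X.CDAlgebraᵐᵒᵖ (radF X)) S 1 ≃ₗ[k] Ext (simple (X := X) .F).obj S 2 :=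
    extContraEquiv (shortComplex_shortExact (radF X).subtype (radF X).mkQ
      (exact_subtype_mkQ _) (radF X).injective_subtype (radF X).mkQ_surjective) S 1
      (subsingleton_ext_of_projective (projObj (X := X) .F).obj S one_ne_zero)
      (subsingleton_ext_of_projective (projObj (X := X) .F).obj S two_ne_zero)
  have := (hfin Q (simple .G)).1 0
  exact ⟨(e1.trans e2).symm.trans (LinearEquiv.ofFinrankEq _ _ hQ0)⟩

/-! ### The Euler form on the classes of the simple modules -/

section Values

theorem euler_values (hM : IsTame F G M) (hreg : ∀ i, (X.rep i).IsRegularSimple)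
    (v : ∀ i, Module.Basis (Fin (X.f i)) Gᵐᵒᵖ (X.rep i).V)
    (u : ∀ i, Module.Basis (Fin (X.e i)) (X.D i) (X.rep i).U)
    (m : Module.Basis (Fin (Module.finrank Gᵐᵒᵖ M)) Gᵐᵒᵖ M) (hθ : Function.Injective X.theta)
    (hE : IsEulerForm k E) :
    let ε : ℝ := epsilon F G M
    let d : ℝ := Module.finrank k F
    let b : X.Vertex → X.Vertex → ℝ := fun x y => (E (cls (simple x)) (cls (simple y)) : ℤ)
    b .F .F = d ∧
      (∀ i j, b .F (.arm i j) = if j.1 = 1 then -(ε * X.f i * d) else 0) ∧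
      b .F .G = 2 * ε * d ∧
      (∀ i j, b (.arm i j) .F = 0) ∧
      (∀ i j j', b (.arm i j) (.arm i j') =
        if j.1 = j'.1 then ε * X.f i / X.e i * d
        else if j.1 = j'.1 + 1 then -(ε * X.f i / X.e i * d) else 0) ∧
      (∀ i i' j j', i ≠ i' → b (.arm i j) (.arm i' j') = 0) ∧
      (∀ i j, b (.arm i j) .G = if j.1 = 1 then -(ε ^ 2 * X.f i * d) else 0) ∧
      b .G .F = 0 ∧
      (∀ i j, b .G (.arm i j) = 0) ∧
      b .G .G = ε ^ 2 * d := by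
  intro ε d b
  have hX : ∀ i, (X.rep i).IsBrick := fun i => (hreg i).isBrick hM
  have hX' : ∀ i, Nontrivial (X.D i) := fun i => (hreg i).nontrivial_end
  -- The pairing of projectives with simples is diagonal; every row of b is a combination of rows of
  -- p, with coefficients given by the resolutions.
  let p : X.Vertex → X.Vertex → ℝ := fun x y => (E (cls (projObj x)) (cls (simple y)) : ℤ)
  have hpne : ∀ {x y}, x ≠ y → p x y = 0 := fun h => by
    rw [← Int.cast_zero, ← euler_projective_of_ne hX hX' hE h]
  have hpF : p .F .F = d := by
    simp only [p, d, euler_projective_self hX hX' hE, Int.cast_natCast]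
    rfl
  have hpG : p .G .G = ε ^ 2 * d := by
    simp only [p, d, euler_projective_self hX hX' hE, Int.cast_natCast]
    have h := hM.finrank_right_algebra (k := k)
    exact h
  have hpA : ∀ i j, p (.arm i j) (.arm i j) = ε * X.f i / X.e i * d := by
    intro i j
    have he : (X.e i : ℝ) ≠ 0 := Nat.cast_ne_zero.2 (e_pos_and_f_pos hM hreg i).1.ne'
    have h := finrank_D_mul_e hM hreg i
    have h' : p (.arm i j) (.arm i j) = Module.finrank k (X.D i) := by
      simp only [p, euler_projective_self hX hX' hE, Int.cast_natCast]
      rfl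
    rw [h', div_mul_eq_mul_div, eq_div_iff he, h]
  have bG : ∀ y, b .G y = p .G y := fun y => by
    simp only [b, p, cls_simple_G hX hX']
  have bOne : ∀ i y, b (.arm i (X.one i)) y = p (.arm i (X.one i)) y - X.f i * p .G y := by
    intro i y
    have h := congr_arg (fun z => ((E z (cls (simple y)) : ℤ) : ℝ)) (cls_simple_one hX hX' (v i))
    simp only [map_add, map_nsmul, AddMonoidHom.add_apply, AddMonoidHom.nsmul_apply, nsmul_eq_mul,
      Int.cast_add, Int.cast_mul, Int.cast_natCast] at h
    simp only [b, p]
    linarith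
  have bSucc : ∀ i {a c : X.Arm i}, c ≤ a → c.1 + 1 = a.1 → ∀ y,
      b (.arm i a) y = p (.arm i a) y - p (.arm i c) y := by
    intro i a c hca hca' y
    have h := congr_arg (fun z => ((E z (cls (simple y)) : ℤ) : ℝ))
      (cls_simple_succ hX hX' hca hca')
    simp only [map_add, AddMonoidHom.add_apply, Int.cast_add] at h
    simp only [b, p]
    linarith
  have bF : ∀ y, b .F y = p .F y + Module.finrank Gᵐᵒᵖ M * p .G y -
      ∑ i, X.e i * p (.arm i (X.one i)) y := by
    intro y
    have h := congr_arg (fun z => ((E z (cls (simple y)) : ℤ) : ℝ)) (cls_simple_F hX hX' u m hθ)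
    simp only [map_add, map_nsmul, map_sum, AddMonoidHom.add_apply, AddMonoidHom.nsmul_apply,
      AddMonoidHom.finsetSum_apply, nsmul_eq_mul, Int.cast_add, Int.cast_mul, Int.cast_natCast,
      Int.cast_sum] at h
    simp only [b, p]
    linarith
  have harm : ∀ {i} {j j' : X.Arm i}, j ≠ j' → p (.arm i j) (.arm i j') = 0 := fun h =>
    hpne (by simpa using h)
  have harm' : ∀ {i i'} {j : X.Arm i} {j' : X.Arm i'}, i ≠ i' → p (.arm i j) (.arm i' j') = 0 :=
    fun h => hpne fun e => h (by injection e)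
  have hcases : ∀ {i} (j : X.Arm i), j = X.one i ∨ j.1 ≠ 1 ∧ ∃ c : X.Arm i, c ≤ j ∧ c.1 + 1 = j.1 := by
    intro i j
    rcases eq_or_ne j (X.one i) with h | h
    · exact Or.inl h
    · exact Or.inr ⟨fun e => h (Subtype.ext e), exists_pred h⟩
  refine ⟨?_, ?_, ?_, ?_, ?_, ?_, ?_, ?_, ?_, ?_⟩
  · rw [bF, hpF, hpne (by simp), Finset.sum_eq_zero fun i _ => by rw [hpne (by simp), mul_zero]]
    ring
  · intro i j
    rw [bF, hpne (by simp), hpne (by simp), Finset.sum_eq_single i]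
    · have he : (X.e i : ℝ) ≠ 0 := Nat.cast_ne_zero.2 (e_pos_and_f_pos hM hreg i).1.ne'
      rcases hcases j with rfl | ⟨h, -⟩
      · rw [hpA, if_pos (show (X.one i).1 = 1 from rfl)]
        field_simp
        ring
      · rw [harm (fun e => h (by rw [← e]; rfl)), if_neg h]
        ring
    · intro i' _ hi
      rw [harm' hi, mul_zero]
    · exact fun h => absurd (Finset.mem_univ _) h
  · rw [bF, hpG, hpne (by simp), Finset.sum_eq_zero fun i _ => by rw [hpne (by simp), mul_zero]]
    have h := hM.epsilon_mul_finrank_right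
    -- The two copies of ε come from dim M_G · ε² d, where one factor ε is absorbed by ε dim M_G =
    -- 2.
    linear_combination ε * d * h
  · intro i j
    rcases hcases j with rfl | ⟨-, c, hc, hc'⟩
    · rw [bOne, hpne (by simp), hpne (by simp)]
      ring
    · rw [bSucc i hc hc', hpne (by simp), hpne (by simp), sub_zero]
  · intro i j j'
    rcases hcases j with rfl | ⟨-, c, hc, hc'⟩
    · rw [bOne, hpne (x := .G) (by simp), mul_zero, sub_zero]
      split_ifs with h1 h2
      · rw [← Subtype.ext h1, hpA]
      -- At j = 1 the case j = j' + 1 cannot occur, since arm labels start at 1.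
      · have h3 := (Finset.mem_Icc.1 j'.2).1
        have h4 : 1 = j'.1 + 1 := h2
        omega
      · exact harm fun e => h1 (by rw [e])
    · rw [bSucc i hc hc']
      split_ifs with h1 h2
      · rw [← Subtype.ext h1, hpA, harm fun e => by rw [e] at hc'; omega, sub_zero]
      · have h3 : c = j' := Subtype.ext (by omega)
        rw [h3, hpA, harm fun e => h1 (by rw [e]), zero_sub]
      · rw [harm fun e => h1 (by rw [e]), harm fun e => h2 (by rw [← e, hc']), sub_zero]
  · intro i i' j j' hi
    rcases hcases j with rfl | ⟨-, c, hc, hc'⟩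
    · rw [bOne, harm' hi, hpne (by simp)]
      ring
    · rw [bSucc i hc hc', harm' hi, harm' hi, sub_zero]
  · intro i j
    rcases hcases j with rfl | ⟨h, c, hc, hc'⟩
    · rw [bOne, hpG, hpne (by simp), if_pos (show (X.one i).1 = 1 from rfl)]
      ring
    · rw [bSucc i hc hc', hpne (by simp), hpne (by simp), sub_zero, if_neg h]
  · rw [bG, hpne (by simp)]
  · intro i j
    rw [bG, hpne (by simp)]
  · rw [bG, hpG]

end Values
end CDAlgebra
end Datum
end EulerValues

end

end CoxeterDynkin

/-! ### The main theorem -/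

theorem mainTheorem8 {k F G M : Type u} [Field k] [DivisionRing F] [DivisionRing G]
    [Algebra k F] [Algebra k G] [Module.Finite k F] [Module.Finite k G]
    [AddCommGroup M] [Module k M] [Module F M] [Module Gᵐᵒᵖ M] [Module.Finite k M]
    [IsScalarTower k F M] [IsScalarTower k Gᵐᵒᵖ M] [SMulCommClass F Gᵐᵒᵖ M]
    (hM : CoxeterDynkin.IsTame F G M) (X : CoxeterDynkin.Datum k F G M)
    (hreg : ∀ i, (X.rep i).IsRegularSimple)
    (hiso : ∀ i j, i ≠ j → ¬ (X.rep i).Isomorphic (X.rep j))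
    (hθ : Function.Injective X.theta) :
    -- the modules `S_F`, `S_i(j)`, `S_G` are the simple right `B`-modules, up to isomorphism
    (∀ x : X.Vertex, IsSimpleModule X.CDAlgebraᵐᵒᵖ (CoxeterDynkin.Datum.simple x).obj) ∧
    (∀ T : FGModuleCat.{u} X.CDAlgebraᵐᵒᵖ, IsSimpleModule X.CDAlgebraᵐᵒᵖ T.obj →
      ∃ x : X.Vertex, Nonempty (T ≅ CoxeterDynkin.Datum.simple x)) ∧
    -- their classes form a basis of `K₀(mod-B)`
    LinearIndependent ℤ (fun x : X.Vertex => CoxeterDynkin.cls (CoxeterDynkin.Datum.simple x)) ∧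
    Submodule.span ℤ
      (Set.range fun x : X.Vertex => CoxeterDynkin.cls (CoxeterDynkin.Datum.simple x)) = ⊤ ∧
    -- the Euler form on `K₀(mod-B)` is well defined
    CoxeterDynkin.HasFiniteExt k X.CDAlgebra ∧
    (∃! E : CoxeterDynkin.K0 X.CDAlgebra →+ CoxeterDynkin.K0 X.CDAlgebra →+ ℤ,
      CoxeterDynkin.IsEulerForm k E) ∧
    -- the parameters `e_i`, `f_i` are positive
    (∀ i, 0 < X.e i ∧ 0 < X.f i) ∧
    -- the values of the Euler form in this basis
    (∀ E : CoxeterDynkin.K0 X.CDAlgebra →+ CoxeterDynkin.K0 X.CDAlgebra →+ ℤ,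
      CoxeterDynkin.IsEulerForm k E →
      let ε : ℝ := CoxeterDynkin.epsilon F G M
      let d : ℝ := Module.finrank k F
      let b : X.Vertex → X.Vertex → ℝ := fun x y =>
        (E (CoxeterDynkin.cls (CoxeterDynkin.Datum.simple x))
          (CoxeterDynkin.cls (CoxeterDynkin.Datum.simple y)) : ℤ)
      b .F .F = d ∧
      (∀ i j, b .F (.arm i j) = if j.1 = 1 then -(ε * X.f i * d) else 0) ∧
      b .F .G = 2 * ε * d ∧
      (∀ i j, b (.arm i j) .F = 0) ∧
      (∀ i j j', b (.arm i j) (.arm i j') =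
        if j.1 = j'.1 then ε * X.f i / X.e i * d
        else if j.1 = j'.1 + 1 then -(ε * X.f i / X.e i * d) else 0) ∧
      (∀ i i' j j', i ≠ i' → b (.arm i j) (.arm i' j') = 0) ∧
      (∀ i j, b (.arm i j) .G = if j.1 = 1 then -(ε ^ 2 * X.f i * d) else 0) ∧
      b .G .F = 0 ∧
      (∀ i j, b .G (.arm i j) = 0) ∧
      b .G .G = ε ^ 2 * d) ∧
    -- a projective resolution of `S_F` of length two
    (∀ x : X.Vertex,
      Module.Projective X.CDAlgebraᵐᵒᵖ (CoxeterDynkin.Datum.projective x)) ∧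
    (∃ (α : (Fin (Module.finrank Gᵐᵒᵖ M) →
            CoxeterDynkin.Datum.projective (X := X) .G) →ₗ[X.CDAlgebraᵐᵒᵖ]
          (∀ i, Fin (X.e i) → CoxeterDynkin.Datum.projective (X := X) (.arm i (X.one i))))
        (β : (∀ i, Fin (X.e i) →
            CoxeterDynkin.Datum.projective (X := X) (.arm i (X.one i))) →ₗ[X.CDAlgebraᵐᵒᵖ]
          CoxeterDynkin.Datum.projective (X := X) .F),
      Function.Injective α ∧ Function.Exact α β ∧
      Function.Exact β (Submodule.mkQ (Module.jacobson X.CDAlgebraᵐᵒᵖ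
        (CoxeterDynkin.Datum.projective (X := X) .F)))) ∧
    -- `Ext²(S_F, S_G) ≅ M`
    Nonempty (Abelian.Ext (CoxeterDynkin.Datum.simple (X := X) .F).obj
      (CoxeterDynkin.Datum.simple (X := X) .G).obj 2 ≃ₗ[k] M) := by
  have hX : ∀ i, (X.rep i).IsBrick := fun i => (hreg i).isBrick hM
  have hX' : ∀ i, Nontrivial (X.D i) := fun i => (hreg i).nontrivial_end
  let u : ∀ i, Module.Basis (Fin (X.e i)) (X.D i) (X.rep i).U := fun i =>
    (CoxeterDynkin.nonempty_basis (hX i)).some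
  let v : ∀ i, Module.Basis (Fin (X.f i)) Gᵐᵒᵖ (X.rep i).V := fun i =>
    Module.finBasis Gᵐᵒᵖ (X.rep i).V
  have : Module.Finite Gᵐᵒᵖ M := Module.Finite.of_restrictScalars_finite k Gᵐᵒᵖ M
  let m : Module.Basis (Fin (Module.finrank Gᵐᵒᵖ M)) Gᵐᵒᵖ M := Module.finBasis Gᵐᵒᵖ M
  have hfin := CoxeterDynkin.Datum.CDAlgebra.hasFiniteExt hX hX' u v m hθ
  obtain ⟨E, hE⟩ := CoxeterDynkin.exists_isEulerForm k hfin
  refine ⟨fun x => (CoxeterDynkin.Datum.CDAlgebra.localIdempotent hX hX' x).isSimpleModule_top,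
    fun T hT => ?_, CoxeterDynkin.Datum.CDAlgebra.linearIndependent_cls_simple hX hX' hE,
    CoxeterDynkin.span_cls_eq_top k CoxeterDynkin.Datum.simple
      (CoxeterDynkin.Datum.CDAlgebra.exists_equiv_top hX hX'), hfin,
    ⟨E, hE, fun E' hE' => CoxeterDynkin.IsEulerForm.unique k hE' hE⟩,
    CoxeterDynkin.Datum.e_pos_and_f_pos hM hreg,
    fun E hE => CoxeterDynkin.Datum.CDAlgebra.euler_values hM hreg v u m hθ hE,
    fun x => CoxeterDynkin.projective_rightIdeal
      (CoxeterDynkin.Datum.CDAlgebra.idem_mul_idem x),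
    ⟨CoxeterDynkin.Datum.CDAlgebra.syzygyF u m,
      CoxeterDynkin.Datum.CDAlgebra.coverF fun i s => (u i).coord s,
      CoxeterDynkin.Datum.CDAlgebra.syzygyF_injective u m hθ,
      CoxeterDynkin.Datum.CDAlgebra.syzygyF_exact u m,
      CoxeterDynkin.Datum.CDAlgebra.coverF_exact u hX hX'⟩,
    CoxeterDynkin.Datum.CDAlgebra.nonempty_ext_two_equiv hX hX' u v m hθ hE ?_⟩
  · obtain ⟨x, ⟨e⟩⟩ := CoxeterDynkin.Datum.CDAlgebra.exists_equiv_top hX hX' T.obj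
    exact ⟨x, ⟨e.toFGModuleCatIso⟩⟩
  · rw [← Module.finrank_mul_finrank k Gᵐᵒᵖ M, CoxeterDynkin.finrank_opposite, mul_comm]
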